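/- **Theorem (decay of the degenerate energy).** Fix $M>0$ and $R_0>2M$, and put $D=(1-M/r)^2$. On $\{r\ge M\}$ consider the extremal Reissner–Nordström metric $g=-D\,dv^2+2\,dv\,dr+r^2\gamma_{\mathbb S^2}$, with $T=\partial_v$, $Y=\partial_r$ in the coordinates $(v,r)$, $dr^*/dr=1/D$, $u=v-2r^*$, $t^*=v-r$. For $\tau\ge0$ let $$S_\tau=\{t^*=\tau,\ M\le r\le R_0\},\qquad N_\tau=\{u=u_\tau,\ v\ge v_\tau\},\qquad \Sigma_\tau=S_\tau\cup N_\tau,$$ where $(u_\tau,v_\tau)$ are the values of $u,v$ at the sphere $\{t^*=\tau,\ r=R_0\}$. On $S_\tau$ we use the future unit normal $n$ and the induced volume, on $N_\tau$ the null normal $n=\partial_v|_u=T+\tfrac D2Y$ and the volume $r^2\,dv\,d\omega$. The integrals $\int_{\tau_1}^{\tau_2}\int_{S_\tau}$ and $\int_{\tau_1}^{\tau_2}\int_{N_\tau}$ below are taken against the spacetime volume form. Let $$J^V_\mu[\psi]=\Big(\partial_\mu\psi\,\partial_\nu\psi-\tfrac12 g_{\mu\nu}\,\partial^a\psi\,\partial_a\psi\Big)V^\nu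 .$$ Let $A:\mathbb R\to\mathbb R$ be smooth and bounded together with each of its derivatives, let $0<\mathcal T\le\infty$, and let $\psi=\psi(v,r)$ be a spherically symmetric function, $C^2$ up to the boundary on $\bigcup_{0\le\tau<\mathcal T}\Sigma_\tau$, solving there $$\Box_g\psi=F,\qquad F=A(\psi)\,g^{\alpha\beta}\partial_\alpha\psi\,\partial_\beta\psi=A(\psi)\big(D(Y\psi)^2+2\,T\psi\,Y\psi\big),$$ with $\psi|_{\Sigma_0}$ supported in $\{r\le R_s\}$. Let $\varepsilon>0$, let $n_*$ be the future unit normal of the hypersurfaces $\{t^*=\text{const}\}$, put $\psi_0=\varepsilon^{-1}\psi$ and $\psi_1=\varepsilon^{-1}n_*\psi$ near $\Sigma_0$, and $$E_0=\int_{S_0}\big((Y\psi_0)^2+(T\psi_0)^2\big)+\int_{N_0}\big((T+\tfrac D2Y)\psi_0\big)^2+\int_{\Sigma_0}J^{n}_\mu[\psi_1]n^\mu .$$ Let $0<\alpha<2$ and $C_\alpha>0$, and assume that for all $0\le\tau_0<\mathcal T$ and all $0\le\tau_1<\tau_2<\mathcal T$ $$\text{(A1)}\quad \int_{S_{\tau_0}}|F|^2\le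 C_\alpha E_0\varepsilon^2(1+\tau_0)^{-2+\alpha},$$ $$\text{(A2)}\quad \int_{\tau_1}^{\tau_2}\!\!\int_{S_\tau}|F|^2\le C_\alpha E_0\varepsilon^2(1+\tau_1)^{-2+\alpha},$$ $$\text{(A3)}\quad \int_{\tau_1}^{\tau_2}\!\!\int_{N_\tau}r^{3-\alpha}|F|^2\le C_\alpha E_0\varepsilon^2(1+\tau_1)^{-2+\alpha}.$$ Then for all $0\le\tau<\mathcal T$ $$\int_{\Sigma_\tau}J^T_\mu[\psi]\,n^\mu\le C\,E_0\,\varepsilon^2(1+\tau)^{-2+\alpha},$$ where $C>0$ depends only on $M,R_0,R_s,\alpha,C_\alpha$ (in particular not on $A,\psi,\varepsilon,\mathcal T,\tau$). -/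

import Mathlib

open scoped ENNReal ContDiff

/-! Extremal Reissner-Nordström spacetime of mass `M` in ingoing Eddington-Finkelstein coordinates:
`g = -D dv² + 2 dv dr + r² γ`, with `γ` the round metric of the unit sphere.  A spherically
symmetric function is a function of `p = (v, r)`, and tangent vectors `(X.1, X.2)` stand for
`X.1 ∂_v + X.2 ∂_r`. -/

namespace ExtremalRN

noncomputable section

/-- `D = (1 - M / r)²`. -/
def lapse (M r : ℝ) : ℝ := (1 - M / r) ^ 2

/-- The tortoise coordinate `r*`, normalised by `dr*/dr = 1 / D` for `r > M`; only differences of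
its values matter below. -/
def tortoise (M r : ℝ) : ℝ := r + 2 * M * Real.log (r - M) - M ^ 2 / (r - M)

/-- `T ψ = ∂_v ψ` in the coordinates `(v, r)`. -/
def dT (ψ : ℝ × ℝ → ℝ) (p : ℝ × ℝ) : ℝ := fderiv ℝ ψ p (1, 0)

/-- `Y ψ = ∂_r ψ` in the coordinates `(v, r)`. -/
def dY (ψ : ℝ × ℝ → ℝ) (p : ℝ × ℝ) : ℝ := fderiv ℝ ψ p (0, 1)

/-- The metric `g` on vectors orthogonal to the symmetry spheres. -/
def metric (M : ℝ) (p X Z : ℝ × ℝ) : ℝ :=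
  -lapse M p.2 * X.1 * Z.1 + X.1 * Z.2 + X.2 * Z.1

/-- `g^{αβ} ∂_α ψ ∂_β ψ`; the inverse metric has `g^{vv} = 0`, `g^{vr} = 1`, `g^{rr} = D`. -/
def gradSq (M : ℝ) (ψ : ℝ × ℝ → ℝ) (p : ℝ × ℝ) : ℝ :=
  lapse M p.2 * dY ψ p ^ 2 + 2 * dT ψ p * dY ψ p

/-- The wave operator `|g|^{-1/2} ∂_α (|g|^{1/2} g^{αβ} ∂_β ψ)` on spherically symmetric functions;
`|g|^{1/2}` is `r²` times a function on the sphere. -/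
def box (M : ℝ) (ψ : ℝ × ℝ → ℝ) (p : ℝ × ℝ) : ℝ :=
  (dT (fun q => q.2 ^ 2 * dY ψ q) p
    + dY (fun q => q.2 ^ 2 * (dT ψ q + lapse M q.2 * dY ψ q)) p) / p.2 ^ 2

/-- The nonlinearity `F = A(ψ) g^{αβ} ∂_α ψ ∂_β ψ`. -/
def nonlinearity (M : ℝ) (A : ℝ → ℝ) (ψ : ℝ × ℝ → ℝ) (p : ℝ × ℝ) : ℝ :=
  A (ψ p) * gradSq M ψ p

/-- The energy current `J^V_μ[ψ] X^μ = T_{μν}[ψ] V^ν X^μ`, where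
`T_{μν} = ∂_μ ψ ∂_ν ψ - (1/2) g_{μν} ∂^a ψ ∂_a ψ`. -/
def current (M : ℝ) (ψ : ℝ × ℝ → ℝ) (p V X : ℝ × ℝ) : ℝ :=
  fderiv ℝ ψ p V * fderiv ℝ ψ p X - 1 / 2 * metric M p V X * gradSq M ψ p

/-- The Killing field `T = ∂_v`. -/
def killingT : ℝ × ℝ := (1, 0)

/-- The future unit normal of the hypersurfaces `t* = v - r = const`. -/
def normalS (M : ℝ) (p : ℝ × ℝ) : ℝ × ℝ :=
  (1 / √(2 - lapse M p.2), (lapse M p.2 - 1) / √(2 - lapse M p.2))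

/-- The null normal of the hypersurfaces `u = const`: the coordinate field `∂_v` of the null
coordinates `(u, v)`, which is `T + (D / 2) Y`. -/
def normalN (M : ℝ) (p : ℝ × ℝ) : ℝ × ℝ := (1, lapse M p.2 / 2)

/-- The null coordinate `u = t - r* = v - 2 r*`. -/
def uCoord (M : ℝ) (p : ℝ × ℝ) : ℝ := p.1 - 2 * tortoise M p.2

/-- `S_τ = {t* = τ} ∩ {M ≤ r ≤ R₀}`. -/
def leafS (M R₀ τ : ℝ) : Set (ℝ × ℝ) := {p | p.1 - p.2 = τ ∧ M ≤ p.2 ∧ p.2 ≤ R₀}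

/-- `N_τ = {u = u_τ, v ≥ v_τ}`, the outgoing null cone from the sphere `t* = τ`, `r = R₀`. -/
def leafN (M R₀ τ : ℝ) : Set (ℝ × ℝ) :=
  {p | M < p.2 ∧ uCoord M p = uCoord M (τ + R₀, R₀) ∧ τ + R₀ ≤ p.1}

/-- `Σ_τ = S_τ ∪ N_τ`. -/
def leaf (M R₀ τ : ℝ) : Set (ℝ × ℝ) := leafS M R₀ τ ∪ leafN M R₀ τ

/-- The union of the `Σ_τ` with `0 ≤ τ < τmax`. -/
def region (M R₀ : ℝ) (τmax : EReal) : Set (ℝ × ℝ) :=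
  {p | ∃ τ : ℝ, 0 ≤ τ ∧ (τ : EReal) < τmax ∧ p ∈ leaf M R₀ τ}

/-- The point of `S_τ` of radius `r`. -/
def pointS (τ r : ℝ) : ℝ × ℝ := (τ + r, r)

/-- The point of `N_τ` of radius `r`. -/
def pointN (M R₀ τ r : ℝ) : ℝ × ℝ := (τ + R₀ + 2 * (tortoise M r - tortoise M R₀), r)

/-- `∫_{S_τ} f` against the induced volume `√(2 - D) r² dr dω`. -/
def intS (M R₀ τ : ℝ) (f : ℝ × ℝ → ℝ) : ℝ≥0∞ :=
  ∫⁻ r in Set.Icc M R₀,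
    ENNReal.ofReal (4 * Real.pi * √(2 - lapse M r) * r ^ 2 * f (pointS τ r))

/-- `∫_{N_τ} f` against the volume `r² dv dω` that goes with the normal `normalN`; along `N_τ` one
has `dv = (2 / D) dr`. -/
def intN (M R₀ τ : ℝ) (f : ℝ × ℝ → ℝ) : ℝ≥0∞ :=
  ∫⁻ r in Set.Ici R₀,
    ENNReal.ofReal (4 * Real.pi * r ^ 2 * (2 / lapse M r) * f (pointN M R₀ τ r))

/-- `∫_{τ₁}^{τ₂} ∫_{S_τ} f` against the spacetime volume `r² dv dr dω = r² dτ dr dω`. -/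
def bulkS (M R₀ τ₁ τ₂ : ℝ) (f : ℝ × ℝ → ℝ) : ℝ≥0∞ :=
  ∫⁻ τ in Set.Icc τ₁ τ₂, ∫⁻ r in Set.Icc M R₀,
    ENNReal.ofReal (4 * Real.pi * r ^ 2 * f (pointS τ r))

/-- `∫_{τ₁}^{τ₂} ∫_{N_τ} f` against the spacetime volume
`r² dv dr dω = r² dτ dr dω = (D / 2) r² du dv dω`. -/
def bulkN (M R₀ τ₁ τ₂ : ℝ) (f : ℝ × ℝ → ℝ) : ℝ≥0∞ :=
  ∫⁻ τ in Set.Icc τ₁ τ₂, ∫⁻ r in Set.Ici R₀,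
    ENNReal.ofReal (4 * Real.pi * r ^ 2 * f (pointN M R₀ τ r))

/-- The degenerate energy `∫_{Σ_τ} J^T_μ[ψ] n^μ`. -/
def degenerateEnergy (M R₀ : ℝ) (ψ : ℝ × ℝ → ℝ) (τ : ℝ) : ℝ≥0∞ :=
  intS M R₀ τ (fun p => current M ψ p killingT (normalS M p))
    + intN M R₀ τ (fun p => current M ψ p killingT (normalN M p))

/-- `∫_{S_0} (Yψ₀)² + (Tψ₀)² + ∫_{N_0} (∂_v ψ₀)² + ∫_{Σ_0} J^n_μ[ψ₁] n^μ`, where `∂_v` on `N_0` is the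
null derivative. -/
def initialEnergy (M R₀ : ℝ) (ψ₀ ψ₁ : ℝ × ℝ → ℝ) : ℝ≥0∞ :=
  intS M R₀ 0 (fun p => dY ψ₀ p ^ 2 + dT ψ₀ p ^ 2)
    + intN M R₀ 0 (fun p => fderiv ℝ ψ₀ p (normalN M p) ^ 2)
    + (intS M R₀ 0 (fun p => current M ψ₁ p (normalS M p) (normalS M p))
      + intN M R₀ 0 (fun p => current M ψ₁ p (normalN M p) (normalN M p)))

/-- The initial energy `E₀` of a solution with `ψ = ε ψ₀` and `n ψ = ε ψ₁` at `Σ_0`, `n` being the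
future unit normal of the hypersurfaces `t* = const`. -/
def E₀ (M R₀ ε : ℝ) (ψ : ℝ × ℝ → ℝ) : ℝ≥0∞ :=
  initialEnergy M R₀ (fun p => ε⁻¹ * ψ p) (fun p => ε⁻¹ * fderiv ℝ ψ p (normalS M p))

end

end ExtremalRN

open ExtremalRN

/-! Put φ = rψ, L = T + (D/2)Y and q = 2 − α. In spherical symmetry the equation reads 2Y(Lφ) = Vφ +
rF with V = D'/r = 2M(r − M)/r⁴. There are no angular derivatives, hence no trapping. What
degenerates is the horizon, where D vanishes to second order and there is no red-shift, and
infinity. Both are handled by one hierarchy of three currents, quadratic in φ, Lφ and Yφ.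

Order zero is a large multiple of the T-current plus a Morawetz current; its flux is comparable to
the T-energy of φ. Order one weights (Lφ)² by about r at infinity and (Yφ)² by r − M at the horizon.
Order two weights (Lφ)² by r^q at infinity and (Yφ)² by a weight that does not vanish at the
horizon. Multiplying by a power of r or dividing by a power of r − M costs one power in the bulk, so
the bulk of each order should dominate the flux of the order below.

At infinity this fails for order two, because q < 2: the bulk contains r^(q−1)(Lφ)², while the flux
of order one contains r(Lφ)². Fix the final time T and put λ = 1 + T. The weight of order one is
truncated at r ~ λ, the outgoing part of order two is multiplied by λ^(2−q), and `min_le_weightW`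
gives λr/(λ + r) ≤ λ^(2−q) r^q (1/r + 1/λ). The part with 1/r lies in the bulk of order two. The
part with 1/λ is gained by giving the current of order two a coefficient κ(t) between 2 and 1 that
decreases at rate at least a constant over λ.

With t = 1 + τ, the combination A₂ κ(t) Flux₂ + A₁ t Flux₁ + t² Flux₀ is therefore nonincreasing up
to the source F (`exists_totalRate_le`). At t = λ it is at least λ² times the energy. At t = 1 it is
at most λ^(2−q) times the data, because the data have bounded support and all other weights are
bounded there. Division by λ² gives the rate (1 + T)^(−q), with no dyadic pigeonhole argument.

The source is weighted by t² + λ^(2−q), and tails of size t^(−q) integrate against this to λ^(2−q);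
this uses (A2) and (A3). One term escapes: near the horizon the product of Yφ and F is not absorbed
by the bulk, where the coefficient of (Yφ)² vanishes at r = M. It is absorbed by the decrease of κ
at the cost of F²/|κ'|, which is where (A1) enters.

The divergence theorem is applied on S and on N separately. Fluxes through r = R₀ cancel, the flux
through the horizon has a good sign, and a cutoff nonincreasing in v removes the outer boundary with
an error of good sign, so no decay at infinity is assumed at later times. -/

namespace ExtremalRN

/-! ### Calculus: divergence theorem on rectangles, moments of decaying densities -/

section

open MeasureTheory Set

/-- The integral over `r` of a function that is jointly continuous is continuous in the parameter. -/
theorem continuousOn_intervalIntegral_of_rectangle {f : ℝ → ℝ → ℝ} {a b c d : ℝ}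
    (hcd : c ≤ d) (hf : ContinuousOn (Function.uncurry f) (Icc a b ×ˢ Icc c d)) :
    ContinuousOn (fun t => ∫ r in c..d, f t r) (Icc a b) := by
  rcases lt_or_ge b a with hba | hab
  · simp [hba]
  -- Clamping both variables to the rectangle extends the integrand continuously to the plane
  -- without changing it on the rectangle.
  set g : ℝ → ℝ → ℝ := fun t r => f (projIcc a b hab t) (projIcc c d hcd r) with hg
  have hgc : Continuous (Function.uncurry g) := by
    have : Function.uncurry g = Function.uncurry f ∘
        fun z : ℝ × ℝ => ((projIcc a b hab z.1 : ℝ), (projIcc c d hcd z.2 : ℝ)) := rfl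
    rw [this]
    refine hf.comp_continuous ?_ fun z => ⟨(projIcc a b hab z.1).2, (projIcc c d hcd z.2).2⟩
    exact (continuous_subtype_val.comp (continuous_projIcc.comp continuous_fst)).prodMk
      (continuous_subtype_val.comp (continuous_projIcc.comp continuous_snd))
  refine (intervalIntegral.continuous_parametric_intervalIntegral_of_continuous' hgc c d).continuousOn.congr
    fun t ht => intervalIntegral.integral_congr fun r hr => ?_
  rw [uIcc_of_le hcd] at hr
  simp [hg, projIcc_of_mem hab ht, projIcc_of_mem hcd hr]

theorem intervalIntegral_swap_of_continuousOn {f : ℝ → ℝ → ℝ} {a b c d : ℝ}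
    (hab : a ≤ b) (hcd : c ≤ d)
    (hf : ContinuousOn (Function.uncurry f) (Icc a b ×ˢ Icc c d)) :
    ∫ t in a..b, ∫ r in c..d, f t r = ∫ r in c..d, ∫ t in a..b, f t r := by
  simp only [intervalIntegral.integral_of_le hcd, intervalIntegral.integral_of_le hab,
    ← integral_Icc_eq_integral_Ioc]
  apply integral_integral_swap
  rw [Measure.prod_restrict]
  exact hf.integrableOn_compact (isCompact_Icc.prod isCompact_Icc)

theorem ContinuousOn.slice_right {f : ℝ → ℝ → ℝ} {s t : Set ℝ}
    (hf : ContinuousOn (Function.uncurry f) (s ×ˢ t)) {x : ℝ} (hx : x ∈ s) :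
    ContinuousOn (f x) t :=
  hf.comp (f := fun y => (x, y)) (by fun_prop) fun _ hy => ⟨hx, hy⟩

theorem ContinuousOn.slice_left {f : ℝ → ℝ → ℝ} {s t : Set ℝ}
    (hf : ContinuousOn (Function.uncurry f) (s ×ˢ t)) {y : ℝ} (hy : y ∈ t) :
    ContinuousOn (fun x => f x y) s :=
  hf.comp (f := fun x => (x, y)) (by fun_prop) fun _ hx => ⟨hx, hy⟩

/-- The divergence theorem on a rectangle, as an inequality for a divergence bounded by `e`. -/
theorem divergence_rectangle_le {f g ft gr e : ℝ → ℝ → ℝ} {a b c d : ℝ}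
    (hab : a ≤ b) (hcd : c ≤ d)
    (hf : ∀ t ∈ Icc a b, ∀ r ∈ Icc c d, HasDerivAt (fun s => f s r) (ft t r) t)
    (hg : ∀ t ∈ Icc a b, ∀ r ∈ Icc c d, HasDerivAt (fun s => g t s) (gr t r) r)
    (cf : ContinuousOn (Function.uncurry f) (Icc a b ×ˢ Icc c d))
    (cft : ContinuousOn (Function.uncurry ft) (Icc a b ×ˢ Icc c d))
    (cgr : ContinuousOn (Function.uncurry gr) (Icc a b ×ˢ Icc c d))
    (ce : ContinuousOn (Function.uncurry e) (Icc a b ×ˢ Icc c d))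
    (h : ∀ t ∈ Icc a b, ∀ r ∈ Icc c d, ft t r + gr t r ≤ e t r) :
    (∫ r in c..d, f b r) + (∫ t in a..b, (g t d - g t c))
      ≤ (∫ r in c..d, f a r) + ∫ t in a..b, ∫ r in c..d, e t r := by
  have uab := uIcc_of_le hab
  have ucd := uIcc_of_le hcd
  have ha : a ∈ Icc a b := ⟨le_rfl, hab⟩
  have hb : b ∈ Icc a b := ⟨hab, le_rfl⟩
  have h1 : ∫ t in a..b, ∫ r in c..d, ft t r = (∫ r in c..d, f b r) - ∫ r in c..d, f a r := by
    rw [intervalIntegral_swap_of_continuousOn hab hcd cft, ← intervalIntegral.integral_sub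
      (ucd ▸ cf.slice_right hb).intervalIntegrable (ucd ▸ cf.slice_right ha).intervalIntegrable]
    refine intervalIntegral.integral_congr fun r hr => ?_
    rw [ucd] at hr
    exact intervalIntegral.integral_eq_sub_of_hasDerivAt (f := fun s => f s r)
      (fun t ht => hf t (uab ▸ ht) r hr) (uab ▸ cft.slice_left hr).intervalIntegrable
  have h2 : ∫ t in a..b, ∫ r in c..d, gr t r = ∫ t in a..b, (g t d - g t c) := by
    refine intervalIntegral.integral_congr fun t ht => ?_
    rw [uab] at ht
    exact intervalIntegral.integral_eq_sub_of_hasDerivAt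
      (fun r hr => hg t ht r (ucd ▸ hr)) (ucd ▸ cgr.slice_right ht).intervalIntegrable
  have I1 := continuousOn_intervalIntegral_of_rectangle hcd cft
  have I2 := continuousOn_intervalIntegral_of_rectangle hcd cgr
  have I3 := continuousOn_intervalIntegral_of_rectangle hcd ce
  have h3 : (∫ t in a..b, ∫ r in c..d, ft t r) + (∫ t in a..b, ∫ r in c..d, gr t r)
      ≤ ∫ t in a..b, ∫ r in c..d, e t r := by
    rw [← intervalIntegral.integral_add (uab ▸ I1).intervalIntegrable
      (uab ▸ I2).intervalIntegrable]
    refine intervalIntegral.integral_mono_on hab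
      ((uab ▸ I1).intervalIntegrable.add (uab ▸ I2).intervalIntegrable)
      (uab ▸ I3).intervalIntegrable fun t ht => ?_
    have J1 := (ucd ▸ cft.slice_right ht : ContinuousOn (ft t) (uIcc c d)).intervalIntegrable (μ := volume)
    have J2 := (ucd ▸ cgr.slice_right ht : ContinuousOn (gr t) (uIcc c d)).intervalIntegrable (μ := volume)
    rw [← intervalIntegral.integral_add J1 J2]
    exact intervalIntegral.integral_mono_on hcd (J1.add J2)
      (ucd ▸ ce.slice_right ht : ContinuousOn (e t) (uIcc c d)).intervalIntegrable (h t ht)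
  linarith

/-- A density whose tails decay like `(1 + s)^(-q)` has a moment of order two growing like
`(1 + T)^(2 - q)`. -/
theorem integral_sq_mul_le_of_tail {g : ℝ → ℝ} {T K q : ℝ} (hT : 0 ≤ T) (hK : 0 ≤ K)
    (hq : q < 2) (hg : ContinuousOn g (Icc 0 T))
    (h : ∀ s ∈ Ico 0 T, ∫ t in s..T, g t ≤ K * (1 + s) ^ (-q)) :
    ∫ t in (0 : ℝ)..T, (1 + t) ^ 2 * g t ≤ (1 + 2 / (2 - q)) * K * (1 + T) ^ (2 - q) := by
  set k : ℝ → ℝ := fun t => g (projIcc 0 T hT t) with hk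
  have kc : Continuous k :=
    hg.comp_continuous (continuous_subtype_val.comp continuous_projIcc)
      fun t => (projIcc 0 T hT t).2
  have kg : ∀ s ∈ Icc 0 T, ∀ t ∈ uIcc s T, g t = k t := fun s hs t ht => by
    rw [uIcc_of_le hs.2] at ht
    simp [hk, projIcc_of_mem hT ⟨hs.1.trans ht.1, ht.2⟩]
  have h0 : (0 : ℝ) ∈ Icc 0 T := ⟨le_rfl, hT⟩
  have hG : ∀ s ∈ Icc 0 T, ∫ t in s..T, k t ≤ K * (1 + s) ^ (-q) := fun s hs => by
    rcases hs.2.eq_or_lt with rfl | hlt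
    · rw [intervalIntegral.integral_same]
      have := hs.1
      positivity
    · rw [← intervalIntegral.integral_congr (kg s hs)]
      exact h s ⟨hs.1, hlt⟩
  have e1 : ∫ t in (0 : ℝ)..T, (1 + t) ^ 2 * g t = ∫ t in (0 : ℝ)..T, (1 + t) ^ 2 * k t :=
    intervalIntegral.integral_congr fun t ht => by simp only [kg 0 h0 t ht]
  have d1 : ∀ x ∈ uIcc 0 T, HasDerivAt (fun t : ℝ => (1 + t) ^ 2) (2 * (1 + x)) x := fun x _ => by
    simpa using ((hasDerivAt_id x).const_add 1).fun_pow 2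
  have d2 : ∀ x ∈ uIcc 0 T, HasDerivAt (fun s => -∫ t in s..T, k t) (k x) x := fun x _ => by
    have := intervalIntegral.integral_hasDerivAt_left (kc.intervalIntegrable x T)
      (kc.stronglyMeasurableAtFilter _ _) kc.continuousAt
    simpa using this.fun_neg
  have Gc : Continuous fun s => ∫ t in s..T, k t := by
    simp_rw [intervalIntegral.integral_symm T]
    exact (intervalIntegral.continuous_primitive (fun a b => kc.intervalIntegrable a b) T).neg
  -- Integration by parts with minus the tail integral as primitive. The boundary term at T
  -- vanishes, the one at 0 is a full tail, and the remaining integrand is at most 2K(1 + x)^(1−q),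
  -- where q < 2 makes the integral of size (1 + T)^(2−q).
  rw [e1, intervalIntegral.integral_mul_deriv_eq_deriv_mul d1 d2
    (Continuous.intervalIntegrable (by fun_prop) _ _) (kc.intervalIntegrable _ _)]
  have e2 : ∫ x in (0 : ℝ)..T, 2 * (1 + x) * -∫ t in x..T, k t
      = -∫ x in (0 : ℝ)..T, 2 * (1 + x) * ∫ t in x..T, k t := by
    rw [← intervalIntegral.integral_neg]; congr 1; ext; ring
  have c1 : ContinuousOn (fun x : ℝ => (1 + x) ^ (1 - q)) (uIcc 0 T) :=
    ContinuousOn.rpow_const (by fun_prop) fun x hx => Or.inl (by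
      rw [uIcc_of_le hT] at hx; linarith [hx.1])
  have e3 : ∫ x in (0 : ℝ)..T, 2 * (1 + x) * ∫ t in x..T, k t
      ≤ ∫ x in (0 : ℝ)..T, 2 * K * (1 + x) ^ (1 - q) := by
    refine intervalIntegral.integral_mono_on hT
      (Continuous.intervalIntegrable (by fun_prop) _ _) ?_ fun x hx => ?_
    · exact (continuousOn_const.mul c1).intervalIntegrable
    · have hx1 : 0 < 1 + x := by linarith [hx.1]
      have : (1 + x) ^ (1 - q) = (1 + x) * (1 + x) ^ (-q) := by
        rw [sub_eq_add_neg, Real.rpow_add hx1, Real.rpow_one]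
      rw [this]
      nlinarith [hG x hx]
  have e4 : ∫ x in (0 : ℝ)..T, (1 + x) ^ (1 - q) = ((1 + T) ^ (2 - q) - 1) / (2 - q) := by
    have hd : ∀ x ∈ uIcc 0 T, HasDerivAt (fun x : ℝ => (1 + x) ^ (2 - q) / (2 - q))
        ((1 + x) ^ (1 - q)) x := fun x hx => by
      rw [uIcc_of_le hT] at hx
      have hx1 : 1 + x ≠ 0 := by linarith [hx.1]
      have := (((hasDerivAt_id x).const_add 1).rpow_const (p := 2 - q) (Or.inl hx1)).div_const (2 - q)
      have h2 : 2 - q ≠ 0 := by linarith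
      refine this.congr_deriv ?_
      rw [show 2 - q - 1 = 1 - q by ring]
      simp only [id]
      field_simp
    rw [intervalIntegral.integral_eq_sub_of_hasDerivAt hd c1.intervalIntegrable]
    simp [sub_div]
  rw [intervalIntegral.integral_const_mul, e4] at e3
  have h5 := hG 0 h0
  have h6 : (1 : ℝ) ≤ (1 + T) ^ (2 - q) := Real.one_le_rpow (by linarith) (by linarith)
  have h7 : 0 ≤ K / (2 - q) := div_nonneg hK (by linarith)
  simp only [intervalIntegral.integral_same, add_zero, Real.one_rpow, mul_one] at h5 ⊢
  rw [e2]
  have : (1 + 2 / (2 - q)) * K * (1 + T) ^ (2 - q)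
    = K * (1 + T) ^ (2 - q) + 2 * K * ((1 + T) ^ (2 - q) / (2 - q)) := by ring
  have h8 : 2 * K * (((1 + T) ^ (2 - q) - 1) / (2 - q))
    = 2 * K * ((1 + T) ^ (2 - q) / (2 - q)) - 2 * (K / (2 - q)) := by ring
  nlinarith

end

/-! ### Derivatives in (v, r), the expanded wave operator, algebra of currents -/

noncomputable section

open Set

theorem hasDerivAt_dT {u : ℝ × ℝ → ℝ} {p : ℝ × ℝ} (h : DifferentiableAt ℝ u p) :
    HasDerivAt (fun v => u (v, p.2)) (dT u p) p.1 :=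
  h.hasFDerivAt.comp_hasDerivAt (f := fun v => (v, p.2)) p.1
    ((hasDerivAt_id p.1).prodMk (hasDerivAt_const p.1 p.2))

theorem hasDerivAt_dY {u : ℝ × ℝ → ℝ} {p : ℝ × ℝ} (h : DifferentiableAt ℝ u p) :
    HasDerivAt (fun r => u (p.1, r)) (dY u p) p.2 :=
  h.hasFDerivAt.comp_hasDerivAt (f := fun r => (p.1, r)) p.2
    ((hasDerivAt_const p.2 p.1).prodMk (hasDerivAt_id p.2))

theorem fderiv_eq_dT_dY (u : ℝ × ℝ → ℝ) (p X : ℝ × ℝ) :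
    fderiv ℝ u p X = X.1 * dT u p + X.2 * dY u p := by
  have : X = X.1 • ((1, 0) : ℝ × ℝ) + X.2 • ((0, 1) : ℝ × ℝ) := by ext <;> simp
  conv_lhs => rw [this]
  rw [map_add, map_smul, map_smul]
  rfl

theorem contDiffOn_dT {ψ : ℝ × ℝ → ℝ} {U : Set (ℝ × ℝ)} (hU : IsOpen U)
    {n m : WithTop ℕ∞} (h : ContDiffOn ℝ n ψ U) (hm : m + 1 ≤ n) : ContDiffOn ℝ m (dT ψ) U :=
  (h.fderiv_of_isOpen hU hm).clm_apply contDiffOn_const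

theorem contDiffOn_dY {ψ : ℝ × ℝ → ℝ} {U : Set (ℝ × ℝ)} (hU : IsOpen U)
    {n m : WithTop ℕ∞} (h : ContDiffOn ℝ n ψ U) (hm : m + 1 ≤ n) : ContDiffOn ℝ m (dY ψ) U :=
  (h.fderiv_of_isOpen hU hm).clm_apply contDiffOn_const

theorem dT_dY_comm {ψ : ℝ × ℝ → ℝ} {U : Set (ℝ × ℝ)} (hU : IsOpen U)
    (h : ContDiffOn ℝ 2 ψ U) {p : ℝ × ℝ} (hp : p ∈ U) : dT (dY ψ) p = dY (dT ψ) p := by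
  have hs := ((h.contDiffAt (hU.mem_nhds hp)).isSymmSndFDerivAt (by simp)).eq (1, 0) (0, 1)
  have hd : DifferentiableAt ℝ (fderiv ℝ ψ) p :=
    ((h.fderiv_of_isOpen hU (m := 1) (by norm_num)).contDiffAt
      (hU.mem_nhds hp)).differentiableAt (by simp)
  have key : ∀ X Z : ℝ × ℝ, fderiv ℝ (fun q => fderiv ℝ ψ q X) p Z
      = fderiv ℝ (fderiv ℝ ψ) p Z X := fun X Z => by
    rw [fderiv_clm_apply hd (differentiableAt_const X)]
    simp
  change fderiv ℝ (fun q => fderiv ℝ ψ q (0, 1)) p (1, 0)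
    = fderiv ℝ (fun q => fderiv ℝ ψ q (1, 0)) p (0, 1)
  rw [key, key, hs]

/-- The derivative of the lapse. -/
def dLapse (M r : ℝ) : ℝ := 2 * M * (r - M) / r ^ 3

theorem hasDerivAt_lapse (M : ℝ) {r : ℝ} (hr : r ≠ 0) :
    HasDerivAt (lapse M) (dLapse M r) r := by
  have h := ((hasDerivAt_const r (1 : ℝ)).fun_sub
    ((hasDerivAt_const r M).fun_div (hasDerivAt_id r) hr)).fun_pow 2
  refine h.congr_deriv ?_
  simp [dLapse]
  field_simp
  

/-- `Y (r ψ)`. -/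
def phiY (ψ : ℝ × ℝ → ℝ) (p : ℝ × ℝ) : ℝ := p.2 * dY ψ p + ψ p

/-- `L (r ψ)` for the null field `L = T + (D / 2) Y`. -/
def phiL (M : ℝ) (ψ : ℝ × ℝ → ℝ) (p : ℝ × ℝ) : ℝ :=
  p.2 * (dT ψ p + lapse M p.2 / 2 * dY ψ p) + lapse M p.2 / 2 * ψ p

theorem box_expand {M : ℝ} {ψ : ℝ × ℝ → ℝ} {U : Set (ℝ × ℝ)} (hU : IsOpen U)
    (h : ContDiffOn ℝ 2 ψ U) {p : ℝ × ℝ} (hp : p ∈ U) (hr : 0 < p.2) :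
    p.2 ^ 2 * box M ψ p = p.2 ^ 2 * (2 * dY (dT ψ) p + lapse M p.2 * dY (dY ψ) p
      + dLapse M p.2 * dY ψ p) + 2 * p.2 * (dT ψ p + lapse M p.2 * dY ψ p) := by
  have hT : DifferentiableAt ℝ (dT ψ) p :=
    ((contDiffOn_dT hU h (m := 1) (by norm_num)).contDiffAt (hU.mem_nhds hp)).differentiableAt (by simp)
  have hY : DifferentiableAt ℝ (dY ψ) p :=
    ((contDiffOn_dY hU h (m := 1) (by norm_num)).contDiffAt (hU.mem_nhds hp)).differentiableAt (by simp)
  have hl : DifferentiableAt ℝ (fun q : ℝ × ℝ => lapse M q.2) p :=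
    (hasDerivAt_lapse M hr.ne').differentiableAt.comp p differentiableAt_snd
  have e1 : dT (fun q => q.2 ^ 2 * dY ψ q) p = p.2 ^ 2 * dY (dT ψ) p := by
    have h1 : DifferentiableAt ℝ (fun q : ℝ × ℝ => q.2 ^ 2 * dY ψ q) p := by fun_prop
    rw [← dT_dY_comm hU h hp]
    exact (hasDerivAt_dT h1).unique ((hasDerivAt_dT hY).const_mul (p.2 ^ 2))
  have e2 : dY (fun q => q.2 ^ 2 * (dT ψ q + lapse M q.2 * dY ψ q)) p
      = 2 * p.2 * (dT ψ p + lapse M p.2 * dY ψ p)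
        + p.2 ^ 2 * (dY (dT ψ) p + (dLapse M p.2 * dY ψ p + lapse M p.2 * dY (dY ψ) p)) := by
    have h1 : DifferentiableAt ℝ (fun q : ℝ × ℝ => q.2 ^ 2 * (dT ψ q + lapse M q.2 * dY ψ q)) p := by
      fun_prop
    refine (hasDerivAt_dY h1).unique ?_
    have := ((hasDerivAt_id p.2).fun_pow 2).fun_mul ((hasDerivAt_dY hT).fun_add
      ((hasDerivAt_lapse M hr.ne').fun_mul (hasDerivAt_dY hY)))
    simpa using this
  rw [box, e1, e2]
  field_simp
  ring

/-- `P ∂_v + Q ∂_r` is a `C¹` vector field on `W` whose coordinate divergence is `G` on `R`. -/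
structure IsCurrent (W R : Set (ℝ × ℝ)) (P Q G : ℝ × ℝ → ℝ) : Prop where
  contDiffOn_vComponent : ContDiffOn ℝ 1 P W
  contDiffOn_rComponent : ContDiffOn ℝ 1 Q W
  div_eq : ∀ p ∈ R, dT P p + dY Q p = G p

section Currents

variable {W R : Set (ℝ × ℝ)}

theorem IsCurrent.add {P Q G P' Q' G' : ℝ × ℝ → ℝ} (hW : IsOpen W) (hR : R ⊆ W)
    (h : IsCurrent W R P Q G) (h' : IsCurrent W R P' Q' G') :
    IsCurrent W R (fun p => P p + P' p) (fun p => Q p + Q' p) (fun p => G p + G' p) where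
  contDiffOn_vComponent := h.1.add h'.1
  contDiffOn_rComponent := h.2.add h'.2
  div_eq p hp := by
    have d {f : ℝ × ℝ → ℝ} (hf : ContDiffOn ℝ 1 f W) : DifferentiableAt ℝ f p :=
      (hf.contDiffAt (hW.mem_nhds (hR hp))).differentiableAt (by simp)
    rw [← h.div_eq p hp, ← h'.div_eq p hp, dT, dY, fderiv_fun_add (d h.1) (d h'.1),
      fderiv_fun_add (d h.2) (d h'.2)]
    simp only [dT, dY, add_apply]
    ring

/-- Multiplication of a current by a function of `v`. -/
theorem IsCurrent.mul_fst {P Q G : ℝ × ℝ → ℝ} (hW : IsOpen W) (hR : R ⊆ W)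
    (h : IsCurrent W R P Q G) {χ : ℝ → ℝ} (hχ : ContDiff ℝ 1 χ) :
    IsCurrent W R (fun p => χ p.1 * P p) (fun p => χ p.1 * Q p)
      (fun p => χ p.1 * G p + deriv χ p.1 * P p) where
  contDiffOn_vComponent := (hχ.comp contDiff_fst).contDiffOn.mul h.1
  contDiffOn_rComponent := (hχ.comp contDiff_fst).contDiffOn.mul h.2
  div_eq p hp := by
    have d {f : ℝ × ℝ → ℝ} (hf : ContDiffOn ℝ 1 f W) : DifferentiableAt ℝ f p :=
      (hf.contDiffAt (hW.mem_nhds (hR hp))).differentiableAt (by simp)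
    have hχd : DifferentiableAt ℝ χ p.1 := hχ.contDiffAt.differentiableAt (by simp)
    have hχp : DifferentiableAt ℝ (fun q : ℝ × ℝ => χ q.1) p := hχd.comp p differentiableAt_fst
    have e1 := (hasDerivAt_dT (hχp.fun_mul (d h.1))).unique
      (hχd.hasDerivAt.fun_mul (hasDerivAt_dT (d h.1)))
    have e2 := (hasDerivAt_dY (hχp.fun_mul (d h.2))).unique
      ((hasDerivAt_dY (d h.2)).const_mul (χ p.1))
    rw [e1, e2, ← h.div_eq p hp]
    ring

theorem IsCurrent.const_mul {P Q G : ℝ × ℝ → ℝ} (hW : IsOpen W) (hR : R ⊆ W)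
    (h : IsCurrent W R P Q G) (c : ℝ) :
    IsCurrent W R (fun p => c * P p) (fun p => c * Q p) (fun p => c * G p) := by
  simpa using h.mul_fst hW hR (contDiff_const (c := c))

theorem IsCurrent.congr {P Q G P' Q' G' : ℝ × ℝ → ℝ} (h : IsCurrent W R P Q G)
    (hP : ∀ p, P' p = P p) (hQ : ∀ p, Q' p = Q p) (hG : ∀ p ∈ R, G' p = G p) :
    IsCurrent W R P' Q' G' := by
  obtain rfl : P' = P := funext hP
  obtain rfl : Q' = Q := funext hQ
  exact ⟨h.1, h.2, fun p hp => (h.3 p hp).trans (hG p hp).symm⟩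

end Currents

end

/-! ### Currents for rψ and for ψ -/

noncomputable section

open Set

/-- `-G` for the current `phiP, phiQ` below, in terms of `φ = r ψ`, `p = Lφ`, `z = Yφ`. -/
def phiBulk (M : ℝ) (a b s k : ℝ → ℝ) (r φ p z F : ℝ) : ℝ :=
  deriv a r * p ^ 2 + (dLapse M r * b r - lapse M r * deriv b r) / 2 * z ^ 2
    + (a r * (dLapse M r / r) - 2 * s r) * φ * p + (2 * k r - b r * (dLapse M r / r)) * φ * z
    + (deriv k r - (dLapse M r * s r + lapse M r * deriv s r) / 2) * φ ^ 2
    + (a r * p - b r * z) * r * F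

/-- The `v`-component of the current with coefficients `a, b, s, k`. -/
def phiP (b s : ℝ → ℝ) (ψ : ℝ × ℝ → ℝ) (p : ℝ × ℝ) : ℝ :=
  b p.2 * phiY ψ p ^ 2 + s p.2 * (p.2 * ψ p) ^ 2

/-- The `r`-component of the current with coefficients `a, b, s, k`. -/
def phiQ (M : ℝ) (a b s k : ℝ → ℝ) (ψ : ℝ × ℝ → ℝ) (p : ℝ × ℝ) : ℝ :=
  -a p.2 * phiL M ψ p ^ 2 + lapse M p.2 / 2 * b p.2 * phiY ψ p ^ 2
    + (lapse M p.2 / 2 * s p.2 - k p.2) * (p.2 * ψ p) ^ 2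

/-- The null derivative `Lψ = Tψ + (D / 2) Yψ`. -/
def psiL (M : ℝ) (ψ : ℝ × ℝ → ℝ) (p : ℝ × ℝ) : ℝ := dT ψ p + lapse M p.2 / 2 * dY ψ p

section

variable {M : ℝ} {U R : Set (ℝ × ℝ)} {ψ : ℝ × ℝ → ℝ}

theorem isOpen_inter_pos (hU : IsOpen U) : IsOpen (U ∩ {p : ℝ × ℝ | 0 < p.2}) :=
  hU.inter (isOpen_lt continuous_const continuous_snd)

theorem contDiffOn_lapse (M : ℝ) {n : WithTop ℕ∞} : ContDiffOn ℝ n (lapse M) (Ioi 0) :=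
  (contDiffOn_const.sub (contDiffOn_const.div contDiffOn_id fun _ hr => (ne_of_gt hr))).pow 2

theorem contDiffOn_radial {c : ℝ → ℝ} {n : WithTop ℕ∞} (hc : ContDiffOn ℝ n c (Ioi 0)) :
    ContDiffOn ℝ n (fun p : ℝ × ℝ => c p.2) (U ∩ {p : ℝ × ℝ | 0 < p.2}) :=
  hc.comp contDiffOn_snd fun _ hp => hp.2

theorem contDiffOn_phiY (hU : IsOpen U) (h : ContDiffOn ℝ 2 ψ U) :
    ContDiffOn ℝ 1 (phiY ψ) (U ∩ {p : ℝ × ℝ | 0 < p.2}) :=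
  ((contDiffOn_snd.mul (contDiffOn_dY hU h (by norm_num))).add (h.of_le (by norm_num))).mono
    inter_subset_left

theorem contDiffOn_psiL (hU : IsOpen U) (h : ContDiffOn ℝ 2 ψ U) :
    ContDiffOn ℝ 1 (psiL M ψ) (U ∩ {p : ℝ × ℝ | 0 < p.2}) :=
  ((contDiffOn_dT hU h (by norm_num)).mono inter_subset_left).add
    (((contDiffOn_radial (contDiffOn_lapse M)).div_const 2).mul
      ((contDiffOn_dY hU h (by norm_num)).mono inter_subset_left))

theorem contDiffOn_phiL (hU : IsOpen U) (h : ContDiffOn ℝ 2 ψ U) :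
    ContDiffOn ℝ 1 (phiL M ψ) (U ∩ {p : ℝ × ℝ | 0 < p.2}) :=
  (contDiffOn_snd.mul (contDiffOn_psiL hU h)).add
    (((contDiffOn_radial (contDiffOn_lapse M)).div_const 2).mul
      ((h.of_le (by norm_num)).mono inter_subset_left))

/-- The vector field is b(Yφ)² L − a(Lφ)² Y + sφ² L − kφ² Y, that is, the multiplier aL − bY with
two free zeroth order corrections. The equation 2Y(Lφ) = Vφ + rF enters when Y falls on Lφ and when
L falls on Yφ; the commutator [Y, L] = (D'/2)Y supplies the term with D'b. The functions s and k
serve to cancel or reshape the cross terms with φ. -/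
theorem isCurrent_phi (hU : IsOpen U) (h : ContDiffOn ℝ 2 ψ U)
    (hR : R ⊆ U ∩ {p : ℝ × ℝ | 0 < p.2}) {F : ℝ × ℝ → ℝ} (hF : ∀ p ∈ R, box M ψ p = F p)
    {a b s k : ℝ → ℝ} (ha : ContDiffOn ℝ 1 a (Ioi 0)) (hb : ContDiffOn ℝ 1 b (Ioi 0))
    (hs : ContDiffOn ℝ 1 s (Ioi 0)) (hk : ContDiffOn ℝ 1 k (Ioi 0)) :
    IsCurrent (U ∩ {p : ℝ × ℝ | 0 < p.2}) R (phiP b s ψ) (phiQ M a b s k ψ)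
      (fun p => -phiBulk M a b s k p.2 (p.2 * ψ p) (phiL M ψ p) (phiY ψ p) (F p)) := by
  have cY := contDiffOn_phiY hU h
  have cL := contDiffOn_phiL (M := M) hU h
  have c0 : ContDiffOn ℝ 1 (fun p : ℝ × ℝ => p.2 * ψ p) (U ∩ {p : ℝ × ℝ | 0 < p.2}) :=
    (contDiffOn_snd.mul (h.of_le (by norm_num))).mono inter_subset_left
  have cP : ContDiffOn ℝ 1 (phiP b s ψ) (U ∩ {p : ℝ × ℝ | 0 < p.2}) :=
    ((contDiffOn_radial hb).mul (cY.pow 2)).add ((contDiffOn_radial hs).mul (c0.pow 2))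
  have cQ : ContDiffOn ℝ 1 (phiQ M a b s k ψ) (U ∩ {p : ℝ × ℝ | 0 < p.2}) := by
    have cD := (contDiffOn_radial (U := U) (contDiffOn_lapse M (n := 1))).div_const 2
    exact (((contDiffOn_radial ha).neg.mul (cL.pow 2)).add ((cD.mul (contDiffOn_radial hb)).mul
      (cY.pow 2))).add (((cD.mul (contDiffOn_radial hs)).sub (contDiffOn_radial hk)).mul (c0.pow 2))
  refine ⟨cP, cQ, fun p hp => ?_⟩
  have hpW := hR hp
  have hr : 0 < p.2 := hpW.2
  have dW {f : ℝ × ℝ → ℝ} (hf : ContDiffOn ℝ 1 f (U ∩ {p : ℝ × ℝ | 0 < p.2})) :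
      DifferentiableAt ℝ f p :=
    (hf.contDiffAt ((isOpen_inter_pos hU).mem_nhds hpW)).differentiableAt (by simp)
  have dr {c : ℝ → ℝ} (hc : ContDiffOn ℝ 1 c (Ioi 0)) : HasDerivAt c (deriv c p.2) p.2 :=
    ((hc.contDiffAt (Ioi_mem_nhds hr)).differentiableAt (by simp)).hasDerivAt
  have hT := dW ((contDiffOn_dT hU h (by norm_num)).mono inter_subset_left)
  have hY := dW ((contDiffOn_dY hU h (by norm_num)).mono inter_subset_left)
  have h0 := dW ((h.of_le (by norm_num)).mono inter_subset_left)
  have hD := hasDerivAt_lapse M hr.ne'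
  have e1 := (hasDerivAt_dT (dW cP)).unique
    (((((hasDerivAt_dT hY).const_mul p.2).fun_add (hasDerivAt_dT h0)).fun_pow 2 |>.const_mul (b p.2)).fun_add
      ((((hasDerivAt_dT h0).const_mul p.2).fun_pow 2).const_mul (s p.2)))
  have i := hasDerivAt_id p.2
  have dL : HasDerivAt (fun r => phiL M ψ (p.1, r)) _ p.2 :=
    (i.fun_mul ((hasDerivAt_dY hT).fun_add ((hD.div_const 2).fun_mul (hasDerivAt_dY hY)))).fun_add
      ((hD.div_const 2).fun_mul (hasDerivAt_dY h0))
  have dPhi : HasDerivAt (fun r => phiY ψ (p.1, r)) _ p.2 :=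
    (i.fun_mul (hasDerivAt_dY hY)).fun_add (hasDerivAt_dY h0)
  have e2 := (hasDerivAt_dY (dW cQ)).unique
    (((((dr ha).fun_neg).fun_mul (dL.fun_pow 2)).fun_add (((hD.div_const 2).fun_mul (dr hb)).fun_mul
      (dPhi.fun_pow 2))).fun_add ((((hD.div_const 2).fun_mul (dr hs)).fun_sub (dr hk)).fun_mul
        ((i.fun_mul (hasDerivAt_dY h0)).fun_pow 2)))
  have hbox := box_expand (M := M) hU h hpW.1 hr
  rw [hF p hp] at hbox
  rw [e1, e2, dT_dY_comm hU h hpW.1]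
  simp only [phiBulk, phiL, phiY, id, Prod.mk.eta] 
  -- Once F is expressed through the second derivatives of ψ, the divergence identity is a rational
  -- identity in which r, D and D' can be treated as independent variables.
  have hF' : F p = (p.2 ^ 2 * (2 * dY (dT ψ) p + lapse M p.2 * dY (dY ψ) p
      + dLapse M p.2 * dY ψ p) + 2 * p.2 * (dT ψ p + lapse M p.2 * dY ψ p)) / p.2 ^ 2 := by
    rw [← hbox]; field_simp
  rw [hF']
  generalize lapse M p.2 = D at *
  generalize dLapse M p.2 = D' at *
  generalize p.2 = r at *
  field_simp
  ring

/-- `-G` for the current `psiP, psiQ` below, in terms of `l = Lψ`, `y = (D / 2) Yψ`. -/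
def psiBulk (r l y F : ℝ) : ℝ := (3 * l ^ 2 + 3 * y ^ 2 + 4 * l * y) / r ^ 2 - F * (l + y) / r

/-- The `v`-component of the current of the vector field `-r⁻³ ∂_{r*}`. -/
def psiP (M : ℝ) (ψ : ℝ × ℝ → ℝ) (p : ℝ × ℝ) : ℝ := lapse M p.2 / (2 * p.2) * dY ψ p ^ 2

/-- The `r`-component of the current of the vector field `-r⁻³ ∂_{r*}`. -/
def psiQ (M : ℝ) (ψ : ℝ × ℝ → ℝ) (p : ℝ × ℝ) : ℝ :=
  (psiL M ψ p ^ 2 + (lapse M p.2 / 2 * dY ψ p) ^ 2) / p.2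

/-- Working with ψ instead of rψ gives a bulk form 3l² + 3y² + 4ly without zeroth order term and
positive definite. It is needed only to control Yψ, against which the cross term of the Morawetz
current is absorbed. -/
theorem isCurrent_psi (hU : IsOpen U) (h : ContDiffOn ℝ 2 ψ U)
    (hR : R ⊆ U ∩ {p : ℝ × ℝ | 0 < p.2}) {F : ℝ × ℝ → ℝ} (hF : ∀ p ∈ R, box M ψ p = F p) :
    IsCurrent (U ∩ {p : ℝ × ℝ | 0 < p.2}) R (psiP M ψ) (psiQ M ψ)
      (fun p => -psiBulk p.2 (psiL M ψ p) (lapse M p.2 / 2 * dY ψ p) (F p)) := by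
  have cL := contDiffOn_psiL (M := M) hU h
  have cD := (contDiffOn_radial (U := U) (contDiffOn_lapse M (n := 1)))
  have cy : ContDiffOn ℝ 1 (dY ψ) (U ∩ {p : ℝ × ℝ | 0 < p.2}) :=
    (contDiffOn_dY hU h (by norm_num)).mono inter_subset_left
  have cP : ContDiffOn ℝ 1 (psiP M ψ) (U ∩ {p : ℝ × ℝ | 0 < p.2}) :=
    (cD.div (contDiffOn_const.mul contDiffOn_snd)
      fun p hp => (mul_pos two_pos hp.2).ne').mul (cy.pow 2)
  have cQ : ContDiffOn ℝ 1 (psiQ M ψ) (U ∩ {p : ℝ × ℝ | 0 < p.2}) :=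
    ((cL.pow 2).add (((cD.div_const 2).mul cy).pow 2)).div contDiffOn_snd fun p hp => ne_of_gt hp.2
  refine ⟨cP, cQ, fun p hp => ?_⟩
  have hpW := hR hp
  have hr : 0 < p.2 := hpW.2
  have dW {f : ℝ × ℝ → ℝ} (hf : ContDiffOn ℝ 1 f (U ∩ {p : ℝ × ℝ | 0 < p.2})) :
      DifferentiableAt ℝ f p :=
    (hf.contDiffAt ((isOpen_inter_pos hU).mem_nhds hpW)).differentiableAt (by simp)
  have hT := dW ((contDiffOn_dT hU h (by norm_num)).mono inter_subset_left)
  have hY := dW cy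
  have hD := hasDerivAt_lapse M hr.ne'
  have i := hasDerivAt_id p.2
  have e1 := (hasDerivAt_dT (dW cP)).unique
    (((hasDerivAt_dT hY).fun_pow 2).const_mul (lapse M p.2 / (2 * p.2)))
  have e2 := (hasDerivAt_dY (dW cQ)).unique
    ((((((hasDerivAt_dY hT).fun_add ((hD.div_const 2).fun_mul (hasDerivAt_dY hY)))).fun_pow 2).fun_add
      (((hD.div_const 2).fun_mul (hasDerivAt_dY hY)).fun_pow 2)).fun_div i hr.ne')
  have hbox := box_expand (M := M) hU h hpW.1 hr
  rw [hF p hp] at hbox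
  rw [e1, e2, dT_dY_comm hU h hpW.1]
  simp only [psiBulk, psiL, Prod.mk.eta]
  have hF' : F p = (p.2 ^ 2 * (2 * dY (dT ψ) p + lapse M p.2 * dY (dY ψ) p
      + dLapse M p.2 * dY ψ p) + 2 * p.2 * (dT ψ p + lapse M p.2 * dY ψ p)) / p.2 ^ 2 := by
    rw [← hbox]; field_simp
  rw [hF']
  generalize lapse M p.2 = D at *
  generalize dLapse M p.2 = D' at *
  generalize p.2 = r at *
  field_simp
  ring

end

end

/-! ### Bulk terms of the individual multipliers -/

noncomputable section

open Set

/-- The potential `V = D' / r` of the equation for `r ψ`. -/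
def potential (M r : ℝ) : ℝ := dLapse M r / r

theorem lapse_eq (M : ℝ) {r : ℝ} (hr : r ≠ 0) : lapse M r = (r - M) ^ 2 / r ^ 2 := by
  rw [lapse]; field_simp

theorem potential_eq (M : ℝ) {r : ℝ} (hr : r ≠ 0) : potential M r = 2 * M * (r - M) / r ^ 4 := by
  rw [potential, dLapse]; field_simp

theorem hasDerivAt_potential (M : ℝ) {r : ℝ} (hr : r ≠ 0) :
    HasDerivAt (potential M) (2 * M * (4 * M - 3 * r) / r ^ 5) r := by
  have h : HasDerivAt (fun r => 2 * M * (r - M) / r ^ 3 / r) _ r :=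
    (((((hasDerivAt_id r).sub_const M).const_mul (2 * M)).fun_div ((hasDerivAt_id r).fun_pow 3)
      (pow_ne_zero 3 hr)).fun_div (hasDerivAt_id r) hr)
  refine h.congr_deriv ?_
  simp only [id]
  field_simp
  ring

theorem phiBulk_eq {M : ℝ} {a b s k : ℝ → ℝ} {a' b' s' k' r : ℝ} (ha : HasDerivAt a a' r)
    (hb : HasDerivAt b b' r) (hs : HasDerivAt s s' r) (hk : HasDerivAt k k' r) (φ p z F : ℝ) :
    phiBulk M a b s k r φ p z F = a' * p ^ 2 + (dLapse M r * b r - lapse M r * b') / 2 * z ^ 2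
    + (a r * potential M r - 2 * s r) * φ * p + (2 * k r - b r * potential M r) * φ * z
    + (k' - (dLapse M r * s r + lapse M r * s') / 2) * φ ^ 2 + (a r * p - b r * z) * r * F := by
  rw [phiBulk, ha.deriv, hb.deriv, hs.deriv, hk.deriv, potential]

/-- The current of the Killing field `T`. -/
theorem phiBulk_killing (M : ℝ) {r : ℝ} (hr : r ≠ 0) (φ p z F : ℝ) :
    phiBulk M (fun _ => 1) (fun r => lapse M r / 2) (fun r => potential M r / 2)
      (fun r => lapse M r * potential M r / 4) r φ p z F
      = (p - lapse M r / 2 * z) * r * F := by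
  have hD := hasDerivAt_lapse M hr
  have hV := hasDerivAt_potential M hr
  rw [phiBulk_eq (hasDerivAt_const r 1) (hD.div_const 2) (hV.div_const 2)
    ((hD.fun_mul hV).div_const 4)]
  ring

/-- The current of a multiple `a L` of the null field `L`. -/
theorem phiBulk_outgoing (M : ℝ) {a : ℝ → ℝ} {a' r : ℝ} (hr : r ≠ 0) (ha : HasDerivAt a a' r)
    (φ p z F : ℝ) :
    phiBulk M a (fun _ => 0) (fun r => a r * potential M r / 2) (fun _ => 0) r φ p z F
      = a' * p ^ 2 - M * (r - M) ^ 2 / (2 * r ^ 7) * (a' * (r - M) * r + a r * (6 * M - 3 * r)) * φ ^ 2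
        + a r * p * r * F := by
  have hV := hasDerivAt_potential M hr
  rw [phiBulk_eq ha (hasDerivAt_const r 0) ((ha.fun_mul hV).div_const 2) (hasDerivAt_const r 0),
    potential_eq M hr, lapse_eq M hr, dLapse]
  field_simp
  ring

/-- The current of a multiple of the radial field `Y`. -/
theorem phiBulk_ingoing (M : ℝ) {b : ℝ → ℝ} {b' r : ℝ} (hr : r ≠ 0) (hb : HasDerivAt b b' r)
    (φ p z F : ℝ) :
    phiBulk M (fun _ => 0) b (fun _ => 0) (fun r => b r * potential M r / 2) r φ p z F
      = (2 * M * b r - (r - M) * r * b') * (r - M) / (2 * r ^ 3) * z ^ 2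
        + M / r ^ 5 * (b' * (r - M) * r + b r * (4 * M - 3 * r)) * φ ^ 2 - b r * z * r * F := by
  have hV := hasDerivAt_potential M hr
  rw [phiBulk_eq (hasDerivAt_const r 0) hb (hasDerivAt_const r 0) ((hb.fun_mul hV).div_const 2),
    potential_eq M hr, lapse_eq M hr, dLapse]
  field_simp
  ring

/-- The current that controls the zeroth order term. -/
theorem phiBulk_zeroth (M : ℝ) {r : ℝ} (hr : r ≠ 0) (φ p z F : ℝ) :
    phiBulk M (fun _ => 0) (fun _ => 0) (fun r => (r - M) ^ 3 / r ^ 5) (fun _ => 0) r φ p z F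
      = -2 * (r - M) ^ 3 / r ^ 5 * φ * p + (r - M) ^ 4 * (2 * r - 7 * M) / (2 * r ^ 8) * φ ^ 2 := by
  have hs : HasDerivAt (fun r => (r - M) ^ 3 / r ^ 5) _ r :=
    (((hasDerivAt_id r).sub_const M).fun_pow 3).fun_div ((hasDerivAt_id r).fun_pow 5)
      (pow_ne_zero 5 hr)
  rw [phiBulk_eq (hasDerivAt_const r 0) (hasDerivAt_const r 0) hs (hasDerivAt_const r 0),
    lapse_eq M hr, dLapse]
  simp only [id]
  field_simp
  ring

/-- The Morawetz multiplier `f = 1 - (M / r)^q`. -/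
def morawetzF (M q r : ℝ) : ℝ := 1 - (M / r) ^ q

theorem hasDerivAt_morawetzF {M q r : ℝ} (hM : 0 < M) (hr : 0 < r) :
    HasDerivAt (morawetzF M q) (q * (M / r) ^ q / r) r := by
  have h : HasDerivAt (fun r => M / r) (-M / r ^ 2) r := by
    have := (hasDerivAt_const r M).fun_div (hasDerivAt_id r) hr.ne'
    simpa using this
  refine ((h.rpow_const (p := q) (Or.inl (div_pos hM hr).ne')).const_sub 1).congr_deriv ?_
  rw [Real.rpow_sub_one (div_pos hM hr).ne']
  field_simp

/-- The coefficient `k` of the Morawetz current; the second term corrects the zeroth order. -/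
def morawetzK (M q r : ℝ) : ℝ :=
  morawetzF M q r * lapse M r * potential M r * (5 * M / (r + 4 * M) / 2 - 1 / 4)

/-- The multiplier is f∂_{r*}. The choice of s cancels the product φ·Lφ, and the summand −1/4 in
`morawetzK` alone would cancel φ·Yφ and leave −(DfV)'/2 as coefficient of φ². That is negative near
the horizon, where DfV grows from zero. The other summand trades the bad part for a product φ·Yφ,
which the current of ψ can absorb. -/
theorem phiBulk_morawetz {M q r : ℝ} (hM : 0 < M) (hr : 0 < r) (φ p z F : ℝ) :
    phiBulk M (morawetzF M q) (fun r => -(lapse M r * morawetzF M q r) / 2)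
      (fun r => morawetzF M q r * potential M r / 2) (morawetzK M q) r φ p z F
      = q * (M / r) ^ q / r * (p ^ 2 + (lapse M r / 2 * z) ^ 2)
        + 10 * M ^ 2 * (r - M) ^ 3 / (r ^ 6 * (r + 4 * M)) * morawetzF M q r * φ * z
        - M * (r - M) ^ 3 / (r ^ 7 * (r + 4 * M) ^ 2) * (q * (M / r) ^ q * (r - M) * (r + 4 * M)
          + morawetzF M q r * (4 * r * (r + 4 * M) - 6 * (r - M) * (r + 4 * M) - (r - M) * r)) * φ ^ 2
        + morawetzF M q r * (p + lapse M r / 2 * z) * r * F := by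
  have hD := hasDerivAt_lapse M hr.ne'
  have hV := hasDerivAt_potential M hr.ne'
  have hf := hasDerivAt_morawetzF (q := q) hM hr
  have h4 : r + 4 * M ≠ 0 := by positivity
  have hk : HasDerivAt (morawetzK M q) _ r := ((hf.fun_mul hD).fun_mul hV).fun_mul
    ((((hasDerivAt_const r (5 * M)).fun_div ((hasDerivAt_id r).add_const (4 * M)) h4).div_const 2).sub_const (1 / 4))
  rw [phiBulk_eq hf ((hD.fun_mul hf).fun_neg.div_const 2) ((hf.fun_mul hV).div_const 2) hk,
    morawetzK, potential_eq M hr.ne', lapse_eq M hr.ne', dLapse]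
  simp only [id]
  generalize morawetzF M q r = f
  generalize (M / r) ^ q = σ
  field_simp
  ring

end

/-! ### Coercivity of the Morawetz bulk -/

noncomputable section

open Set

theorem neg_mul_le_young {A : ℝ} (hA : 0 < A) (u v : ℝ) : -(A * u ^ 2 + v ^ 2 / (4 * A)) ≤ u * v := by
  have h : u * v + (A * u ^ 2 + v ^ 2 / (4 * A)) = (2 * A * u + v) ^ 2 / (4 * A) := by
    field_simp; ring
  have : 0 ≤ (2 * A * u + v) ^ 2 / (4 * A) := by positivity
  linarith

theorem mul_le_young {A : ℝ} (hA : 0 < A) (u v : ℝ) : u * v ≤ A * u ^ 2 + v ^ 2 / (4 * A) := by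
  have := neg_mul_le_young hA u (-v)
  rw [neg_sq, mul_neg] at this
  linarith

section Morawetz

variable {M q r : ℝ}

theorem div_rpow_eq (hM : 0 < M) (hr : M ≤ r) : (M / r) ^ q = M ^ q / r ^ q :=
  Real.div_rpow hM.le (hM.le.trans hr) q

/-- With s = M/r ≤ 1, the assumption q < 2 gives s^q ≥ s², and 1 − s² ≤ 2(1 − s). -/
theorem morawetzF_le (hM : 0 < M) (hr : M ≤ r) (hq2 : q < 2) :
    morawetzF M q r ≤ 2 * ((r - M) / r) := by
  have hr0 : 0 < r := hM.trans_le hr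
  have h0 : 0 < M / r := div_pos hM hr0
  have h1 : M / r ≤ 1 := (div_le_one hr0).2 hr
  have h2 : (M / r) ^ (2 : ℝ) ≤ (M / r) ^ q := Real.rpow_le_rpow_of_exponent_ge h0 h1 hq2.le
  have h3 : (r - M) / r = 1 - M / r := by field_simp
  rw [morawetzF, h3]
  norm_num at h2
  nlinarith [sq_nonneg (1 - M / r)]

/-- Bernoulli's inequality for the concave power of exponent min(q, 1). -/
theorem le_morawetzF (hM : 0 < M) (hr : M ≤ r) (hq : 0 < q) :
    min q 1 * ((r - M) / r) ≤ morawetzF M q r := by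
  have hr0 : 0 < r := hM.trans_le hr
  have h0 : 0 < M / r := div_pos hM hr0
  have h1 : M / r ≤ 1 := (div_le_one hr0).2 hr
  have h3 : (r - M) / r = 1 - M / r := by field_simp
  have h2 : (M / r) ^ q ≤ (M / r) ^ (min q 1) :=
    Real.rpow_le_rpow_of_exponent_ge h0 h1 (min_le_left _ _)
  have h4 := rpow_one_add_le_one_add_mul_self (s := M / r - 1) (by linarith) (p := min q 1)
    (le_min hq.le zero_le_one) (min_le_right _ _)
  rw [add_sub_cancel] at h4
  rw [morawetzF, h3]
  linarith

theorem morawetzF_nonneg (hM : 0 < M) (hr : M ≤ r) (hq : 0 < q) : 0 ≤ morawetzF M q r := by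
  have hr0 : 0 < r := hM.trans_le hr
  have := Real.rpow_le_one (div_pos hM hr0).le ((div_le_one hr0).2 hr) hq.le
  rw [morawetzF]; linarith

theorem morawetzF_le_one (hM : 0 < M) (hr : M ≤ r) : morawetzF M q r ≤ 1 := by
  have hr0 : 0 < r := hM.trans_le hr
  have := (Real.rpow_pos_of_pos (div_pos hM hr0) q).le
  rw [morawetzF]; linarith

/-- With x = (r − M)/r, one has (M/r)^q ≤ exp(−qx) and 1 + qx ≤ exp(qx); the product of the two is
the claim. -/
theorem deriv_morawetzF_mul_le (hM : 0 < M) (hr : M ≤ r) (hq : 0 < q) :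
    q * (M / r) ^ q * (r - M) ≤ morawetzF M q r * r := by
  have hr0 : 0 < r := hM.trans_le hr
  have h0 : 0 < M / r := div_pos hM hr0
  have h3 : (r - M) / r = 1 - M / r := by field_simp
  have e1 : M / r ≤ Real.exp (-((r - M) / r)) := by
    have := Real.add_one_le_exp (-((r - M) / r))
    rw [h3] at this ⊢
    linarith
  have e2 : (M / r) ^ q ≤ Real.exp (-(q * ((r - M) / r))) := by
    refine (Real.rpow_le_rpow h0.le e1 hq.le).trans_eq ?_
    rw [← Real.exp_mul]
    ring_nf
  have e3 := Real.add_one_le_exp (q * ((r - M) / r))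
  have e4 : (M / r) ^ q * (q * ((r - M) / r) + 1) ≤ 1 := by
    calc _ ≤ Real.exp (-(q * ((r - M) / r))) * Real.exp (q * ((r - M) / r)) := by
            refine mul_le_mul e2 e3 ?_ (Real.exp_pos _).le
            have : 0 ≤ (r - M) / r := div_nonneg (by linarith) hr0.le
            positivity
      _ = 1 := by rw [← Real.exp_add]; simp
  have e5 : q * (M / r) ^ q * (r - M) = r * ((M / r) ^ q * (q * ((r - M) / r) + 1)) - r * (M / r) ^ q := by
    field_simp; ring
  rw [e5, morawetzF]
  nlinarith

/-- The basic Morawetz bulk term, including its inhomogeneous part. -/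
def bulkZero (M q r y p z F : ℝ) : ℝ :=
  4000 * phiBulk M (fun _ => 1) (fun r => lapse M r / 2) (fun r => potential M r / 2)
      (fun r => lapse M r * potential M r / 4) r (r * y) p z F
    + phiBulk M (morawetzF M q) (fun r => -(lapse M r * morawetzF M q r) / 2)
      (fun r => morawetzF M q r * potential M r / 2) (morawetzK M q) r (r * y) p z F
    + 400 * M ^ 3 * psiBulk r ((p - lapse M r / 2 * y) / r) (lapse M r / 2 * ((z - y) / r)) F

/-- With u = Yψ one has Yφ = ru + ψ. In these variables the zeroth order part of the Morawetz bulk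
is at least eψ² + κeψu, where e = Mf(r − M)³/r⁵ and κ = 10Mr/(r + 4M) ≤ 10M. Half of eψ² and the
current of ψ absorb the cross term. The T-current adds nothing here except sources; its multiple
4000 is there for the sign of the fluxes. -/
theorem bulkZero_ge_sources (hM : 0 < M) (hr : M ≤ r) (hq : 0 < q) (hq2 : q < 2) (y p z F : ℝ) :
    q * (M / r) ^ q / r * (p ^ 2 + (lapse M r / 2 * z) ^ 2)
      + M * morawetzF M q r * (r - M) ^ 3 / (2 * r ^ 5) * y ^ 2
      + (((4000 + morawetzF M q r) * r - 400 * M ^ 3 / r ^ 2) * p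
        + ((-4000 + morawetzF M q r) * r - 400 * M ^ 3 / r ^ 2) * (lapse M r / 2 * z)
        + 400 * M ^ 3 / r ^ 2 * lapse M r * y) * F
      ≤ bulkZero M q r y p z F := by
  have hr0 : 0 < r := hM.trans_le hr
  have h0 := morawetzF_nonneg hM hr hq
  have h2 := morawetzF_le hM hr hq2
  have h3 := deriv_morawetzF_mul_le hM hr hq
  rw [bulkZero, phiBulk_killing M hr0.ne', phiBulk_morawetz hM hr0, psiBulk]
  generalize morawetzF M q r = f at *
  generalize (M / r) ^ q = σ at *
  obtain ⟨u, rfl⟩ : ∃ u, z = r * u + y := ⟨(z - y) / r, by field_simp; ring⟩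
  have hx : 0 ≤ r - M := by linarith
  have hzu : (r * u + y - y) / r = u := by field_simp; ring
  have hD : lapse M r = (r - M) ^ 2 / r ^ 2 := lapse_eq M hr0.ne'
  set x := r - M with hxd
  rw [hzu]
  set l := (p - lapse M r / 2 * y) / r with hl
  set η := lapse M r / 2 * u with hη
  set e := M * f * x ^ 3 / r ^ 5 with he
  set κ := 10 * M * r / (r + 4 * M) with hκ
  have he0 : 0 ≤ e := by positivity
  have hκ0 : 0 ≤ κ := by positivity
  have hκ1 : κ ≤ 10 * M := by
    rw [hκ, div_le_iff₀ (by positivity)]; nlinarith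
  have psi : 400 * M ^ 3 * (η ^ 2 / r ^ 2) ≤ 400 * M ^ 3 * ((3 * l ^ 2 + 3 * η ^ 2 + 4 * l * η) / r ^ 2) := by
    gcongr
    nlinarith [sq_nonneg (l + η), sq_nonneg l]
  -- This fixes the factor 400M³: the current of ψ yields (r − M)⁴u², one power of r − M short of e,
  -- and the bound f ≤ 2(r − M)/r makes up for it.
  have hu : 50 * M ^ 2 * e * u ^ 2 ≤ 400 * M ^ 3 * (η ^ 2 / r ^ 2) := by
    have : 400 * M ^ 3 * (η ^ 2 / r ^ 2) = 50 * M ^ 3 * x ^ 3 / r ^ 5 * u ^ 2 * (2 * (x / r)) := by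
      rw [hη, hD]; field_simp; ring
    rw [this, he]
    have : 50 * M ^ 2 * (M * f * x ^ 3 / r ^ 5) * u ^ 2 = 50 * M ^ 3 * x ^ 3 / r ^ 5 * u ^ 2 * f := by ring
    rw [this]
    gcongr
  -- Expand e(y + κu)² ≥ 0 and use κ²/2 ≤ 50M².
  have hcross : -(e / 2 * y ^ 2 + 50 * M ^ 2 * e * u ^ 2) ≤ κ * e * (y * u) := by
    have hk2 : κ ^ 2 ≤ 100 * M ^ 2 := by nlinarith
    have : 0 ≤ e * (y + κ * u) ^ 2 := by positivity
    have : e * u ^ 2 * κ ^ 2 ≤ e * u ^ 2 * (100 * M ^ 2) := by gcongr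
    nlinarith
  -- The y² coming from z = ru + y cancels the summand 10M(r + 4M) of the bracket; the summand −(r +
  -- 4M)² leaves exactly e.
  have hzero : e * y ^ 2 + κ * e * (y * u) ≤ 10 * M ^ 2 * x ^ 3 / (r ^ 6 * (r + 4 * M)) * f * (r * y) * (r * u + y)
        - M * x ^ 3 / (r ^ 7 * (r + 4 * M) ^ 2) * (q * σ * x * (r + 4 * M)
          + f * (4 * r * (r + 4 * M) - 6 * x * (r + 4 * M) - x * r)) * (r * y) ^ 2 := by
    have h5 : q * σ * x * (r + 4 * M)
          + f * (4 * r * (r + 4 * M) - 6 * x * (r + 4 * M) - x * r)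
        ≤ f * (10 * M * (r + 4 * M) - (r + 4 * M) ^ 2) := by
      have h6 : q * σ * x * (r + 4 * M) ≤ f * r * (r + 4 * M) := by gcongr
      have h7 : 0 ≤ f * (x * r) := by positivity
      rw [hxd] at *
      nlinarith
    have h8 : M * x ^ 3 / (r ^ 7 * (r + 4 * M) ^ 2) * (q * σ * x * (r + 4 * M)
          + f * (4 * r * (r + 4 * M) - 6 * x * (r + 4 * M) - x * r)) * (r * y) ^ 2
        ≤ M * x ^ 3 / (r ^ 7 * (r + 4 * M) ^ 2) * (f * (10 * M * (r + 4 * M) - (r + 4 * M) ^ 2)) * (r * y) ^ 2 := by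
      gcongr
    refine le_trans (le_of_eq ?_) (sub_le_sub_left h8 _)
    rw [he, hκ]
    field_simp
    ring
  have hsrc : 400 * M ^ 3 * (F * (l + η) / r) = 400 * M ^ 3 / r ^ 2 * (p - lapse M r * y
      + lapse M r / 2 * (r * u + y)) * F := by
    rw [hl, hη]; field_simp; ring
  have hee : M * f * x ^ 3 / (2 * r ^ 5) = e / 2 := by rw [he]; field_simp
  rw [hee]
  linarith

/-- Integrated local energy decay, pointwise form. -/
theorem exists_bulkZero_ge (hM : 0 < M) (hq : 0 < q) (hq2 : q < 2) :
    ∃ c C : ℝ, 0 < c ∧ 0 < C ∧ ∀ r y p z F : ℝ, M ≤ r →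
      c * ((p ^ 2 + (lapse M r * z) ^ 2) / (r * r ^ q) + (r - M) ^ 4 / r ^ 6 * y ^ 2)
        ≤ bulkZero M q r y p z F + C * (r ^ 3 * r ^ q * F ^ 2) := by
  set μ := M ^ q with hμ
  have hμ0 : 0 < μ := Real.rpow_pos_of_pos hM q
  have hm : 0 < min q 1 := lt_min hq one_pos
  set m := min q 1
  refine ⟨min (q * μ / 8) (M * m / 4), 4401 ^ 2 / (q * μ) + 160000 / (m * μ), by positivity,
    by positivity, fun r y p z F hr => ?_⟩
  have hr0 : 0 < r := hM.trans_le hr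
  have hx : 0 ≤ r - M := by linarith
  have hR : μ ≤ r ^ q := Real.rpow_le_rpow hM.le hr hq.le
  have hR0 : 0 < r ^ q := hμ0.trans_le hR
  have key := bulkZero_ge_sources hM hr hq hq2 y p z F
  have h0 := morawetzF_nonneg hM hr hq
  have h1 := morawetzF_le_one (q := q) hM hr
  have h2 := le_morawetzF hM hr hq
  rw [div_rpow_eq hM hr] at key
  have hD : lapse M r = (r - M) ^ 2 / r ^ 2 := lapse_eq M hr0.ne'
  have hM3 : 0 ≤ 400 * M ^ 3 / r ^ 2 ∧ 400 * M ^ 3 / r ^ 2 ≤ 400 * r := by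
    refine ⟨by positivity, ?_⟩
    rw [div_le_iff₀ (by positivity)]
    have : M ^ 3 ≤ r ^ 3 := by gcongr
    linarith
  generalize bulkZero M q r y p z F = Z at *
  generalize morawetzF M q r = f at *
  generalize r ^ q = R at *
  set g := q * (μ / R) / r with hg
  have hg0 : 0 < g := by positivity
  -- The sources have coefficients of size at most 4401r: 4000 from T, 1 from f, 400 from the
  -- current of ψ. Young's inequality against g ~ r^(−1−q) costs r^(3+q)F², which is the weight
  -- r^(3−α) of (A3) times the volume factor r².
  have hlin : ∀ α v : ℝ, |α| ≤ 4401 * r →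
      -(g / 2 * v ^ 2 + 4401 ^ 2 / (q * μ) / 2 * (r ^ 3 * R * F ^ 2)) ≤ α * v * F := by
    intro α v hα
    have hα2 : α ^ 2 ≤ (4401 * r) ^ 2 := sq_le_sq' (by linarith [neg_abs_le α]) ((le_abs_self α).trans hα)
    have h := neg_mul_le_young (half_pos hg0) v (α * F)
    have h' : (α * F) ^ 2 / (4 * (g / 2)) ≤ 4401 ^ 2 / (q * μ) / 2 * (r ^ 3 * R * F ^ 2) := by
      have e : 4401 ^ 2 / (q * μ) / 2 * (r ^ 3 * R * F ^ 2) = (4401 * r) ^ 2 * F ^ 2 / (4 * (g / 2)) := by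
        rw [hg]; field_simp; ring
      rw [e, mul_pow]
      gcongr
    linarith
  have hfr : 0 ≤ f * r ∧ f * r ≤ r := ⟨by positivity, mul_le_of_le_one_left hr0.le h1⟩
  have b1 : |(4000 + f) * r - 400 * M ^ 3 / r ^ 2| ≤ 4401 * r := by
    rw [abs_le]; constructor <;> linarith [hM3.1, hM3.2, hfr.1, hfr.2]
  have b2 : |(-4000 + f) * r - 400 * M ^ 3 / r ^ 2| ≤ 4401 * r := by
    rw [abs_le]; constructor <;> linarith [hM3.1, hM3.2, hfr.1, hfr.2]
  have l1 := hlin _ p b1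
  have l2 := hlin _ (lapse M r / 2 * z) b2
  have l3 : -(M * m / 4 * ((r - M) ^ 4 / r ^ 6 * y ^ 2) + 160000 / (m * μ) * (r ^ 3 * R * F ^ 2))
      ≤ 400 * M ^ 3 / r ^ 2 * lapse M r * y * F := by
    have h := neg_mul_le_young (A := M * m / 4) (by positivity) ((r - M) ^ 2 / r ^ 3 * y) (400 * M ^ 3 / r * F)
    have e1 : ((r - M) ^ 2 / r ^ 3 * y) ^ 2 = (r - M) ^ 4 / r ^ 6 * y ^ 2 := by field_simp
    have e2 : (r - M) ^ 2 / r ^ 3 * y * (400 * M ^ 3 / r * F) = 400 * M ^ 3 / r ^ 2 * lapse M r * y * F := by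
      rw [hD]; field_simp
    have e3 : (400 * M ^ 3 / r * F) ^ 2 / (4 * (M * m / 4)) ≤ 160000 / (m * μ) * (r ^ 3 * R * F ^ 2) := by
      have : (400 * M ^ 3 / r * F) ^ 2 / (4 * (M * m / 4)) = 160000 / (m * μ) * (M ^ 5 / r ^ 2 * μ * F ^ 2) := by
        field_simp; ring
      rw [this]
      have h5 : M ^ 5 / r ^ 2 ≤ r ^ 3 := by
        rw [div_le_iff₀ (by positivity), ← pow_add]; gcongr
      gcongr
    rw [e1, e2] at h
    linarith
  have l4 : M * m / 2 * ((r - M) ^ 4 / r ^ 6 * y ^ 2) ≤ M * f * (r - M) ^ 3 / (2 * r ^ 5) * y ^ 2 := by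
    have e : M * m / 2 * ((r - M) ^ 4 / r ^ 6 * y ^ 2)
        = M * (m * ((r - M) / r)) * (r - M) ^ 3 / (2 * r ^ 5) * y ^ 2 := by field_simp
    rw [e]
    gcongr
  have l5 : q * μ / 8 * ((p ^ 2 + (lapse M r * z) ^ 2) / (r * R))
      ≤ g / 2 * (p ^ 2 + (lapse M r / 2 * z) ^ 2) := by
    have e : q * μ / 8 * ((p ^ 2 + (lapse M r * z) ^ 2) / (r * R))
        = g / 8 * (p ^ 2 + (lapse M r * z) ^ 2) := by rw [hg]; field_simp
    have e' : (lapse M r / 2 * z) ^ 2 = (lapse M r * z) ^ 2 / 4 := by ring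
    have : 0 ≤ g * p ^ 2 := by positivity
    rw [e, e']
    linarith
  have hA : 0 ≤ (p ^ 2 + (lapse M r * z) ^ 2) / (r * R) := by positivity
  have hB : 0 ≤ (r - M) ^ 4 / r ^ 6 * y ^ 2 := by positivity
  have l6 := mul_le_mul_of_nonneg_right (min_le_left (q * μ / 8) (M * m / 4)) hA
  have l7 := mul_le_mul_of_nonneg_right (min_le_right (q * μ / 8) (M * m / 4)) hB
  nlinarith

end Morawetz

end

/-! ### Weighted multipliers at infinity and at the horizon -/

noncomputable section

open Set

/-- A weight comparable to `min r lam` at infinity. -/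
def weightOne (M lam r : ℝ) : ℝ := lam * (r - M) ^ 2 / (r * (r + lam))

/-- A weight comparable to `r ^ q` at infinity. -/
def weightTwo (M q r : ℝ) : ℝ := (r - M) ^ 2 / r ^ 2 * r ^ q

theorem hasDerivAt_weightOne {M lam r : ℝ} (hr : 0 < r) (hl : 0 < lam) :
    HasDerivAt (weightOne M lam)
      (lam * (r - M) * (r * lam + 2 * M * r + M * lam) / (r ^ 2 * (r + lam) ^ 2)) r := by
  have h2 : r + lam ≠ 0 := by positivity
  have h : HasDerivAt (weightOne M lam) _ r :=
    ((((hasDerivAt_id r).sub_const M).fun_pow 2).const_mul lam).fun_div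
      ((hasDerivAt_id r).fun_mul ((hasDerivAt_id r).add_const lam)) (mul_ne_zero hr.ne' h2)
  refine h.congr_deriv ?_
  simp only [id]
  field_simp
  ring

theorem hasDerivAt_weightTwo {M q r : ℝ} (hr : 0 < r) :
    HasDerivAt (weightTwo M q) ((r - M) * r ^ q / r ^ 3 * (2 * M + q * (r - M))) r := by
  have h : HasDerivAt (weightTwo M q) _ r :=
    ((((hasDerivAt_id r).sub_const M).fun_pow 2).fun_div ((hasDerivAt_id r).fun_pow 2)
      (pow_ne_zero 2 hr.ne')).fun_mul ((hasDerivAt_id r).rpow_const (p := q) (Or.inl hr.ne'))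
  refine h.congr_deriv ?_
  simp only [id]
  rw [Real.rpow_sub_one hr.ne']
  field_simp
  ring

/-- Bulk term of the current of order one. -/
def bulkOne (M q C ε lam r y p z F : ℝ) : ℝ :=
  C * bulkZero M q r y p z F
    + phiBulk M (weightOne M lam) (fun _ => 0) (fun r => weightOne M lam r * potential M r / 2)
      (fun _ => 0) r (r * y) p z F
    + ε * phiBulk M (fun _ => 0) (fun _ => 0) (fun r => (r - M) ^ 3 / r ^ 5) (fun _ => 0) r (r * y) p z F
    + phiBulk M (fun _ => 0) (fun r => (r - M) / r ^ 2) (fun _ => 0)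
      (fun r => (r - M) / r ^ 2 * potential M r / 2) r (r * y) p z F

/-- Bulk term of the current of order two. -/
def bulkTwo (M q C ε Λ r y p z F : ℝ) : ℝ :=
  Λ * (C * bulkZero M q r y p z F
    + phiBulk M (weightTwo M q) (fun _ => 0) (fun r => weightTwo M q r * potential M r / 2)
      (fun _ => 0) r (r * y) p z F
    + ε * phiBulk M (fun _ => 0) (fun _ => 0) (fun r => (r - M) ^ 3 / r ^ 5) (fun _ => 0) r (r * y) p z F)
    + phiBulk M (fun _ => 0) (fun r => 1 / r ^ 2) (fun _ => 0)
      (fun r => 1 / r ^ 2 * potential M r / 2) r (r * y) p z F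

/-- An ingoing multiplier whose weight on (Yφ)² vanishes to first order at the horizon, whereas that
of T vanishes to second order. The bulk returns the second order weight of the T-energy. -/
theorem phiBulk_inv {M r : ℝ} (hr : 0 < r) (y p z F : ℝ) :
    phiBulk M (fun _ => 0) (fun r => (r - M) / r ^ 2) (fun _ => 0)
      (fun r => (r - M) / r ^ 2 * potential M r / 2) r (r * y) p z F
    = (r - M) ^ 2 / (2 * r ^ 4) * z ^ 2 + M * (r - M) * (6 * M - 4 * r) / r ^ 5 * y ^ 2
      - (r - M) / r * z * F := by
  have hb : HasDerivAt (fun r : ℝ => (r - M) / r ^ 2) _ r :=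
    ((hasDerivAt_id r).sub_const M).fun_div ((hasDerivAt_id r).fun_pow 2) (pow_ne_zero 2 hr.ne')
  rw [phiBulk_ingoing M hr.ne' hb]
  simp only [id]
  field_simp
  ring

/-- The weight of (Yφ)² in the flux is now nonzero at the horizon. Since D and D' both vanish there,
the bulk carries one factor r − M, matching the flux of order one. -/
theorem phiBulk_inv_sq {M r : ℝ} (hr : 0 < r) (y p z F : ℝ) :
    phiBulk M (fun _ => 0) (fun r => 1 / r ^ 2) (fun _ => 0)
      (fun r => 1 / r ^ 2 * potential M r / 2) r (r * y) p z F
    = (r - M) / r ^ 4 * z ^ 2 + M * (6 * M - 5 * r) / r ^ 5 * y ^ 2 - z * F / r := by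
  have hb : HasDerivAt (fun r : ℝ => 1 / r ^ 2) _ r :=
    (hasDerivAt_const r (1 : ℝ)).fun_div ((hasDerivAt_id r).fun_pow 2) (pow_ne_zero 2 hr.ne')
  rw [phiBulk_ingoing M hr.ne' hb]
  simp only [id]
  field_simp
  ring

/-- A Hardy inequality in divergence form, by completing the square. At infinity it controls y²/r,
one power of r better than the Morawetz bulk, and pays with p²/r. -/
theorem phiBulk_zeroth_ge {M r : ℝ} (hM : 0 < M) (hr : M ≤ r) (y p z F : ℝ) :
    (r - M) ^ 4 / (2 * r ^ 5) * y ^ 2 - 7 / 2 * M * ((r - M) ^ 4 / r ^ 6 * y ^ 2)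
        - 2 * (r - M) ^ 2 / r ^ 3 * p ^ 2
      ≤ phiBulk M (fun _ => 0) (fun _ => 0) (fun r => (r - M) ^ 3 / r ^ 5) (fun _ => 0) r (r * y) p z F := by
  have hr0 : 0 < r := hM.trans_le hr
  rw [phiBulk_zeroth M hr0.ne']
  have h : 0 ≤ (r - M) ^ 2 / (2 * r ^ 5) * ((r - M) * y - 2 * r * p) ^ 2 := by positivity
  have e : (r - M) ^ 2 / (2 * r ^ 5) * ((r - M) * y - 2 * r * p) ^ 2
    = (-2 * (r - M) ^ 3 / r ^ 5 * (r * y) * p + (r - M) ^ 4 * (2 * r - 7 * M) / (2 * r ^ 8) * (r * y) ^ 2)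
      - ((r - M) ^ 4 / (2 * r ^ 5) * y ^ 2 - 7 / 2 * M * ((r - M) ^ 4 / r ^ 6 * y ^ 2)
        - 2 * (r - M) ^ 2 / r ^ 3 * p ^ 2) := by
    field_simp
    ring
  linarith

/-- In the zeroth order coefficient only a term with 7M has the wrong sign, and it carries the
weight of the Morawetz bulk. -/
theorem phiBulk_weightOne_ge {M lam r : ℝ} (hM : 0 < M) (hr : M ≤ r) (hl : 0 < lam) (y p z F : ℝ) :
    (r - M) ^ 2 / r ^ 2 * (lam / (r + lam)) ^ 2 * p ^ 2 - 7 / 2 * M ^ 2 * ((r - M) ^ 4 / r ^ 6 * y ^ 2)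
        + weightOne M lam r * p * r * F
      ≤ phiBulk M (weightOne M lam) (fun _ => 0) (fun r => weightOne M lam r * potential M r / 2)
      (fun _ => 0) r (r * y) p z F := by
  have hr0 : 0 < r := hM.trans_le hr
  have hx : 0 ≤ r - M := by linarith
  rw [phiBulk_outgoing M hr0.ne' (hasDerivAt_weightOne hr0 hl)]
  have h1 : (r - M) ^ 2 / r ^ 2 * (lam / (r + lam)) ^ 2
      ≤ lam * (r - M) * (r * lam + 2 * M * r + M * lam) / (r ^ 2 * (r + lam) ^ 2) := by
    rw [div_pow, div_mul_div_comm]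
    refine div_le_div_of_nonneg_right ?_ (by positivity)
    have : 0 ≤ lam * (r - M) * (2 * M * r + 2 * M * lam) := by positivity
    nlinarith
  have h2 : M * (r - M) ^ 2 / (2 * r ^ 7) * (lam * (r - M) * (r * lam + 2 * M * r + M * lam)
      / (r ^ 2 * (r + lam) ^ 2) * (r - M) * r + weightOne M lam r * (6 * M - 3 * r)) * (r * y) ^ 2
      ≤ 7 / 2 * M ^ 2 * ((r - M) ^ 4 / r ^ 6 * y ^ 2) := by
    have e : M * (r - M) ^ 2 / (2 * r ^ 7) * (lam * (r - M) * (r * lam + 2 * M * r + M * lam)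
      / (r ^ 2 * (r + lam) ^ 2) * (r - M) * r + weightOne M lam r * (6 * M - 3 * r)) * (r * y) ^ 2
      = (M / 2 * ((r - M) ^ 4 / r ^ 6 * y ^ 2)) *
        ((lam / (r + lam)) * (7 * M - (2 * r + (r - M) * r / (r + lam)))) := by
      rw [weightOne]; field_simp; ring
    have e' : 7 / 2 * M ^ 2 * ((r - M) ^ 4 / r ^ 6 * y ^ 2)
      = (M / 2 * ((r - M) ^ 4 / r ^ 6 * y ^ 2)) * (1 * (7 * M)) := by ring
    rw [e, e']
    refine mul_le_mul_of_nonneg_left ?_ (by positivity)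
    have h3 : lam / (r + lam) ≤ 1 := by rw [div_le_one (by positivity)]; linarith
    have h4 : 0 ≤ 2 * r + (r - M) * r / (r + lam) := by positivity
    calc _ ≤ lam / (r + lam) * (7 * M) := mul_le_mul_of_nonneg_left (by linarith) (by positivity)
      _ ≤ _ := by gcongr
  have := mul_le_mul_of_nonneg_right h1 (sq_nonneg p)
  linarith

theorem phiBulk_weightTwo_ge {M q r : ℝ} (hM : 0 < M) (hr : M ≤ r) (hq : 0 < q) (hq2 : q < 2)
    (y p z F : ℝ) :
    3 / 4 * (q * (r - M) ^ 2 * r ^ q / r ^ 3 * p ^ 2) - 4 * M * (8 * M) ^ q * ((r - M) ^ 4 / r ^ 6 * y ^ 2)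
        - 1 / q * (r ^ 3 * r ^ q * F ^ 2)
      ≤ phiBulk M (weightTwo M q) (fun _ => 0) (fun r => weightTwo M q r * potential M r / 2)
      (fun _ => 0) r (r * y) p z F := by
  have hr0 : 0 < r := hM.trans_le hr
  have hx : 0 ≤ r - M := by linarith
  have hR : 0 < r ^ q := Real.rpow_pos_of_pos hr0 q
  rw [phiBulk_outgoing M hr0.ne' (hasDerivAt_weightTwo hr0)]
  have h1 : q * (r - M) ^ 2 * r ^ q / r ^ 3 ≤ (r - M) * r ^ q / r ^ 3 * (2 * M + q * (r - M)) := by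
    have e : (r - M) * r ^ q / r ^ 3 * (2 * M + q * (r - M))
      = (r - M) * r ^ q / r ^ 3 * (2 * M) + q * (r - M) ^ 2 * r ^ q / r ^ 3 := by ring
    have : 0 ≤ (r - M) * r ^ q / r ^ 3 * (2 * M) := by positivity
    linarith
  -- By q < 2 the zeroth order bracket 8M + q(r − M) − 3r is at most 8M − r, so it is bad only for r
  -- < 8M, where r^q is bounded.
  have h8 : r ^ q * (8 * M - r) ≤ (8 * M) ^ q * (8 * M) := by
    rcases le_or_gt r (8 * M) with h | h
    · have := Real.rpow_le_rpow hr0.le h hq.le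
      calc _ ≤ (8 * M) ^ q * (8 * M - r) := by gcongr
        _ ≤ _ := mul_le_mul_of_nonneg_left (by linarith) (by positivity)
    · have : 0 ≤ (8 * M) ^ q * (8 * M) := by positivity
      nlinarith
  have h2 : M * (r - M) ^ 2 / (2 * r ^ 7) * ((r - M) * r ^ q / r ^ 3 * (2 * M + q * (r - M)) * (r - M) * r
      + weightTwo M q r * (6 * M - 3 * r)) * (r * y) ^ 2
      ≤ 4 * M * (8 * M) ^ q * ((r - M) ^ 4 / r ^ 6 * y ^ 2) := by
    have e : M * (r - M) ^ 2 / (2 * r ^ 7) * ((r - M) * r ^ q / r ^ 3 * (2 * M + q * (r - M)) * (r - M) * r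
      + weightTwo M q r * (6 * M - 3 * r)) * (r * y) ^ 2
      = (M / (2 * r) * ((r - M) ^ 4 / r ^ 6 * y ^ 2)) * (r ^ q * (8 * M + q * (r - M) - 3 * r)) := by
      rw [weightTwo]; field_simp; ring
    have h3 : r ^ q * (8 * M + q * (r - M) - 3 * r) ≤ r ^ q * (8 * M - r) := by
      refine mul_le_mul_of_nonneg_left ?_ hR.le
      have : q * (r - M) ≤ 2 * (r - M) := mul_le_mul_of_nonneg_right hq2.le hx
      linarith
    have h4 : M / (2 * r) ≤ 1 / 2 := by
      rw [div_le_div_iff₀ (by positivity) (by positivity)]; linarith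
    rw [e]
    calc _ ≤ (M / (2 * r) * ((r - M) ^ 4 / r ^ 6 * y ^ 2)) * ((8 * M) ^ q * (8 * M)) := by
            exact mul_le_mul_of_nonneg_left (h3.trans h8) (by positivity)
      _ ≤ (1 / 2 * ((r - M) ^ 4 / r ^ 6 * y ^ 2)) * ((8 * M) ^ q * (8 * M)) := by
            gcongr
      _ = _ := by ring
  have h5 : -(1 / 4 * (q * (r - M) ^ 2 * r ^ q / r ^ 3 * p ^ 2) + 1 / q * (r ^ 3 * r ^ q * F ^ 2))
      ≤ weightTwo M q r * p * r * F := by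
    have h := neg_mul_le_young (A := q * r ^ q / (4 * r ^ 3)) (by positivity) ((r - M) * p)
      ((r - M) * r ^ q / r * F)
    have e1 : (r - M) * p * ((r - M) * r ^ q / r * F) = weightTwo M q r * p * r * F := by
      rw [weightTwo]; field_simp
    have e2 : q * r ^ q / (4 * r ^ 3) * ((r - M) * p) ^ 2
      = 1 / 4 * (q * (r - M) ^ 2 * r ^ q / r ^ 3 * p ^ 2) := by ring
    have e3 : ((r - M) * r ^ q / r * F) ^ 2 / (4 * (q * r ^ q / (4 * r ^ 3)))
      = 1 / q * ((r - M) ^ 2 * r * r ^ q * F ^ 2) := by field_simp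
    rw [e1, e2, e3] at h
    have h6 : 1 / q * ((r - M) ^ 2 * r * r ^ q * F ^ 2) ≤ 1 / q * (r ^ 3 * r ^ q * F ^ 2) := by
      gcongr
      have : (r - M) ^ 2 ≤ r ^ 2 := by gcongr; linarith
      nlinarith
    linarith
  have := mul_le_mul_of_nonneg_right h1 (sq_nonneg p)
  linarith

end

/-! ### Coercivity at order one -/

noncomputable section

open Set

/-- The weight of `(Lφ)²` controlled at order two. -/
def weightW (q lam r : ℝ) : ℝ := lam ^ (2 - q) * r ^ q * (1 / r + 1 / lam)

section

variable {M q lam r : ℝ}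

/-- If h = λr/(λ + r), then 1/r + 1/λ = 1/h and h is at most λ and at most r, so h² = h^(2−q) h^q ≤
λ^(2−q) r^q. This interpolation lets order two dominate the truncated order one although q < 2. -/
theorem min_le_weightW (hq : 0 < q) (hq2 : q < 2) (hl : 0 < lam) (hr : 0 < r) :
    lam * r / (lam + r) ≤ weightW q lam r := by
  set h := lam * r / (lam + r) with hh
  have h0 : 0 < h := by positivity
  have h1 : h ≤ lam := by rw [hh, div_le_iff₀ (by positivity)]; nlinarith
  have h2 : h ≤ r := by rw [hh, div_le_iff₀ (by positivity)]; nlinarith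
  have h3 : h ^ 2 ≤ lam ^ (2 - q) * r ^ q := by
    calc h ^ 2 = h ^ (2 - q) * h ^ q := by
          rw [← Real.rpow_add h0]; norm_num
      _ ≤ _ := mul_le_mul (Real.rpow_le_rpow h0.le h1 (by linarith))
          (Real.rpow_le_rpow h0.le h2 hq.le) (by positivity) (by positivity)
  have e : 1 / r + 1 / lam = 1 / h := by rw [hh]; field_simp
  rw [weightW, e, mul_one_div, le_div_iff₀ h0]
  linarith

theorem weightOne_le (hM : 0 < M) (hr : M ≤ r) (hl : 0 < lam) :
    weightOne M lam r ≤ lam * r / (lam + r) := by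
  have hr0 : 0 < r := hM.trans_le hr
  have : (r - M) ^ 2 ≤ r ^ 2 := by gcongr; linarith
  rw [weightOne, div_le_div_iff₀ (by positivity) (by positivity)]
  have : lam * (lam + r) * (r - M) ^ 2 ≤ lam * (lam + r) * r ^ 2 := by gcongr
  linarith

theorem weightOne_nonneg (hM : 0 < M) (hr : M ≤ r) (hl : 0 < lam) : 0 ≤ weightOne M lam r := by
  have hr0 : 0 < r := hM.trans_le hr
  rw [weightOne]; positivity

theorem weightOne_le_self (hM : 0 < M) (hr : M ≤ r) (hl : 0 < lam) : weightOne M lam r ≤ r := by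
  have hr0 : 0 < r := hM.trans_le hr
  refine (weightOne_le hM hr hl).trans ?_
  rw [div_le_iff₀ (by positivity)]; nlinarith

theorem const_le_weightW (hM : 0 < M) (hr : M ≤ r) (hq : 0 < q) (hq2 : q < 2) (hl : 1 ≤ lam) :
    M / (1 + M) ≤ weightW q lam r := by
  have hr0 : 0 < r := hM.trans_le hr
  refine le_trans ?_ (min_le_weightW hq hq2 (by linarith) hr0)
  rw [div_le_div_iff₀ (by positivity) (by positivity)]
  have : 0 ≤ (r - M) * lam := mul_nonneg (by linarith) (by linarith)
  have : M * r ≤ lam * r * M := by nlinarith [mul_nonneg (mul_nonneg hM.le hr0.le) (sub_nonneg.2 hl)]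
  nlinarith

/-- The good terms of order one. -/
def goodOne (M lam r y p z : ℝ) : ℝ :=
  (lam / (r + lam)) ^ 2 * p ^ 2 + (r - M) ^ 2 / r ^ 4 * z ^ 2 + (r - M) / r ^ 2 * y ^ 2

theorem sq_le_cube_rpow (hM : 0 < M) (hr : M ≤ r) (hq : 0 < q) :
    r ^ 2 ≤ 1 / (M * M ^ q) * (r ^ 3 * r ^ q) := by
  have hr0 : 0 < r := hM.trans_le hr
  have hμ0 : 0 < M ^ q := Real.rpow_pos_of_pos hM q
  have hR : M ^ q ≤ r ^ q := Real.rpow_le_rpow hM.le hr hq.le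
  rw [one_div_mul_eq_div, le_div_iff₀ (by positivity)]
  calc r ^ 2 * (M * M ^ q) ≤ r ^ 2 * (r * r ^ q) := by gcongr
    _ = _ := by ring

/-- The ingoing current has a zeroth order coefficient proportional to 6M − 4r, good near the
horizon and bad beyond 3M/2. The Morawetz and Hardy terms, which vanish at the horizon, take over
there. -/
theorem bulkOne_zeroth (hM : 0 < M) (hr : M ≤ r) :
    min (M / 256) (1 / (8 * M)) * ((r - M) / r ^ 2)
      ≤ 8 * ((r - M) ^ 4 / r ^ 6) + M / 16 * ((r - M) ^ 4 / (2 * r ^ 5))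
        + M * (r - M) * (6 * M - 4 * r) / r ^ 5 := by
  have hr0 : 0 < r := hM.trans_le hr
  obtain ⟨x, rfl⟩ : ∃ x, r = x + M := ⟨r - M, by ring⟩
  have hx : 0 ≤ x := by linarith
  rw [add_sub_cancel_right]
  set c := min (M / 256) (1 / (8 * M))
  have c0 : 0 < c := lt_min (by positivity) (by positivity)
  have c1 : c * x ^ 4 ≤ M / 256 * x ^ 4 := by gcongr; exact min_le_left _ _
  have c2 : c * M ^ 4 ≤ M ^ 3 / 8 := by
    calc c * M ^ 4 ≤ 1 / (8 * M) * M ^ 4 := by gcongr; exact min_le_right _ _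
      _ = _ := by field_simp
  have c3 : c * (x + M) ^ 4 ≤ c * (8 * (x ^ 4 + M ^ 4)) := by
    gcongr
    nlinarith [sq_nonneg (x - M), sq_nonneg (x ^ 2 - M ^ 2), mul_nonneg hx hM.le]
  -- The Morawetz factor 8 is chosen for this: 8x³ + M(2M − 4x)(x + M) = (2x − M)²(2x + M) + M³,
  -- which leaves M³ to spare.
  have c4 : 0 ≤ (2 * x - M) ^ 2 * (2 * x + M) := by positivity
  have c5 : 0 ≤ M / 32 * x ^ 3 * M := by positivity
  have e : 8 * (x ^ 4 / (x + M) ^ 6) + M / 16 * (x ^ 4 / (2 * (x + M) ^ 5))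
        + M * x * (6 * M - 4 * (x + M)) / (x + M) ^ 5 - c * (x / (x + M) ^ 2)
      = x / (x + M) ^ 6 * (8 * x ^ 3 + M / 32 * x ^ 3 * (x + M) + M * (6 * M - 4 * (x + M)) * (x + M)
        - c * (x + M) ^ 4) := by
    field_simp
    ring
  have : 0 ≤ x / (x + M) ^ 6 * (8 * x ^ 3 + M / 32 * x ^ 3 * (x + M) + M * (6 * M - 4 * (x + M)) * (x + M)
        - c * (x + M) ^ 4) := by
    refine mul_nonneg (by positivity) ?_
    nlinarith
  linarith

/-- The coefficient of p² from the outgoing weight vanishes at the horizon, where the Morawetz bulk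
replaces it. The Hardy loss of size M/(8r) is absorbed when r ≤ λ; for r > λ it is at most M/(8λ).
That remainder is kept and charged to order two later. -/
theorem bulkOne_outgoing (hM : 0 < M) (hr : M ≤ r) (hq : 0 < q) (hl : 0 < lam) {c : ℝ} (hc : 0 < c) :
    min (1 / 8) (c / (2 * M * (2 * M) ^ q)) * (lam / (r + lam)) ^ 2 - M / 8 * (1 / lam)
      ≤ c / (r * r ^ q) + (r - M) ^ 2 / r ^ 2 * (lam / (r + lam)) ^ 2
        - M / 16 * (2 * (r - M) ^ 2 / r ^ 3) := by
  have hr0 : 0 < r := hM.trans_le hr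
  have hR : 0 < r ^ q := Real.rpow_pos_of_pos hr0 q
  have hx : 0 ≤ (r - M) / r := div_nonneg (by linarith) hr0.le
  have hx1 : (r - M) / r ≤ 1 := by rw [div_le_one hr0]; linarith
  set ρ := lam / (r + lam) with hρ
  have hρ0 : 0 < ρ := by positivity
  have hρ1 : ρ ≤ 1 := by rw [hρ, div_le_one (by positivity)]; linarith
  have h1 : (r - M) ^ 2 / r ^ 2 = ((r - M) / r) ^ 2 := by rw [div_pow]
  have h2 : M / 16 * (2 * (r - M) ^ 2 / r ^ 3) = ((r - M) / r) ^ 2 * (M / (8 * r)) := by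
    field_simp; ring
  have h3 : M / (8 * r) ≤ 1 / 2 * ρ ^ 2 + M / 8 * (1 / lam) := by
    rcases le_or_gt r lam with h | h
    · have h4 : M / (8 * r) ≤ 1 / 8 := by rw [div_le_div_iff₀ (by positivity) (by positivity)]; linarith
      have h5 : 1 / 2 ≤ ρ := by rw [hρ, div_le_div_iff₀ (by positivity) (by positivity)]; linarith
      have : 0 ≤ M / 8 * (1 / lam) := by positivity
      nlinarith
    · have : M / (8 * r) ≤ M / 8 * (1 / lam) := by
        have h4 : 1 / r ≤ 1 / lam := one_div_le_one_div_of_le hl h.le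
        calc M / (8 * r) = M / 8 * (1 / r) := by field_simp
          _ ≤ _ := by gcongr
      nlinarith [sq_nonneg ρ]
  have hξ : ((r - M) / r) ^ 2 ≤ 1 := pow_le_one₀ hx hx1
  have h4 : min (1 / 8) (c / (2 * M * (2 * M) ^ q)) * ρ ^ 2
      ≤ c / (r * r ^ q) + 1 / 2 * ((r - M) / r) ^ 2 * ρ ^ 2 := by
    rcases le_or_gt r (2 * M) with h | h
    · have h5 : c / (2 * M * (2 * M) ^ q) ≤ c / (r * r ^ q) := by
        have := Real.rpow_le_rpow hr0.le h hq.le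
        gcongr
      have h6 : min (1 / 8) (c / (2 * M * (2 * M) ^ q)) ≤ c / (r * r ^ q) := (min_le_right _ _).trans h5
      have h7 : ρ ^ 2 ≤ 1 := pow_le_one₀ hρ0.le hρ1
      have h8 : 0 < c / (r * r ^ q) := by positivity
      have : 0 ≤ 1 / 2 * ((r - M) / r) ^ 2 * ρ ^ 2 := by positivity
      nlinarith
    · have h5 : 1 / 2 ≤ (r - M) / r := by rw [div_le_div_iff₀ (by positivity) (by positivity)]; linarith
      have h6 : 1 / 4 ≤ ((r - M) / r) ^ 2 := by nlinarith
      have h8 : 0 < c / (r * r ^ q) := by positivity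
      have h7 := min_le_left (1 / 8) (c / (2 * M * (2 * M) ^ q))
      nlinarith [sq_nonneg ρ]
  have h5 : ((r - M) / r) ^ 2 * (M / (8 * r)) ≤ 1 / 2 * ((r - M) / r) ^ 2 * ρ ^ 2 + M / 8 * (1 / lam) := by
    have := mul_le_mul_of_nonneg_left h3 (sq_nonneg ((r - M) / r))
    have h6 : ((r - M) / r) ^ 2 * (M / 8 * (1 / lam)) ≤ 1 * (M / 8 * (1 / lam)) := by gcongr
    linarith
  rw [h1, h2]
  linarith

theorem exists_bulkOne_ge_sources (hM : 0 < M) (hq : 0 < q) (hq2 : q < 2) :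
    ∃ C₁ c C : ℝ, 0 < C₁ ∧ 0 < c ∧ 0 < C ∧ ∀ lam r y p z F : ℝ, M ≤ r → 1 ≤ lam →
      c * goodOne M lam r y p z - M / 8 * (1 / lam) * p ^ 2 + weightOne M lam r * p * r * F
        - C * (r ^ 3 * r ^ q * F ^ 2) ≤ bulkOne M q C₁ (M / 16) lam r y p z F := by
  obtain ⟨c₀, C₀, hc₀, hC₀, hbulk⟩ := exists_bulkZero_ge hM hq hq2
  have hμ0 : 0 < M ^ q := Real.rpow_pos_of_pos hM q
  -- Multiple of the Morawetz bulk: 8 for `bulkOne_zeroth`, the other summands for the zeroth order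
  -- losses of the Hardy current (with ε = M/16) and of the outgoing current.
  obtain ⟨k, hk⟩ : ∃ k, k = 8 + 7 / 2 * M * (M / 16) + 7 / 2 * M ^ 2 := ⟨_, rfl⟩
  have hk0 : 0 < k := by rw [hk]; positivity
  have hc₁0 : 0 < min (1 / 8) (k / (2 * M * (2 * M) ^ q)) := lt_min (by norm_num) (by positivity)
  have hc₂0 : 0 < min (M / 256) (1 / (8 * M)) := lt_min (by positivity) (by positivity)
  have hone (lam r : ℝ) (h1 : M ≤ r) (h2 : 0 < lam) := bulkOne_outgoing hM h1 hq h2 hk0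
  have htwo (r : ℝ) (h1 : M ≤ r) := bulkOne_zeroth hM h1
  generalize min (1 / 8) (k / (2 * M * (2 * M) ^ q)) = c₁ at *
  generalize min (M / 256) (1 / (8 * M)) = c₂ at *
  refine ⟨k / c₀, min (min c₁ c₂) (1 / 4), k / c₀ * C₀ + 1 / (M * M ^ q),
    by positivity, by positivity, by positivity, ?_⟩
  intro lam r y p z F hr hl
  have hr0 : 0 < r := hM.trans_le hr
  have hx : 0 ≤ r - M := by linarith
  have hl0 : 0 < lam := by linarith
  have b0 := mul_le_mul_of_nonneg_left (hbulk r y p z F hr) (show 0 ≤ k / c₀ by positivity)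
  have b1 := phiBulk_weightOne_ge hM hr hl0 y p z F
  have b2 := mul_le_mul_of_nonneg_left (phiBulk_zeroth_ge hM hr y p z F) (show 0 ≤ M / 16 by positivity)
  have b3 := phiBulk_inv (M := M) hr0 y p z F
  have z0 := mul_le_mul_of_nonneg_right (htwo r hr) (sq_nonneg y)
  have p0 := mul_le_mul_of_nonneg_right (hone lam r hr hl0) (sq_nonneg p)
  have s0 := neg_mul_le_young (A := 1 / 4) (by norm_num) ((r - M) / r ^ 2 * z) (-(r * F))
  have hsq := mul_le_mul_of_nonneg_right (sq_le_cube_rpow hM hr hq) (sq_nonneg F)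
  have hR : 0 < r ^ q := Real.rpow_pos_of_pos hr0 q
  have e0 : k / c₀ * (c₀ * ((p ^ 2 + (lapse M r * z) ^ 2) / (r * r ^ q) + (r - M) ^ 4 / r ^ 6 * y ^ 2))
      = k / (r * r ^ q) * p ^ 2 + k / (r * r ^ q) * (lapse M r * z) ^ 2 + k * ((r - M) ^ 4 / r ^ 6 * y ^ 2) := by
    field_simp
  have e1 : 0 ≤ k / (r * r ^ q) * (lapse M r * z) ^ 2 := by positivity
  have e2 : (r - M) / r ^ 2 * z * -(r * F) = - ((r - M) / r * z * F) := by field_simp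
  have e3 : (-(r * F)) ^ 2 / (4 * (1 / 4)) = r ^ 2 * F ^ 2 := by ring
  have e4 : (1 : ℝ) / 4 * ((r - M) / r ^ 2 * z) ^ 2 = 1 / 4 * ((r - M) ^ 2 / r ^ 4 * z ^ 2) := by
    field_simp
  have e5 : (r - M) ^ 2 / (2 * r ^ 4) * z ^ 2 = 1 / 2 * ((r - M) ^ 2 / r ^ 4 * z ^ 2) := by
    field_simp
  have e6 : k * ((r - M) ^ 4 / r ^ 6 * y ^ 2) = 8 * ((r - M) ^ 4 / r ^ 6 * y ^ 2)
      + 7 / 2 * M * (M / 16) * ((r - M) ^ 4 / r ^ 6 * y ^ 2)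
      + 7 / 2 * M ^ 2 * ((r - M) ^ 4 / r ^ 6 * y ^ 2) := by
    rw [hk]; ring
  rw [e2, e3, e4] at s0
  rw [e5] at b3
  rw [e0, e6] at b0
  have f4 : min (min c₁ c₂) (1 / 4) * goodOne M lam r y p z
      ≤ c₁ * ((lam / (r + lam)) ^ 2 * p ^ 2) + 1 / 4 * ((r - M) ^ 2 / r ^ 4 * z ^ 2)
      + c₂ * ((r - M) / r ^ 2 * y ^ 2) := by
    rw [goodOne, mul_add, mul_add]
    have m1 : min (min c₁ c₂) (1 / 4) ≤ c₁ := (min_le_left _ _).trans (min_le_left _ _)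
    have m2 : min (min c₁ c₂) (1 / 4) ≤ c₂ := (min_le_left _ _).trans (min_le_right _ _)
    gcongr
    exact min_le_right _ _
  refine le_trans (sub_le_sub_right (add_le_add_left (sub_le_sub_right f4 _) _) _) ?_
  rw [bulkOne, b3]
  generalize phiBulk M (weightOne M lam) (fun _ => 0) (fun r => weightOne M lam r * potential M r / 2)
    (fun _ => 0) r (r * y) p z F = B₁ at *
  generalize phiBulk M (fun _ => 0) (fun _ => 0) (fun r => (r - M) ^ 3 / r ^ 5) (fun _ => 0) r (r * y) p z F
    = B₂ at *
  generalize bulkZero M q r y p z F = B₀ at *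
  linarith

theorem exists_bulkOne_ge (hM : 0 < M) (hq : 0 < q) (hq2 : q < 2) :
    ∃ C₁ c C : ℝ, 0 < C₁ ∧ 0 < c ∧ 0 < C ∧ ∀ lam t r y p z F : ℝ, M ≤ r → 1 ≤ lam →
      1 ≤ t → t ≤ lam →
      c * (t * goodOne M lam r y p z)
        ≤ t * bulkOne M q C₁ (M / 16) lam r y p z F
          + C * (weightW q lam r * p ^ 2 + t ^ 2 * (r ^ 3 * r ^ q * F ^ 2)) := by
  obtain ⟨C₁, c, C, hC₁, hc, hC, hmain⟩ := exists_bulkOne_ge_sources hM hq hq2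
  have hμ0 : 0 < M ^ q := Real.rpow_pos_of_pos hM q
  refine ⟨C₁, c, (1 + M) + 1 + C + 1 / 4 * (1 / M ^ q), hC₁, hc, by positivity, ?_⟩
  intro lam t r y p z F hr hl ht htl
  have hr0 : 0 < r := hM.trans_le hr
  have hl0 : 0 < lam := by linarith
  have hR : 0 < r ^ q := Real.rpow_pos_of_pos hr0 q
  have hW0 := const_le_weightW hM hr hq hq2 hl
  have hW1 := (weightOne_le hM hr hl0).trans (min_le_weightW hq hq2 hl0 hr0)
  have hW2 := weightOne_le_self hM hr hl0
  have hW3 := weightOne_nonneg hM hr hl0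
  have hWpos : 0 < weightW q lam r := lt_of_lt_of_le (by positivity) hW0
  have main := hmain lam r y p z F hr hl
  have hRμ := Real.rpow_le_rpow hM.le hr hq.le
  generalize goodOne M lam r y p z = G at *
  generalize bulkOne M q C₁ (M / 16) lam r y p z F = B at *
  generalize weightW q lam r = W at *
  generalize weightOne M lam r = a at *
  generalize r ^ q = R at *
  generalize M ^ q = μ at *
  have t0 : 0 < t := by linarith
  have hX0 : 0 ≤ r ^ 3 * R * F ^ 2 := by positivity
  have f1 : t * (M / 8 * (1 / lam) * p ^ 2) ≤ (1 + M) * (W * p ^ 2) := by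
    have h1 : t * (1 / lam) ≤ 1 := by rw [mul_one_div, div_le_one hl0]; exact htl
    have h2 : M ≤ (1 + M) * W := by
      rw [div_le_iff₀ (by positivity)] at hW0; linarith
    calc t * (M / 8 * (1 / lam) * p ^ 2) = t * (1 / lam) * (M / 8 * p ^ 2) := by ring
      _ ≤ 1 * (M * p ^ 2) := by gcongr; linarith
      _ ≤ 1 * ((1 + M) * W * p ^ 2) := by gcongr
      _ = _ := by ring
  have f2 : -(W * p ^ 2 + 1 / 4 * (1 / μ) * (t ^ 2 * (r ^ 3 * R * F ^ 2))) ≤ t * (a * p * r * F) := by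
    have h := neg_mul_le_young hWpos p (t * a * r * F)
    have h1 : (t * a * r * F) ^ 2 / (4 * W) ≤ 1 / 4 * (1 / μ) * (t ^ 2 * (r ^ 3 * R * F ^ 2)) := by
      rw [div_le_iff₀ (by positivity)]
      -- The outgoing weight is at most W by `min_le_weightW` and at most r. Hence Young against Wp²
      -- costs only t²r³F², without a factor λ.
      have h2 : a ^ 2 ≤ W * r := by
        rw [sq]; exact mul_le_mul hW1 hW2 hW3 hWpos.le
      have h3 : 1 ≤ 1 / μ * R := by
        rw [one_div_mul_eq_div, one_le_div hμ0]; exact hRμ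
      calc (t * a * r * F) ^ 2 = t ^ 2 * r ^ 2 * F ^ 2 * a ^ 2 := by ring
        _ ≤ t ^ 2 * r ^ 2 * F ^ 2 * (W * r) := by gcongr
        _ = t ^ 2 * r ^ 2 * F ^ 2 * (W * r) * 1 := by ring
        _ ≤ t ^ 2 * r ^ 2 * F ^ 2 * (W * r) * (1 / μ * R) := by gcongr
        _ = _ := by ring
    have h4 : p * (t * a * r * F) = t * (a * p * r * F) := by ring
    rw [h4] at h
    linarith
  generalize r ^ 3 * R * F ^ 2 = X at *
  have f3 : t * (C * X) ≤ C * (t ^ 2 * X) := by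
    have : t * X ≤ t ^ 2 * X := by gcongr; nlinarith
    calc _ = C * (t * X) := by ring
      _ ≤ _ := by gcongr
  have hp0 : 0 ≤ W * p ^ 2 := by positivity
  have hX1 : 0 ≤ t ^ 2 * X := by positivity
  have f5 := mul_le_mul_of_nonneg_left main t0.le
  have g1 : 0 ≤ (C + 1 / 4 * (1 / μ)) * (W * p ^ 2) := by positivity
  have g2 : 0 ≤ (1 + M + 1) * (t ^ 2 * X) := by positivity
  linarith

end

end

/-! ### Coercivity at order two -/

noncomputable section

open Set

section

variable {M q lam r : ℝ}

theorem bulkTwo_zeroth (hM : 0 < M) (hr : M ≤ r) {ε : ℝ} (hε : 0 < ε) :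
    min (ε / 32) (1 / (32 * M ^ 2)) * (1 / r)
      ≤ 1400 / M * ((r - M) ^ 4 / r ^ 6) + ε * ((r - M) ^ 4 / (2 * r ^ 5))
        + M * (6 * M - 5 * r) / r ^ 5 := by
  have hr0 : 0 < r := hM.trans_le hr
  obtain ⟨x, rfl⟩ : ∃ x, r = x + M := ⟨r - M, by ring⟩
  have hx : 0 ≤ x := by linarith
  rw [add_sub_cancel_right]
  have c0 : 0 < min (ε / 32) (1 / (32 * M ^ 2)) := lt_min (by positivity) (by positivity)
  have c1 : min (ε / 32) (1 / (32 * M ^ 2)) * x ^ 5 ≤ ε / 32 * x ^ 5 := by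
    gcongr; exact min_le_left _ _
  have c2 : min (ε / 32) (1 / (32 * M ^ 2)) * M ^ 5 ≤ M ^ 3 / 32 := by
    calc _ ≤ 1 / (32 * M ^ 2) * M ^ 5 := by gcongr; exact min_le_right _ _
      _ = _ := by field_simp
  generalize min (ε / 32) (1 / (32 * M ^ 2)) = c at *
  have c3 : c * (x + M) ^ 5 ≤ c * (16 * (x ^ 5 + M ^ 5)) := by
    gcongr
    have := add_pow_le hx hM.le 5
    norm_num at this
    exact this
  -- M(6M − 5r)r = M³ − 4M²x − 5Mx². This and the next inequality bound the loss by 3M³/8 +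
  -- 1369x⁴/M, within the 1400x⁴/M of the Morawetz bulk; c then uses at most half of M³.
  have c4 : 4 * M ^ 2 * x ≤ M ^ 3 / 8 + 32 * M * x ^ 2 := by
    nlinarith [mul_nonneg hM.le (sq_nonneg (M - 16 * x))]
  have c5 : 37 * M * x ^ 2 ≤ M ^ 3 / 4 + 1369 * (x ^ 4 / M) := by
    have h : 0 ≤ (M ^ 2 / 2 - 37 * x ^ 2) ^ 2 / M := by positivity
    have e : (M ^ 2 / 2 - 37 * x ^ 2) ^ 2 / M = M ^ 3 / 4 + 1369 * (x ^ 4 / M) - 37 * M * x ^ 2 := by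
      field_simp; ring
    linarith
  have c6 : 0 ≤ x ^ 4 / M := by positivity
  have c7 : 0 ≤ ε * x ^ 4 * M := by positivity
  have e : 1400 / M * (x ^ 4 / (x + M) ^ 6) + ε * (x ^ 4 / (2 * (x + M) ^ 5))
        + M * (6 * M - 5 * (x + M)) / (x + M) ^ 5 - c * (1 / (x + M))
      = 1 / (x + M) ^ 6 * (1400 * (x ^ 4 / M) + ε / 2 * x ^ 4 * (x + M) + M * (6 * M - 5 * (x + M)) * (x + M)
        - c * (x + M) ^ 5) := by
    field_simp
  have : 0 ≤ 1 / (x + M) ^ 6 * (1400 * (x ^ 4 / M) + ε / 2 * x ^ 4 * (x + M) + M * (6 * M - 5 * (x + M)) * (x + M)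
        - c * (x + M) ^ 5) := by
    refine mul_nonneg (by positivity) ?_
    have : 0 < M ^ 3 := by positivity
    linarith
  linarith

theorem bulkTwo_outgoing (hM : 0 < M) (hr : M ≤ r) (hq : 0 < q) {k : ℝ} (hk : 0 < k) :
    min (q / 8) (k / ((2 * M) ^ q) ^ 2) * (r ^ q / r)
      ≤ k / (r * r ^ q) + 1 / 2 * (q * (r - M) ^ 2 * r ^ q / r ^ 3) := by
  have hr0 : 0 < r := hM.trans_le hr
  have hR : 0 < r ^ q := Real.rpow_pos_of_pos hr0 q
  rcases le_or_gt r (2 * M) with h | h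
  · have h5 : k / ((2 * M) ^ q) ^ 2 ≤ k / (r ^ q) ^ 2 := by
      have := Real.rpow_le_rpow hr0.le h hq.le
      gcongr
    have h6 : 0 ≤ 1 / 2 * (q * (r - M) ^ 2 * r ^ q / r ^ 3) := by positivity
    calc _ ≤ k / (r ^ q) ^ 2 * (r ^ q / r) := by gcongr; exact (min_le_right _ _).trans h5
      _ = k / (r * r ^ q) := by field_simp
      _ ≤ _ := by linarith
  · have h6 : 0 < k / (r * r ^ q) := by positivity
    have h7 : (r / 2) ^ 2 ≤ (r - M) ^ 2 := by gcongr; linarith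
    calc _ ≤ q / 8 * (r ^ q / r) := by gcongr; exact min_le_left _ _
      _ = 1 / 2 * (q * (r / 2) ^ 2 * r ^ q / r ^ 3) := by field_simp; norm_num
      _ ≤ 1 / 2 * (q * (r - M) ^ 2 * r ^ q / r ^ 3) := by gcongr
      _ ≤ _ := by linarith

/-- The product zF/r stays on the left: the coefficient of z² in the bulk vanishes at the horizon
and cannot absorb it. The factor Λ multiplies everything except the ingoing current, so that this
product is not amplified by Λ. -/
theorem exists_bulkTwo_ge (hM : 0 < M) (hq : 0 < q) (hq2 : q < 2) :
    ∃ C₂ ε c C : ℝ, 0 < C₂ ∧ 0 < ε ∧ 0 < c ∧ c ≤ 1 ∧ 0 < C ∧ ∀ Λ r y p z F : ℝ, M ≤ r → 1 ≤ Λ →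
      c * (Λ * (r ^ q / r) * p ^ 2 + (r - M) / r ^ 4 * z ^ 2 + 1 / r * y ^ 2) - z * F / r
        - C * (Λ * (r ^ 3 * r ^ q * F ^ 2)) ≤ bulkTwo M q C₂ ε Λ r y p z F := by
  obtain ⟨c₀, C₀, hc₀, hC₀, hbulk⟩ := exists_bulkZero_ge hM hq hq2
  have hμ0 : 0 < M ^ q := Real.rpow_pos_of_pos hM q
  -- With this ε the Hardy loss in p² is a quarter of q(r − M)²r^q/r³; the outgoing current has
  -- three quarters of it, so half is left.
  obtain ⟨ε, hε⟩ : ∃ ε, ε = q * M ^ q / 8 := ⟨_, rfl⟩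
  have hε0 : 0 < ε := by rw [hε]; positivity
  obtain ⟨k, hk⟩ : ∃ k, k = 1400 / M + 7 / 2 * M * ε + 4 * M * (8 * M) ^ q := ⟨_, rfl⟩
  have hk0 : 0 < k := by rw [hk]; positivity
  have hc₁0 : 0 < min (q / 8) (k / ((2 * M) ^ q) ^ 2) := lt_min (by positivity) (by positivity)
  have hc₂0 : 0 < min (ε / 32) (1 / (32 * M ^ 2)) := lt_min (by positivity) (by positivity)
  have hone (r : ℝ) (h1 : M ≤ r) := bulkTwo_outgoing hM h1 hq hk0
  have htwo (r : ℝ) (h1 : M ≤ r) := bulkTwo_zeroth hM h1 hε0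
  generalize min (q / 8) (k / ((2 * M) ^ q) ^ 2) = c₁ at *
  generalize min (ε / 32) (1 / (32 * M ^ 2)) = c₂ at *
  refine ⟨k / c₀, ε, min (min c₁ c₂) 1, k / c₀ * C₀ + 1 / q,
    by positivity, hε0, by positivity, min_le_right _ _, by positivity, ?_⟩
  intro Λ r y p z F hr hΛ
  have hr0 : 0 < r := hM.trans_le hr
  have hx : 0 ≤ r - M := by linarith
  have hΛ0 : 0 < Λ := by linarith
  have b0 := mul_le_mul_of_nonneg_left (hbulk r y p z F hr) (show 0 ≤ k / c₀ by positivity)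
  have b1 := phiBulk_weightTwo_ge hM hr hq hq2 y p z F
  have b2 := mul_le_mul_of_nonneg_left (phiBulk_zeroth_ge hM hr y p z F) hε0.le
  have b3 := phiBulk_inv_sq (M := M) hr0 y p z F
  have z0 := mul_le_mul_of_nonneg_right (htwo r hr) (sq_nonneg y)
  have p0 := mul_le_mul_of_nonneg_right (hone r hr) (sq_nonneg p)
  have hR : 0 < r ^ q := Real.rpow_pos_of_pos hr0 q
  have e0 : k / c₀ * (c₀ * ((p ^ 2 + (lapse M r * z) ^ 2) / (r * r ^ q) + (r - M) ^ 4 / r ^ 6 * y ^ 2))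
      = k / (r * r ^ q) * p ^ 2 + k / (r * r ^ q) * (lapse M r * z) ^ 2 + k * ((r - M) ^ 4 / r ^ 6 * y ^ 2) := by
    field_simp
  have e1 : 0 ≤ k / (r * r ^ q) * (lapse M r * z) ^ 2 := by positivity
  have e6 : k * ((r - M) ^ 4 / r ^ 6 * y ^ 2) = 1400 / M * ((r - M) ^ 4 / r ^ 6 * y ^ 2)
      + 7 / 2 * M * ε * ((r - M) ^ 4 / r ^ 6 * y ^ 2)
      + 4 * M * (8 * M) ^ q * ((r - M) ^ 4 / r ^ 6 * y ^ 2) := by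
    rw [hk]; ring
  rw [e0, e6] at b0
  have e7 : ε * (2 * (r - M) ^ 2 / r ^ 3 * p ^ 2) ≤ 1 / 4 * (q * (r - M) ^ 2 * r ^ q / r ^ 3 * p ^ 2) := by
    have : M ^ q ≤ r ^ q := Real.rpow_le_rpow hM.le hr hq.le
    calc _ = 1 / 4 * (q * (r - M) ^ 2 * M ^ q / r ^ 3 * p ^ 2) := by rw [hε]; field_simp; ring
      _ ≤ _ := by gcongr
  have f4 : min (min c₁ c₂) 1 * (Λ * (r ^ q / r) * p ^ 2 + (r - M) / r ^ 4 * z ^ 2 + 1 / r * y ^ 2)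
      ≤ Λ * (c₁ * (r ^ q / r) * p ^ 2) + (r - M) / r ^ 4 * z ^ 2 + c₂ * (1 / r) * y ^ 2 := by
    have m1 : min (min c₁ c₂) 1 ≤ c₁ := (min_le_left _ _).trans (min_le_left _ _)
    have m2 : min (min c₁ c₂) 1 ≤ c₂ := (min_le_left _ _).trans (min_le_right _ _)
    have m3 : min (min c₁ c₂) 1 ≤ 1 := min_le_right _ _
    have n1 : 0 ≤ Λ * (r ^ q / r) * p ^ 2 := by positivity
    have n2 : 0 ≤ (r - M) / r ^ 4 * z ^ 2 := by positivity
    have n3 : 0 ≤ 1 / r * y ^ 2 := by positivity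
    have := mul_le_mul_of_nonneg_right m1 n1
    have := mul_le_mul_of_nonneg_right m2 n3
    have := mul_le_mul_of_nonneg_right m3 n2
    linarith
  refine le_trans (sub_le_sub_right (sub_le_sub_right f4 _) _) ?_
  rw [bulkTwo, b3]
  generalize phiBulk M (weightTwo M q) (fun _ => 0) (fun r => weightTwo M q r * potential M r / 2)
    (fun _ => 0) r (r * y) p z F = B₁ at *
  generalize phiBulk M (fun _ => 0) (fun _ => 0) (fun r => (r - M) ^ 3 / r ^ 5) (fun _ => 0) r (r * y) p z F
    = B₂ at *
  generalize bulkZero M q r y p z F = B₀ at *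
  have hin : c₁ * (r ^ q / r) * p ^ 2 + (1400 / M * ((r - M) ^ 4 / r ^ 6) + ε * ((r - M) ^ 4 / (2 * r ^ 5))) * y ^ 2
      - (k / c₀ * C₀ + 1 / q) * (r ^ 3 * r ^ q * F ^ 2) ≤ k / c₀ * B₀ + B₁ + ε * B₂ := by
    linarith
  have hin2 := mul_le_mul_of_nonneg_left hin hΛ0.le
  -- The ingoing current occurs once, so one copy of the good zeroth order terms repairs it; the
  -- remaining Λ − 1 copies are dropped.
  have hy : 0 ≤ (Λ - 1) * ((1400 / M * ((r - M) ^ 4 / r ^ 6) + ε * ((r - M) ^ 4 / (2 * r ^ 5))) * y ^ 2) :=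
    mul_nonneg (by linarith) (by positivity)
  linarith

end

end

/-! ### Flux densities through curves of slope dv/dr = h -/

noncomputable section

open Set

/-- Flux density of the current `phiP, phiQ` through a curve of slope `dv/dr = h`. -/
def phiFlux (M : ℝ) (a b s k : ℝ → ℝ) (h r φ p z : ℝ) : ℝ :=
  h * a r * p ^ 2 + b r * (1 - lapse M r / 2 * h) * z ^ 2
    + (s r * (1 - lapse M r / 2 * h) + h * k r) * φ ^ 2

/-- Flux density of the current `psiP, psiQ` through a curve of slope `dv/dr = h`. -/
def psiFlux (M h r l u : ℝ) : ℝ :=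
  lapse M r / (2 * r) * (1 - lapse M r / 2 * h) * u ^ 2 - h * l ^ 2 / r

/-- Flux density of the current of the Killing field. -/
def fluxT (M h r y p z : ℝ) : ℝ :=
  h * p ^ 2 + lapse M r / 2 * (1 - lapse M r / 2 * h) * z ^ 2 + M * (r - M) / r ^ 2 * y ^ 2

/-- Flux density of the current of order zero. -/
def fluxZero (M q h r y p z : ℝ) : ℝ :=
  4000 * phiFlux M (fun _ => 1) (fun r => lapse M r / 2) (fun r => potential M r / 2)
      (fun r => lapse M r * potential M r / 4) h r (r * y) p z
    + phiFlux M (morawetzF M q) (fun r => -(lapse M r * morawetzF M q r) / 2)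
      (fun r => morawetzF M q r * potential M r / 2) (morawetzK M q) h r (r * y) p z
    + 400 * M ^ 3 * psiFlux M h r ((p - lapse M r / 2 * y) / r) ((z - y) / r)

/-- Flux density of the current of order one. -/
def fluxOne (M q C ε lam h r y p z : ℝ) : ℝ :=
  C * fluxZero M q h r y p z
    + phiFlux M (weightOne M lam) (fun _ => 0) (fun r => weightOne M lam r * potential M r / 2)
      (fun _ => 0) h r (r * y) p z
    + ε * phiFlux M (fun _ => 0) (fun _ => 0) (fun r => (r - M) ^ 3 / r ^ 5) (fun _ => 0) h r (r * y) p z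
    + phiFlux M (fun _ => 0) (fun r => (r - M) / r ^ 2) (fun _ => 0)
      (fun r => (r - M) / r ^ 2 * potential M r / 2) h r (r * y) p z

/-- Flux density of the current of order two. -/
def fluxTwo (M q C ε Λ h r y p z : ℝ) : ℝ :=
  Λ * (C * fluxZero M q h r y p z
    + phiFlux M (weightTwo M q) (fun _ => 0) (fun r => weightTwo M q r * potential M r / 2)
      (fun _ => 0) h r (r * y) p z
    + ε * phiFlux M (fun _ => 0) (fun _ => 0) (fun r => (r - M) ^ 3 / r ^ 5) (fun _ => 0) h r (r * y) p z)
    + phiFlux M (fun _ => 0) (fun r => 1 / r ^ 2) (fun _ => 0)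
      (fun r => 1 / r ^ 2 * potential M r / 2) h r (r * y) p z

section Bounds

variable {M q h r : ℝ}

theorem lapse_nonneg (M r : ℝ) : 0 ≤ lapse M r := sq_nonneg _

theorem lapse_le_one (hM : 0 < M) (hr : M ≤ r) : lapse M r ≤ 1 := by
  have hr0 : 0 < r := hM.trans_le hr
  rw [lapse_eq M hr0.ne', div_le_one (by positivity)]
  exact pow_le_pow_left₀ (sub_nonneg.2 hr) (by linarith) 2

theorem half_potential_mul_sq (hr : r ≠ 0) : potential M r / 2 * r ^ 2 = M * (r - M) / r ^ 2 := by
  rw [potential_eq M hr]; field_simp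

theorem fluxZero_eq (hr : 0 < r) (y p z : ℝ) :
    fluxZero M q h r y p z
      = h * (4000 + morawetzF M q r) * p ^ 2
        + lapse M r / 2 * (1 - lapse M r / 2 * h) * (4000 - morawetzF M q r) * z ^ 2
        + M * (r - M) / r ^ 2 * (4000 + morawetzF M q r
          * (1 - lapse M r * h * (1 - 5 * M / (r + 4 * M)))) * y ^ 2
        + 400 * M ^ 3 * psiFlux M h r ((p - lapse M r / 2 * y) / r) ((z - y) / r) := by
  have := half_potential_mul_sq (M := M) hr.ne'
  rw [← this, fluxZero, phiFlux, phiFlux, morawetzK]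
  ring

theorem lapse_mul_cube_le (hM : 0 < M) (hr : M ≤ r) :
    M ^ 3 / r ^ 3 * lapse M r ≤ M * (r - M) / r ^ 2 := by
  have hr0 : 0 < r := hM.trans_le hr
  have hx := sub_nonneg.2 hr
  rw [lapse_eq M hr0.ne', div_mul_div_comm, div_le_div_iff₀ (by positivity) (by positivity)]
  have : M ^ 2 * (r - M) ≤ r ^ 2 * r := by gcongr; linarith
  have := mul_le_mul_of_nonneg_left this (show 0 ≤ M * (r - M) * r ^ 2 by positivity)
  linarith

/-- The Morawetz current and the current of ψ have fluxes without sign, dominated by 4000 copies of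
the T-flux. The condition Dh ≤ 2 says that the curve is nowhere timelike. The ψ² terms of the
current of ψ carry M³D/r³, and `lapse_mul_cube_le` bounds this by the potential energy weight. -/
theorem fluxT_le_fluxZero (hM : 0 < M) (hr : M ≤ r) (hq : 0 < q) (hh : 0 ≤ h) (hDh : lapse M r * h ≤ 2)
    (y p z : ℝ) : fluxT M h r y p z ≤ fluxZero M q h r y p z := by
  have hr0 : 0 < r := hM.trans_le hr
  have hx := sub_nonneg.2 hr
  have f0 := morawetzF_nonneg hM hr hq
  have f1 := morawetzF_le_one (q := q) hM hr
  have hD := lapse_nonneg M r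
  have hc := lapse_mul_cube_le hM hr
  have hMr : M ^ 3 / r ^ 3 ≤ 1 := by
    rw [div_le_one (by positivity)]; exact pow_le_pow_left₀ hM.le hr 3
  have hMr0 : 0 ≤ M ^ 3 / r ^ 3 := by positivity
  have hθ0 : 0 ≤ 5 * M / (r + 4 * M) := by positivity
  have hθ1 : 5 * M / (r + 4 * M) ≤ 1 := by rw [div_le_one (by positivity)]; linarith
  have hN : 0 ≤ M * (r - M) / r ^ 2 := by positivity
  rw [fluxZero_eq hr0, fluxT, psiFlux]
  have e : 400 * M ^ 3 * (lapse M r / (2 * r) * (1 - lapse M r / 2 * h) * ((z - y) / r) ^ 2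
      - h * ((p - lapse M r / 2 * y) / r) ^ 2 / r)
      = 200 * (M ^ 3 / r ^ 3) * (lapse M r * (1 - lapse M r / 2 * h) * (z - y) ^ 2)
        - 400 * (M ^ 3 / r ^ 3) * h * (p - lapse M r / 2 * y) ^ 2 := by
    field_simp
    try ring
  rw [e]
  generalize morawetzF M q r = f at *
  generalize lapse M r = D at *
  generalize M ^ 3 / r ^ 3 = m at *
  generalize 5 * M / (r + 4 * M) = θ at *
  generalize M * (r - M) / r ^ 2 = N at *
  have hw : 0 ≤ 1 - D / 2 * h := by linarith
  have a1 : 0 ≤ 200 * m * (D * (1 - D / 2 * h) * (z - y) ^ 2) := by positivity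
  have a2 : (p - D / 2 * y) ^ 2 ≤ 2 * p ^ 2 + D ^ 2 / 2 * y ^ 2 := by
    linarith [sq_nonneg (p + D / 2 * y)]
  have a3 : 400 * m * h * (p - D / 2 * y) ^ 2 ≤ 400 * m * h * (2 * p ^ 2 + D ^ 2 / 2 * y ^ 2) :=
    mul_le_mul_of_nonneg_left a2 (by positivity)
  have a4 : m * (h * p ^ 2) ≤ 1 * (h * p ^ 2) := mul_le_mul_of_nonneg_right hMr (by positivity)
  have a5 : m * D * (D * h) * y ^ 2 ≤ N * 2 * y ^ 2 := by gcongr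
  have a6 : -1 ≤ f * (1 - D * h * (1 - θ)) := by
    have : D * h * (1 - θ) ≤ 2 * 1 := by
      apply mul_le_mul hDh (by linarith) (by linarith) (by norm_num)
    nlinarith
  have a7 : N * 3999 * y ^ 2 ≤ N * (4000 + f * (1 - D * h * (1 - θ))) * y ^ 2 := by
    gcongr; linarith
  have a8 : D / 2 * (1 - D / 2 * h) * 1 * z ^ 2 ≤ D / 2 * (1 - D / 2 * h) * (4000 - f) * z ^ 2 := by
    gcongr; linarith
  have a9 : h * 4000 * p ^ 2 ≤ h * (4000 + f) * p ^ 2 := by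
    gcongr; linarith
  have b1 : 0 ≤ h * p ^ 2 := by positivity
  have b2 : 0 ≤ N * y ^ 2 := by positivity
  linarith

theorem fluxZero_le (hM : 0 < M) (hr : M ≤ r) (hq : 0 < q) (hh : 0 ≤ h) (hDh : lapse M r * h ≤ 2)
    (y p z : ℝ) : fluxZero M q h r y p z ≤ 10000 * fluxT M h r y p z := by
  have hr0 : 0 < r := hM.trans_le hr
  have hx := sub_nonneg.2 hr
  have f0 := morawetzF_nonneg hM hr hq
  have f1 := morawetzF_le_one (q := q) hM hr
  have hD := lapse_nonneg M r
  have hc := lapse_mul_cube_le hM hr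
  have hMr : M ^ 3 / r ^ 3 ≤ 1 := by
    rw [div_le_one (by positivity)]; exact pow_le_pow_left₀ hM.le hr 3
  have hMr0 : 0 ≤ M ^ 3 / r ^ 3 := by positivity
  have hθ0 : 0 ≤ 5 * M / (r + 4 * M) := by positivity
  have hθ1 : 5 * M / (r + 4 * M) ≤ 1 := by rw [div_le_one (by positivity)]; linarith
  have hN : 0 ≤ M * (r - M) / r ^ 2 := by positivity
  rw [fluxZero_eq hr0, fluxT, psiFlux]
  have e : 400 * M ^ 3 * (lapse M r / (2 * r) * (1 - lapse M r / 2 * h) * ((z - y) / r) ^ 2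
      - h * ((p - lapse M r / 2 * y) / r) ^ 2 / r)
      = 200 * (M ^ 3 / r ^ 3) * (lapse M r * (1 - lapse M r / 2 * h) * (z - y) ^ 2)
        - 400 * (M ^ 3 / r ^ 3) * h * (p - lapse M r / 2 * y) ^ 2 := by
    field_simp
    try ring
  rw [e]
  generalize morawetzF M q r = f at *
  generalize lapse M r = D at *
  generalize M ^ 3 / r ^ 3 = m at *
  generalize 5 * M / (r + 4 * M) = θ at *
  generalize M * (r - M) / r ^ 2 = N at *
  have hw : 0 ≤ 1 - D / 2 * h := by linarith
  have hw1 : 1 - D / 2 * h ≤ 1 := by linarith [mul_nonneg hD hh]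
  have a1 : 0 ≤ 400 * m * h * (p - D / 2 * y) ^ 2 := by positivity
  have a2 : (z - y) ^ 2 ≤ 2 * z ^ 2 + 2 * y ^ 2 := by linarith [sq_nonneg (z + y)]
  have a3 : 200 * m * (D * (1 - D / 2 * h) * (z - y) ^ 2)
      ≤ 200 * m * (D * (1 - D / 2 * h) * (2 * z ^ 2 + 2 * y ^ 2)) := by gcongr
  have a4 : m * (D * (1 - D / 2 * h) * z ^ 2) ≤ 1 * (D * (1 - D / 2 * h) * z ^ 2) := by gcongr
  have a5 : m * D * (1 - D / 2 * h) * y ^ 2 ≤ N * 1 * y ^ 2 := by gcongr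
  have a6 : f * (1 - D * h * (1 - θ)) ≤ 1 := by
    have : 0 ≤ D * h * (1 - θ) := mul_nonneg (mul_nonneg hD hh) (by linarith)
    nlinarith
  have a7 : N * (4000 + f * (1 - D * h * (1 - θ))) * y ^ 2 ≤ N * 4001 * y ^ 2 := by
    gcongr; linarith
  have a8 : D / 2 * (1 - D / 2 * h) * (4000 - f) * z ^ 2 ≤ D / 2 * (1 - D / 2 * h) * 4000 * z ^ 2 := by
    gcongr; linarith
  have a9 : h * (4000 + f) * p ^ 2 ≤ h * 4001 * p ^ 2 := by
    gcongr; linarith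
  have b1 : 0 ≤ h * p ^ 2 := by positivity
  have b2 : 0 ≤ N * y ^ 2 := by positivity
  have b3 : 0 ≤ D * (1 - D / 2 * h) * z ^ 2 := by positivity
  linarith

theorem fluxT_nonneg (hM : 0 < M) (hr : M ≤ r) (hh : 0 ≤ h) (hDh : lapse M r * h ≤ 2) (y p z : ℝ) :
    0 ≤ fluxT M h r y p z := by
  have hx := sub_nonneg.2 hr
  have hD := lapse_nonneg M r
  have hw : 0 ≤ 1 - lapse M r / 2 * h := by linarith
  rw [fluxT]; positivity

theorem fluxOne_eq (hr : 0 < r) (C ε lam y p z : ℝ) :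
    fluxOne M q C ε lam h r y p z = C * fluxZero M q h r y p z + h * weightOne M lam r * p ^ 2
      + (r - M) / r ^ 2 * (1 - lapse M r / 2 * h) * z ^ 2
      + (weightOne M lam r * (1 - lapse M r / 2 * h) * (M * (r - M) / r ^ 2)
        + ε * (1 - lapse M r / 2 * h) * ((r - M) ^ 3 / r ^ 3)
        + M * (lapse M r * h) / r ^ 2) * y ^ 2 := by
  rw [fluxOne, phiFlux, phiFlux, phiFlux, potential_eq M hr.ne', lapse_eq M hr.ne']
  field_simp
  ring

theorem fluxTwo_eq (hr : 0 < r) (C ε Λ y p z : ℝ) :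
    fluxTwo M q C ε Λ h r y p z = Λ * (C * fluxZero M q h r y p z
      + lapse M r * h * r ^ q * p ^ 2
      + (weightTwo M q r * (1 - lapse M r / 2 * h) * (M * (r - M) / r ^ 2)
        + ε * (1 - lapse M r / 2 * h) * ((r - M) ^ 3 / r ^ 3)) * y ^ 2)
      + 1 / r ^ 2 * (1 - lapse M r / 2 * h) * z ^ 2 + h * M * (r - M) / r ^ 4 * y ^ 2 := by
  rw [fluxTwo, phiFlux, phiFlux, phiFlux, potential_eq M hr.ne', lapse_eq M hr.ne', weightTwo]
  field_simp
  ring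

theorem fluxOne_nonneg (hM : 0 < M) (hr : M ≤ r) (hq : 0 < q) (hh : 0 ≤ h) (hDh : lapse M r * h ≤ 2)
    {C ε lam : ℝ} (hC : 0 ≤ C) (hε : 0 ≤ ε) (hl : 0 < lam) (y p z : ℝ) :
    0 ≤ fluxOne M q C ε lam h r y p z := by
  have hr0 : 0 < r := hM.trans_le hr
  have hx := sub_nonneg.2 hr
  have hD := lapse_nonneg M r
  have hw : 0 ≤ 1 - lapse M r / 2 * h := by linarith
  have h0 := (fluxT_nonneg hM hr hh hDh y p z).trans (fluxT_le_fluxZero hM hr hq hh hDh y p z)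
  have h1 := weightOne_nonneg hM hr hl
  rw [fluxOne_eq hr0]
  positivity

theorem weightTwo_nonneg (hM : 0 < M) (hr : M ≤ r) : 0 ≤ weightTwo M q r := by
  have hr0 : 0 < r := hM.trans_le hr
  rw [weightTwo]; positivity

theorem fluxTwo_ge (hM : 0 < M) (hr : M ≤ r) (hq : 0 < q) (hh : 0 ≤ h) (hDh : lapse M r * h ≤ 2)
    {C ε Λ : ℝ} (hC : 0 ≤ C) (hε : 0 ≤ ε) (hΛ : 0 ≤ Λ) (y p z : ℝ) :
    Λ * (lapse M r * h * r ^ q * p ^ 2) + 1 / r ^ 2 * (1 - lapse M r / 2 * h) * z ^ 2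
      ≤ fluxTwo M q C ε Λ h r y p z := by
  have hr0 : 0 < r := hM.trans_le hr
  have hx := sub_nonneg.2 hr
  have hD := lapse_nonneg M r
  have hw : 0 ≤ 1 - lapse M r / 2 * h := by linarith
  have h0 := (fluxT_nonneg hM hr hh hDh y p z).trans (fluxT_le_fluxZero hM hr hq hh hDh y p z)
  have h1 := weightTwo_nonneg (q := q) hM hr
  rw [fluxTwo_eq hr0]
  have a1 : 0 ≤ Λ * (C * fluxZero M q h r y p z) := by positivity
  have a2 : 0 ≤ Λ * ((weightTwo M q r * (1 - lapse M r / 2 * h) * (M * (r - M) / r ^ 2)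
        + ε * (1 - lapse M r / 2 * h) * ((r - M) ^ 3 / r ^ 3)) * y ^ 2) := by positivity
  have a3 : 0 ≤ h * M * (r - M) / r ^ 4 * y ^ 2 := by positivity
  linarith

theorem fluxTwo_nonneg (hM : 0 < M) (hr : M ≤ r) (hq : 0 < q) (hh : 0 ≤ h) (hDh : lapse M r * h ≤ 2)
    {C ε Λ : ℝ} (hC : 0 ≤ C) (hε : 0 ≤ ε) (hΛ : 0 ≤ Λ) (y p z : ℝ) :
    0 ≤ fluxTwo M q C ε Λ h r y p z := by
  refine le_trans ?_ (fluxTwo_ge hM hr hq hh hDh hC hε hΛ y p z)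
  have hr0 : 0 < r := hM.trans_le hr
  have hD := lapse_nonneg M r
  have hw : 0 ≤ 1 - lapse M r / 2 * h := by linarith
  positivity

end Bounds

end

/-! ### Fluxes dominated by the bulk of the next order -/

noncomputable section

open Set

/-- The good terms of order two, on a curve of slope `h`. -/
def goodTwo (M q lam h r y p z : ℝ) : ℝ :=
  weightW q lam r * p ^ 2 + (1 - lapse M r / 2 * h) * ((r - M) / r ^ 4) * z ^ 2 + 1 / r * y ^ 2

section Bounds

variable {M q h r R lam : ℝ}

theorem weightW_nonneg (hl : 0 < lam) (hr : 0 < r) : 0 ≤ weightW q lam r := by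
  have := Real.rpow_nonneg hl.le (2 - q)
  have := Real.rpow_nonneg hr.le q
  rw [weightW]; positivity

theorem one_le_const_mul_weightW (hM : 0 < M) (hr : M ≤ r) (hq : 0 < q) (hq2 : q < 2) (hl : 1 ≤ lam) :
    1 ≤ (1 + M) / M * weightW q lam r := by
  have := mul_le_mul_of_nonneg_left (const_le_weightW hM hr hq hq2 hl) (show 0 ≤ (1 + M) / M by positivity)
  rwa [show (1 + M) / M * (M / (1 + M)) = 1 by field_simp] at this

/-- Here w stands for 1 − Dh/2, the weight of (Yφ)² in the flux. It vanishes on N, while on S the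
radius is bounded, so powers of r can be exchanged for constants in every term containing w. -/
theorem mul_sq_div_le (hM : 0 < M) (hr : M ≤ r) {w : ℝ} (hw0 : 0 ≤ w) (hw : w = 0 ∨ r ≤ R) :
    w * ((r - M) ^ 2 / r ^ 2) ≤ R ^ 2 * (w * ((r - M) ^ 2 / r ^ 4))
      ∧ w * ((r - M) ^ 2 / r ^ 2) ≤ R ^ 3 * (w * ((r - M) / r ^ 4))
      ∧ w * ((r - M) / r ^ 2) ≤ R ^ 2 * (w * ((r - M) / r ^ 4)) ∧ w ≤ w * (R / r) := by
  have hr0 : 0 < r := hM.trans_le hr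
  have hx := sub_nonneg.2 hr
  rcases hw with rfl | hw
  · simp
  refine ⟨?_, ?_, ?_, ?_⟩
  · calc w * ((r - M) ^ 2 / r ^ 2) = r ^ 2 * (w * ((r - M) ^ 2 / r ^ 4)) := by field_simp
      _ ≤ _ := by gcongr
  · calc w * ((r - M) ^ 2 / r ^ 2) = (r - M) * r ^ 2 * (w * ((r - M) / r ^ 4)) := by field_simp
      _ ≤ (R * R ^ 2) * (w * ((r - M) / r ^ 4)) := by gcongr <;> linarith
      _ = _ := by ring
  · calc w * ((r - M) / r ^ 2) = r ^ 2 * (w * ((r - M) / r ^ 4)) := by field_simp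
      _ ≤ _ := by gcongr
  · have : 1 ≤ R / r := by rwa [one_le_div hr0]
    nlinarith

theorem div_sq_le_div (hM : 0 < M) (hr : M ≤ r) : (r - M) / r ^ 2 ≤ 1 / r := by
  have hr0 : 0 < r := hM.trans_le hr
  rw [div_le_div_iff₀ (by positivity) hr0]; nlinarith

/-- For r ≤ λ the factor λ/(r + λ) is at least 1/2 and the good terms of order one suffice. For r >
λ the truncation has destroyed them, but then t ≤ λ ≤ 2W, so the term is charged to order two. -/
theorem mul_fluxZero_le (hM : 0 < M) (hr : M ≤ r) (hq : 0 < q) (hq2 : q < 2) (hh : 0 ≤ h) (hh8 : h ≤ 8)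
    (hDh : lapse M r * h ≤ 2) (hw : 1 - lapse M r / 2 * h = 0 ∨ r ≤ R) {t : ℝ} (ht : 1 ≤ t)
    (htl : t ≤ lam) (y p z : ℝ) :
    t * fluxZero M q h r y p z ≤ 10000 * (32 + R ^ 2 + M)
      * (t * goodOne M lam r y p z + weightW q lam r * p ^ 2) := by
  have hr0 : 0 < r := hM.trans_le hr
  have hx := sub_nonneg.2 hr
  have hl : 0 < lam := by linarith
  have hD := lapse_nonneg M r
  have hw0 : 0 ≤ 1 - lapse M r / 2 * h := by linarith
  have hw1 : 1 - lapse M r / 2 * h ≤ 1 := by linarith [mul_nonneg hD hh]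
  have hW := weightW_nonneg (q := q) hl hr0
  have h1 : t * (h * p ^ 2) ≤ 32 * (t * ((lam / (r + lam)) ^ 2 * p ^ 2) + weightW q lam r * p ^ 2) := by
    rcases le_or_gt r lam with hc | hc
    · have e : 1 / 4 ≤ (lam / (r + lam)) ^ 2 := by
        have : 1 / 2 ≤ lam / (r + lam) := by
          rw [div_le_div_iff₀ (by norm_num) (by positivity)]; linarith
        nlinarith
      have : t * (8 * p ^ 2) ≤ t * (8 * (4 * (lam / (r + lam)) ^ 2) * p ^ 2) := by
        gcongr; linarith
      have : t * (h * p ^ 2) ≤ t * (8 * p ^ 2) := by gcongr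
      have : 0 ≤ weightW q lam r * p ^ 2 := by positivity
      linarith
    · have e : t ≤ 2 * weightW q lam r := by
        have h2 := min_le_weightW hq hq2 hl hr0
        have : lam / 2 ≤ lam * r / (lam + r) := by
          rw [div_le_div_iff₀ (by norm_num) (by positivity)]
          nlinarith
        linarith
      have e1 : t * (h * p ^ 2) ≤ (2 * weightW q lam r) * (8 * p ^ 2) := by gcongr
      have : 0 ≤ t * ((lam / (r + lam)) ^ 2 * p ^ 2) := by positivity
      have : 0 ≤ weightW q lam r * p ^ 2 := by positivity
      linarith
  have h2 : lapse M r / 2 * (1 - lapse M r / 2 * h) * z ^ 2 ≤ R ^ 2 * ((r - M) ^ 2 / r ^ 4 * z ^ 2) := by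
    have e := (mul_sq_div_le hM hr hw0 hw).1
    rw [← lapse_eq M hr0.ne'] at e
    have e3 : lapse M r / 2 * (1 - lapse M r / 2 * h) ≤ (1 - lapse M r / 2 * h) * lapse M r := by
      nlinarith [mul_nonneg hD hw0]
    calc _ ≤ (R ^ 2 * ((1 - lapse M r / 2 * h) * ((r - M) ^ 2 / r ^ 4))) * z ^ 2 :=
          mul_le_mul_of_nonneg_right (e3.trans e) (sq_nonneg z)
      _ ≤ (R ^ 2 * (1 * ((r - M) ^ 2 / r ^ 4))) * z ^ 2 := by gcongr
      _ = _ := by ring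
  have h2' := mul_le_mul_of_nonneg_left h2 (by linarith : (0:ℝ) ≤ t)
  have h3 := mul_le_mul_of_nonneg_left (fluxZero_le hM hr hq hh hDh y p z) (by linarith : (0:ℝ) ≤ t)
  have h4 : M * (r - M) / r ^ 2 * y ^ 2 = M * ((r - M) / r ^ 2 * y ^ 2) := by ring
  rw [fluxT, h4] at h3
  have n1 : 0 ≤ t * ((lam / (r + lam)) ^ 2 * p ^ 2) := by positivity
  have n2 : 0 ≤ t * ((r - M) ^ 2 / r ^ 4 * z ^ 2) := by positivity
  have n3 : 0 ≤ t * ((r - M) / r ^ 2 * y ^ 2) := by positivity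
  have n4 : 0 ≤ weightW q lam r * p ^ 2 := by positivity
  rw [goodOne]
  generalize (lam / (r + lam)) ^ 2 * p ^ 2 = a at *
  generalize (r - M) ^ 2 / r ^ 4 * z ^ 2 = b at *
  generalize (r - M) / r ^ 2 * y ^ 2 = c at *
  generalize weightW q lam r * p ^ 2 = d at *
  generalize lapse M r / 2 * (1 - lapse M r / 2 * h) * z ^ 2 = e at *
  generalize h * p ^ 2 = f at *
  have m1 := mul_nonneg (sq_nonneg R) n1
  have m2 := mul_nonneg (sq_nonneg R) n3
  have m3 := mul_nonneg (sq_nonneg R) n4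
  have m4 := mul_nonneg hM.le n1
  have m5 := mul_nonneg hM.le n2
  have m6 := mul_nonneg hM.le n4
  linarith

/-- The critical term is h·`weightOne`·p², bounded through `min_le_weightW`. At the horizon the flux
weight r − M of z² is the one in the bulk of order two. -/
theorem fluxOne_le (hM : 0 < M) (hr : M ≤ r) (hq : 0 < q) (hq2 : q < 2) (hh : 0 ≤ h) (hh8 : h ≤ 8)
    (hDh : lapse M r * h ≤ 2) (hR : 0 ≤ R) (hw : 1 - lapse M r / 2 * h = 0 ∨ r ≤ R) (hl : 1 ≤ lam)
    {C ε : ℝ} (hC : 0 ≤ C) (hε : 0 ≤ ε) (y p z : ℝ) :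
    fluxOne M q C ε lam h r y p z ≤
      (10000 * C * (8 * (1 + M) / M + R ^ 3 + M) + 8 + R ^ 2 + M * R + ε * R + 2)
        * goodTwo M q lam h r y p z := by
  have hr0 : 0 < r := hM.trans_le hr
  have hx := sub_nonneg.2 hr
  have hl0 : 0 < lam := by linarith
  have hD := lapse_nonneg M r
  have hw0 : 0 ≤ 1 - lapse M r / 2 * h := by linarith
  have hw1 : 1 - lapse M r / 2 * h ≤ 1 := by linarith [mul_nonneg hD hh]
  have hW := weightW_nonneg (q := q) hl0 hr0
  obtain ⟨-, w2, w3, w4⟩ := mul_sq_div_le hM hr hw0 hw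
  rw [← lapse_eq M hr0.ne'] at w2
  have hone := one_le_const_mul_weightW hM hr hq hq2 hl
  have hz := mul_le_mul_of_nonneg_left (fluxZero_le hM hr hq hh hDh y p z) hC
  have p1 : h * p ^ 2 ≤ 8 * (1 + M) / M * (weightW q lam r * p ^ 2) := by
    calc h * p ^ 2 ≤ 8 * ((1 + M) / M * weightW q lam r) * p ^ 2 := by gcongr; linarith
      _ = _ := by ring
  have p2 : h * weightOne M lam r * p ^ 2 ≤ 8 * (weightW q lam r * p ^ 2) := by
    have a1 := (weightOne_le hM hr hl0).trans (min_le_weightW hq hq2 hl0 hr0)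
    have a0 := weightOne_nonneg hM hr hl0
    calc h * weightOne M lam r * p ^ 2 ≤ 8 * weightW q lam r * p ^ 2 := by gcongr
      _ = _ := by ring
  have z1 : lapse M r / 2 * (1 - lapse M r / 2 * h) * z ^ 2
      ≤ R ^ 3 * ((1 - lapse M r / 2 * h) * ((r - M) / r ^ 4) * z ^ 2) := by
    have e3 : lapse M r / 2 * (1 - lapse M r / 2 * h) ≤ (1 - lapse M r / 2 * h) * lapse M r := by
      nlinarith [mul_nonneg hD hw0]
    have := mul_le_mul_of_nonneg_right (e3.trans w2) (sq_nonneg z)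
    linarith
  have z2 : (r - M) / r ^ 2 * (1 - lapse M r / 2 * h) * z ^ 2
      ≤ R ^ 2 * ((1 - lapse M r / 2 * h) * ((r - M) / r ^ 4) * z ^ 2) := by
    have := mul_le_mul_of_nonneg_right w3 (sq_nonneg z)
    linarith
  have hd := div_sq_le_div hM hr
  have y1 : M * (r - M) / r ^ 2 * y ^ 2 ≤ M * (1 / r * y ^ 2) := by
    calc _ = M * ((r - M) / r ^ 2 * y ^ 2) := by ring
      _ ≤ _ := by gcongr
  have y2 : weightOne M lam r * (1 - lapse M r / 2 * h) * (M * (r - M) / r ^ 2)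
        ≤ M * R * (1 / r) := by
    have a0 := weightOne_nonneg hM hr hl0
    have a2 : weightOne M lam r * (r - M) / r ^ 2 ≤ 1 := by
      rw [div_le_one (by positivity), sq]
      exact mul_le_mul (weightOne_le_self hM hr hl0) (by linarith) hx hr0.le
    calc _ = M * (weightOne M lam r * (r - M) / r ^ 2 * (1 - lapse M r / 2 * h)) := by ring
      _ ≤ M * (1 * ((1 - lapse M r / 2 * h) * (R / r))) := by gcongr
      _ ≤ M * (1 * (1 * (R / r))) := by gcongr
      _ = _ := by ring
  have y3 : ε * (1 - lapse M r / 2 * h) * ((r - M) ^ 3 / r ^ 3) ≤ ε * R * (1 / r) := by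
    have : (r - M) ^ 3 / r ^ 3 ≤ 1 := by
      rw [div_le_one (by positivity)]; exact pow_le_pow_left₀ hx (by linarith) 3
    calc _ ≤ ε * ((1 - lapse M r / 2 * h) * (R / r)) * 1 := by gcongr
      _ ≤ ε * (1 * (R / r)) * 1 := by gcongr
      _ = _ := by ring
  have y4 : M * (lapse M r * h) / r ^ 2 ≤ 2 * (1 / r) := by
    calc _ ≤ r * 2 / r ^ 2 := by gcongr
      _ = _ := by field_simp
  have yy := mul_le_mul_of_nonneg_right (add_le_add (add_le_add y2 y3) y4) (sq_nonneg y)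
  have n1 : 0 ≤ weightW q lam r * p ^ 2 := by positivity
  have n2 : 0 ≤ (1 - lapse M r / 2 * h) * ((r - M) / r ^ 4) * z ^ 2 := by positivity
  have n3 : 0 ≤ 1 / r * y ^ 2 := by positivity
  have q0 : 0 ≤ 10000 * C := by positivity
  have k1 := mul_le_mul_of_nonneg_left p1 q0
  have k2 := mul_le_mul_of_nonneg_left z1 q0
  have k3 := mul_le_mul_of_nonneg_left y1 q0
  rw [fluxT] at hz
  rw [fluxOne_eq hr0, goodTwo]
  have c1 : 0 ≤ 10000 * C * (R ^ 3 + M) + R ^ 2 + M * R + ε * R + 2 := by positivity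
  have c2 : 0 ≤ 10000 * C * (8 * (1 + M) / M + M) + 8 + M * R + ε * R + 2 := by positivity
  have c3 : 0 ≤ 10000 * C * (8 * (1 + M) / M + R ^ 3) + 8 + R ^ 2 := by positivity
  have d1 := mul_nonneg c1 n1
  have d2 := mul_nonneg c2 n2
  have d3 := mul_nonneg c3 n3
  generalize weightW q lam r * p ^ 2 = a at *
  generalize (1 - lapse M r / 2 * h) * ((r - M) / r ^ 4) * z ^ 2 = b at *
  generalize 8 * (1 + M) / M = m at *
  linarith

end Bounds

end

/-! ### Order two with a decreasing coefficient -/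

noncomputable section

open Set

section

variable {M q R₀ lam : ℝ}

theorem lapse_ge_quarter (hM : 0 < M) {r : ℝ} (hr : 2 * M ≤ r) : 1 / 4 ≤ lapse M r := by
  have hr0 : 0 < r := by linarith
  rw [lapse_eq M hr0.ne', div_le_div_iff₀ (by norm_num) (by positivity)]
  nlinarith

theorem lapse_mul_two_div (hM : 0 < M) {r : ℝ} (hr : 2 * M ≤ r) : lapse M r * (2 / lapse M r) = 2 := by
  have := lapse_ge_quarter hM hr
  have : lapse M r ≠ 0 := by linarith
  field_simp

/-- Differentiating κ(t)·Flux₂ with κ' = −η produces the bulk and, in addition, η times the flux.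
The extra flux does two things: on N it supplies the 1/λ part of W, and on S its z²/r² absorbs zF/r.
-/
theorem exists_orderTwo_le (hM : 0 < M) (hR₀ : 2 * M < R₀) (hq : 0 < q) (hq2 : q < 2) :
    ∃ C₂ ε c C : ℝ, 0 < C₂ ∧ 0 < ε ∧ 0 < c ∧ 0 < C ∧ ∀ lam κ η r y p z F : ℝ, 1 ≤ lam → 1 ≤ κ → κ ≤ 2 →
      (1 - q / 2) / lam ≤ η →
      (M ≤ r → r ≤ R₀ → c * goodTwo M q lam 1 r y p z
        ≤ κ * bulkTwo M q C₂ ε (lam ^ (2 - q)) r y p z F + η * fluxTwo M q C₂ ε (lam ^ (2 - q)) 1 r y p z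
          + C * (lam ^ (2 - q) * (r ^ 3 * r ^ q * F ^ 2) + F ^ 2 / η)) ∧
      (R₀ ≤ r → c * goodTwo M q lam (2 / lapse M r) r y p z
        ≤ κ * bulkTwo M q C₂ ε (lam ^ (2 - q)) r y p z F
          + η * fluxTwo M q C₂ ε (lam ^ (2 - q)) (2 / lapse M r) r y p z
          + C * (lam ^ (2 - q) * (r ^ 3 * r ^ q * F ^ 2))) := by
  obtain ⟨C₂, ε, c, C, hC₂, hε, hc, hc1, hC, hbulk⟩ := exists_bulkTwo_ge hM hq hq2
  have hR0 : 0 < R₀ := by linarith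
  have hmq : 0 < M * M ^ q := by positivity
  refine ⟨C₂, ε, min (c / (1 + R₀)) (min c (2 - q)), 2 * C + 2 + 2 / (c * M) * (1 / (M * M ^ q)), hC₂, hε,
    lt_min (by positivity) (lt_min hc (by linarith)), by positivity, ?_⟩
  intro lam κ η r y p z F hl hκ1 hκ2 hη
  have hl0 : 0 < lam := by linarith
  have hη0 : 0 < η := lt_of_lt_of_le (div_pos (by linarith) hl0) hη
  have hΛ : 1 ≤ lam ^ (2 - q) := Real.one_le_rpow hl (by linarith)
  have key : ∀ r, M ≤ r → c * (lam ^ (2 - q) * (r ^ q / r) * p ^ 2 + (r - M) / r ^ 4 * z ^ 2 + 1 / r * y ^ 2)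
      - κ * (z * F / r) - 2 * C * (lam ^ (2 - q) * (r ^ 3 * r ^ q * F ^ 2))
      ≤ κ * bulkTwo M q C₂ ε (lam ^ (2 - q)) r y p z F := by
    intro r hr
    have hr0 : 0 < r := hM.trans_le hr
    have hx := sub_nonneg.2 hr
    have b := mul_le_mul_of_nonneg_left (hbulk (lam ^ (2 - q)) r y p z F hr hΛ) (by linarith : 0 ≤ κ)
    have n1 : 0 ≤ c * (lam ^ (2 - q) * (r ^ q / r) * p ^ 2 + (r - M) / r ^ 4 * z ^ 2 + 1 / r * y ^ 2) := by
      have := Real.rpow_nonneg hr0.le q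
      positivity
    have n2 : 0 ≤ C * (lam ^ (2 - q) * (r ^ 3 * r ^ q * F ^ 2)) := by
      have := Real.rpow_nonneg hr0.le q
      positivity
    have m1 := mul_nonneg (sub_nonneg.2 hκ1) n1
    have m2 := mul_nonneg (sub_nonneg.2 hκ2) n2
    generalize lam ^ (2 - q) * (r ^ q / r) * p ^ 2 + (r - M) / r ^ 4 * z ^ 2 + 1 / r * y ^ 2 = X at *
    generalize lam ^ (2 - q) * (r ^ 3 * r ^ q * F ^ 2) = Y at *
    generalize bulkTwo M q C₂ ε (lam ^ (2 - q)) r y p z F = B at *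
    linarith
  generalize hcm : min (c / (1 + R₀)) (min c (2 - q)) = cm at *
  have hcm1 : cm ≤ c / (1 + R₀) := hcm ▸ min_le_left _ _
  have hcm2 : cm ≤ c := hcm ▸ (min_le_right _ _).trans (min_le_left _ _)
  have hcm3 : cm ≤ 2 - q := hcm ▸ (min_le_right _ _).trans (min_le_right _ _)
  have hcm0 : 0 < cm := hcm ▸ lt_min (by positivity) (lt_min hc (by linarith))
  constructor
  · intro hr hrR
    have hr0 : 0 < r := hM.trans_le hr
    have hx := sub_nonneg.2 hr
    have hD0 := lapse_nonneg M r
    have hD1 := lapse_le_one hM hr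
    have hrq := Real.rpow_pos_of_pos hr0 q
    have hk := key r hr
    have hf := mul_le_mul_of_nonneg_left (fluxTwo_ge (h := 1) hM hr hq zero_le_one (by linarith) hC₂.le hε.le
      (by linarith : 0 ≤ lam ^ (2 - q)) y p z) hη0.le
    have f1 : 0 ≤ η * (lam ^ (2 - q) * (lapse M r * 1 * r ^ q * p ^ 2)) := by positivity
    have f2 : η / 2 * (z / r) ^ 2 ≤ η * (1 / r ^ 2 * (1 - lapse M r / 2 * 1) * z ^ 2) := by
      calc _ = η * (1 / r ^ 2 * (1 / 2) * z ^ 2) := by field_simp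
        _ ≤ _ := by gcongr; linarith
    -- Only the flux term controls z at the horizon; this is the origin of F²/η.
    have f3 : κ * (z * F / r) ≤ η / 2 * (z / r) ^ 2 + 2 * (F ^ 2 / η) := by
      have := mul_le_young (A := η / 2) (by positivity) (z / r) (κ * F)
      have : (κ * F) ^ 2 / (4 * (η / 2)) ≤ 2 * (F ^ 2 / η) := by
        calc _ = κ ^ 2 / 2 * (F ^ 2 / η) := by field_simp; ring
          _ ≤ _ := by gcongr; nlinarith
      have e : κ * (z * F / r) = z / r * (κ * F) := by ring
      linarith
    have g1 : cm * (weightW q lam r * p ^ 2) ≤ c * (lam ^ (2 - q) * (r ^ q / r) * p ^ 2) := by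
      have : 1 / r + 1 / lam ≤ (1 + R₀) / r := by
        have : 1 / lam ≤ 1 := by rw [div_le_one hl0]; exact hl
        have : 1 ≤ R₀ / r := by rwa [one_le_div hr0]
        rw [add_div]; linarith
      calc _ ≤ c / (1 + R₀) * (lam ^ (2 - q) * r ^ q * ((1 + R₀) / r) * p ^ 2) := by
            rw [weightW]; gcongr
        _ = _ := by field_simp
    have g2 : cm * ((1 - lapse M r / 2 * 1) * ((r - M) / r ^ 4) * z ^ 2) ≤ c * ((r - M) / r ^ 4 * z ^ 2) := by
      have hw0 : 0 ≤ 1 - lapse M r / 2 * 1 := by linarith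
      calc _ ≤ c * (1 * ((r - M) / r ^ 4) * z ^ 2) := by gcongr; linarith
        _ = _ := by ring
    have g3 : cm * (1 / r * y ^ 2) ≤ c * (1 / r * y ^ 2) := by gcongr
    have s1 : 0 ≤ lam ^ (2 - q) * (r ^ 3 * r ^ q * F ^ 2) := by positivity
    have s2 : 0 ≤ F ^ 2 / η := by positivity
    have s3 : 0 ≤ 2 / (c * M) * (1 / (M * M ^ q)) := by positivity
    have t1 := mul_nonneg s3 s1
    have t2 := mul_nonneg s3 s2
    have t3 := mul_nonneg hC.le s2
    rw [goodTwo]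
    generalize lam ^ (2 - q) * (r ^ 3 * r ^ q * F ^ 2) = Y at *
    generalize bulkTwo M q C₂ ε (lam ^ (2 - q)) r y p z F = B at *
    generalize fluxTwo M q C₂ ε (lam ^ (2 - q)) 1 r y p z = B2 at *
    generalize F ^ 2 / η = Z at *
    generalize 2 / (c * M) * (1 / (M * M ^ q)) = k at *
    linarith
  · intro hrR
    have hr : M ≤ r := by linarith
    have hr0 : 0 < r := hM.trans_le hr
    have hx := sub_nonneg.2 hr
    have hx2 : r / 2 ≤ r - M := by linarith
    have hDh := lapse_mul_two_div (r := r) hM (by linarith)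
    have hD4 := lapse_ge_quarter (r := r) hM (by linarith)
    have hh : 0 ≤ 2 / lapse M r := by positivity
    have hrq := Real.rpow_pos_of_pos hr0 q
    have hk := key r hr
    have hf := mul_le_mul_of_nonneg_left (fluxTwo_ge hM hr hq hh hDh.le hC₂.le hε.le
      (by linarith : 0 ≤ lam ^ (2 - q)) y p z) hη0.le
    have hw : 1 - lapse M r / 2 * (2 / lapse M r) = 0 := by linarith
    rw [hw, hDh] at hf
    rw [goodTwo, hw]
    have hA : 0 < c * ((r - M) / r ^ 4) := by
      have : 0 < r - M := by linarith
      positivity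
    have f3 : κ * (z * F / r) ≤ c * ((r - M) / r ^ 4) * z ^ 2
        + 2 / (c * M) * (1 / (M * M ^ q)) * (lam ^ (2 - q) * (r ^ 3 * r ^ q * F ^ 2)) := by
      have y1 := mul_le_young hA z (κ * F / r)
      have y2 : (κ * F / r) ^ 2 / (4 * (c * ((r - M) / r ^ 4))) ≤ 2 / (c * M) * (r ^ 2 * F ^ 2) := by
        calc _ = κ ^ 2 * r ^ 2 * F ^ 2 / (4 * c * (r - M)) := by
              have : r - M ≠ 0 := by linarith
              field_simp
          _ ≤ 2 ^ 2 * r ^ 2 * F ^ 2 / (4 * c * (M / 2)) := by gcongr; linarith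
          _ = _ := by field_simp; ring
      have y3 : r ^ 2 * F ^ 2 ≤ 1 / (M * M ^ q) * (r ^ 3 * r ^ q) * F ^ 2 :=
        mul_le_mul_of_nonneg_right (sq_le_cube_rpow hM hr hq) (sq_nonneg F)
      have y4 : 2 / (c * M) * (r ^ 2 * F ^ 2)
          ≤ 2 / (c * M) * (1 / (M * M ^ q) * (1 * (r ^ 3 * r ^ q * F ^ 2))) :=
        mul_le_mul_of_nonneg_left (by linarith) (by positivity)
      have y5 : 2 / (c * M) * (1 / (M * M ^ q) * (1 * (r ^ 3 * r ^ q * F ^ 2)))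
          ≤ 2 / (c * M) * (1 / (M * M ^ q) * (lam ^ (2 - q) * (r ^ 3 * r ^ q * F ^ 2))) := by
        gcongr
      have e : κ * (z * F / r) = z * (κ * F / r) := by ring
      rw [e]
      linarith
    -- Splitting of W: the 1/r part comes from the bulk, and the 1/λ part from the flux, where Dh =
    -- 2 on N and η ≥ (1 − q/2)/λ.
    have g1 : cm * (weightW q lam r * p ^ 2) ≤ c * (lam ^ (2 - q) * (r ^ q / r) * p ^ 2)
        + η * (lam ^ (2 - q) * (2 * r ^ q * p ^ 2)) := by
      have e1 : cm * (lam ^ (2 - q) * (r ^ q / r) * p ^ 2) ≤ c * (lam ^ (2 - q) * (r ^ q / r) * p ^ 2) := by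
        gcongr
      have e2 : cm / 2 / lam * (lam ^ (2 - q) * (2 * r ^ q * p ^ 2)) ≤ η * (lam ^ (2 - q) * (2 * r ^ q * p ^ 2)) := by
        refine mul_le_mul_of_nonneg_right (le_trans ?_ hη) (by positivity)
        gcongr; linarith
      calc _ = cm * (lam ^ (2 - q) * (r ^ q / r) * p ^ 2) + cm / 2 / lam * (lam ^ (2 - q) * (2 * r ^ q * p ^ 2)) := by
            rw [weightW]; field_simp
        _ ≤ _ := add_le_add e1 e2
    have g3 : cm * (1 / r * y ^ 2) ≤ c * (1 / r * y ^ 2) := by gcongr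
    have s1 : 0 ≤ lam ^ (2 - q) * (r ^ 3 * r ^ q * F ^ 2) := by positivity
    generalize lam ^ (2 - q) * (r ^ 3 * r ^ q * F ^ 2) = Y at *
    generalize bulkTwo M q C₂ ε (lam ^ (2 - q)) r y p z F = B at *
    generalize fluxTwo M q C₂ ε (lam ^ (2 - q)) (2 / lapse M r) r y p z = B2 at *
    generalize 2 / (c * M) * (1 / (M * M ^ q)) = k at *
    linarith

end

end

/-! ### The total current and its rate of change -/

noncomputable section

open Set

/-- The coefficients with which the currents of order zero, one and two are put together. -/
structure Weights where
  A₁ : ℝ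
  A₂ : ℝ
  C₁ : ℝ
  C₂ : ℝ
  ε₁ : ℝ
  ε₂ : ℝ

/-- All coefficients are positive. -/
structure Weights.Pos (w : Weights) : Prop where
  hA₁ : 0 < w.A₁
  hA₂ : 0 < w.A₂
  hC₁ : 0 < w.C₁
  hC₂ : 0 < w.C₂
  hε₁ : 0 < w.ε₁
  hε₂ : 0 < w.ε₂

/-- A decreasing factor between one and two. -/
def kappa (q lam t : ℝ) : ℝ := 2 - (t / lam) ^ (1 - q / 2)

/-- The rate of decrease of `kappa`. -/
def kappaRate (q lam t : ℝ) : ℝ := (1 - q / 2) / lam * (t / lam) ^ (-(q / 2))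

/-- Flux density of the total current at time `t - 1`. -/
def totalFlux (M q : ℝ) (w : Weights) (lam t h r y p z : ℝ) : ℝ :=
  w.A₂ * (kappa q lam t * fluxTwo M q w.C₂ w.ε₂ (lam ^ (2 - q)) h r y p z)
    + w.A₁ * (t * fluxOne M q w.C₁ w.ε₁ lam h r y p z) + t ^ 2 * fluxZero M q h r y p z

/-- Divergence of the total current at time `t - 1`. -/
def totalRate (M q : ℝ) (w : Weights) (lam t h r y p z F : ℝ) : ℝ :=
  -(w.A₂ * (kappa q lam t * bulkTwo M q w.C₂ w.ε₂ (lam ^ (2 - q)) r y p z F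
      + kappaRate q lam t * fluxTwo M q w.C₂ w.ε₂ (lam ^ (2 - q)) h r y p z))
    + w.A₁ * (fluxOne M q w.C₁ w.ε₁ lam h r y p z - t * bulkOne M q w.C₁ w.ε₁ lam r y p z F)
    + (2 * t * fluxZero M q h r y p z - t ^ 2 * bulkZero M q r y p z F)

section

variable {M q R₀ lam t : ℝ}

theorem hasDerivAt_kappa (hl : 0 < lam) (ht : 0 < t) :
    HasDerivAt (kappa q lam) (-kappaRate q lam t) t := by
  have h := (((hasDerivAt_id t).div_const lam).rpow_const (p := 1 - q / 2)
    (Or.inl (div_pos ht hl).ne')).const_sub 2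
  refine h.congr_deriv ?_
  rw [kappaRate, id, show 1 - q / 2 - 1 = -(q / 2) by ring]
  ring

theorem kappa_le (hl : 0 < lam) (ht : 0 ≤ t) : kappa q lam t ≤ 2 := by
  have := Real.rpow_nonneg (div_nonneg ht hl.le) (1 - q / 2)
  rw [kappa]; linarith

theorem one_le_kappa (hq2 : q < 2) (hl : 0 < lam) (ht : 0 ≤ t) (htl : t ≤ lam) : 1 ≤ kappa q lam t := by
  have := Real.rpow_le_one (div_nonneg ht hl.le) ((div_le_one hl).2 htl) (by linarith : 0 ≤ 1 - q / 2)
  rw [kappa]; linarith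

/-- A constant rate of this size would suffice for the absorption, but the source term F²/η would
then cost λ∫t^(−q), which exceeds λ^(2−q) when q ≥ 1. The factor (t/λ)^(−q/2) makes the rate larger
at early times while the total decrease of κ stays at most one. -/
theorem le_kappaRate (hq : 0 < q) (hq2 : q < 2) (hl : 0 < lam) (ht : 0 < t) (htl : t ≤ lam) :
    (1 - q / 2) / lam ≤ kappaRate q lam t := by
  have h1 := Real.one_le_rpow_of_pos_of_le_one_of_nonpos (div_pos ht hl) ((div_le_one hl).2 htl)
    (by linarith : -(q / 2) ≤ 0)
  have : 0 ≤ (1 - q / 2) / lam := div_nonneg (by linarith) hl.le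
  rw [kappaRate]; nlinarith

theorem exists_totalRate_le (hM : 0 < M) (hR₀ : 2 * M < R₀) (hq : 0 < q) (hq2 : q < 2) :
    ∃ (w : Weights) (C : ℝ), w.Pos ∧ 0 < C ∧ ∀ lam t r y p z F : ℝ, 1 ≤ lam → 1 ≤ t → t ≤ lam →
      (M ≤ r → r ≤ R₀ → totalRate M q w lam t 1 r y p z F
        ≤ C * ((t ^ 2 + lam ^ (2 - q)) * (r ^ 3 * r ^ q * F ^ 2) + F ^ 2 / kappaRate q lam t)) ∧
      (R₀ ≤ r → totalRate M q w lam t (2 / lapse M r) r y p z F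
        ≤ C * ((t ^ 2 + lam ^ (2 - q)) * (r ^ 3 * r ^ q * F ^ 2))) := by
  obtain ⟨c₀, C₀, hc₀, hC₀, hb0⟩ := exists_bulkZero_ge hM hq hq2
  obtain ⟨C₁, c₁, B₁, hC₁, hc₁, hB₁, hb1⟩ := exists_bulkOne_ge hM hq hq2
  obtain ⟨C₂, ε₂, c₂, B₂, hC₂, hε₂, hc₂, hB₂, hb2⟩ := exists_orderTwo_le hM hR₀ hq hq2
  have hR0 : 0 < R₀ := by linarith
  obtain ⟨K₁, hK₁⟩ : ∃ K, K = 10000 * C₁ * (8 * (1 + M) / M + R₀ ^ 3 + M) + 8 + R₀ ^ 2 + M * R₀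
    + M / 16 * R₀ + 2 := ⟨_, rfl⟩
  obtain ⟨K₀, hK₀⟩ : ∃ K, K = 10000 * (32 + R₀ ^ 2 + M) := ⟨_, rfl⟩
  have pK₁ : 0 < K₁ := by rw [hK₁]; positivity
  have pK₀ : 0 < K₀ := by rw [hK₀]; positivity
  -- A₁ is chosen so that t times the bulk of order one pays for 2t·Flux₀. Then A₂ lets order two
  -- pay for A₁·Flux₁ and for the multiples of Wp² lost at the two lower orders.
  obtain ⟨A₁, hA₁⟩ : ∃ A, A = 2 * K₀ / c₁ := ⟨_, rfl⟩
  have pA₁ : 0 < A₁ := by rw [hA₁]; positivity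
  obtain ⟨A₂, hA₂⟩ : ∃ A, A = (A₁ * K₁ + A₁ * B₁ + 2 * K₀) / c₂ := ⟨_, rfl⟩
  have pA₂ : 0 < A₂ := by rw [hA₂]; positivity
  have eA₁ : A₁ * c₁ = 2 * K₀ := by rw [hA₁]; field_simp
  have eA₂ : A₂ * c₂ = A₁ * K₁ + A₁ * B₁ + 2 * K₀ := by rw [hA₂]; field_simp
  refine ⟨⟨A₁, A₂, C₁, C₂, M / 16, ε₂⟩, A₂ * B₂ + A₁ * B₁ + C₀,
    ⟨pA₁, pA₂, hC₁, hC₂, by positivity, hε₂⟩, by positivity, ?_⟩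
  intro lam t r y p z F hl ht htl
  have hl0 : 0 < lam := by linarith
  have ht0 : 0 < t := by linarith
  have hκ1 := one_le_kappa (q := q) hq2 hl0 ht0.le htl
  have hκ2 := kappa_le (q := q) hl0 ht0.le
  have hη := le_kappaRate hq hq2 hl0 ht0 htl
  have hη0 : 0 < kappaRate q lam t := lt_of_lt_of_le (div_pos (by linarith) hl0) hη
  have key : ∀ h E : ℝ, M ≤ r → 0 ≤ h → h ≤ 8 → lapse M r * h ≤ 2 → (1 - lapse M r / 2 * h = 0 ∨ r ≤ R₀) →
      c₂ * goodTwo M q lam h r y p z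
        ≤ kappa q lam t * bulkTwo M q C₂ ε₂ (lam ^ (2 - q)) r y p z F
          + kappaRate q lam t * fluxTwo M q C₂ ε₂ (lam ^ (2 - q)) h r y p z + B₂ * E →
      totalRate M q ⟨A₁, A₂, C₁, C₂, M / 16, ε₂⟩ lam t h r y p z F
        ≤ A₂ * B₂ * E + (A₁ * B₁ + C₀) * (t ^ 2 * (r ^ 3 * r ^ q * F ^ 2)) := by
    intro h E hr hh hh8 hDh hw h2
    have hr0 : 0 < r := hM.trans_le hr
    have hx := sub_nonneg.2 hr
    have hw0 : 0 ≤ 1 - lapse M r / 2 * h := by linarith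
    have b0 := hb0 r y p z F hr
    have b1 := hb1 lam t r y p z F hr hl ht htl
    have f1 := fluxOne_le hM hr hq hq2 hh hh8 hDh hR0.le hw hl hC₁.le (by positivity : 0 ≤ M / 16) y p z
    have f0 := mul_fluxZero_le hM hr hq hq2 hh hh8 hDh hw ht htl y p z
    rw [← hK₁] at f1
    rw [← hK₀] at f0
    have g0 : 0 ≤ c₀ * ((p ^ 2 + (lapse M r * z) ^ 2) / (r * r ^ q) + (r - M) ^ 4 / r ^ 6 * y ^ 2) := by
      have := Real.rpow_nonneg hr0.le q
      positivity
    have g2 : weightW q lam r * p ^ 2 ≤ goodTwo M q lam h r y p z := by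
      have n1 : 0 ≤ (1 - lapse M r / 2 * h) * ((r - M) / r ^ 4) * z ^ 2 := by positivity
      have n2 : 0 ≤ 1 / r * y ^ 2 := by positivity
      rw [goodTwo]; linarith
    have b0' := mul_le_mul_of_nonneg_left (g0.trans b0) (sq_nonneg t)
    have b1' := mul_le_mul_of_nonneg_left b1 pA₁.le
    have f1' := mul_le_mul_of_nonneg_left f1 pA₁.le
    have h2' := mul_le_mul_of_nonneg_left h2 pA₂.le
    have g2' := mul_le_mul_of_nonneg_left g2 (show 0 ≤ A₁ * B₁ + 2 * K₀ by positivity)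
    simp only [totalRate]
    generalize r ^ 3 * r ^ q * F ^ 2 = S at *
    generalize weightW q lam r * p ^ 2 = X at *
    generalize goodTwo M q lam h r y p z = G at *
    generalize goodOne M lam r y p z = G₁ at *
    generalize bulkZero M q r y p z F = b₀ at *
    generalize bulkOne M q C₁ (M / 16) lam r y p z F = b₁ at *
    generalize bulkTwo M q C₂ ε₂ (lam ^ (2 - q)) r y p z F = b₂ at *
    generalize fluxZero M q h r y p z = f₀ at *
    generalize fluxOne M q C₁ (M / 16) lam h r y p z = f₁ at *
    generalize fluxTwo M q C₂ ε₂ (lam ^ (2 - q)) h r y p z = f₂ at *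
    have e1 : A₁ * (c₁ * (t * G₁)) = 2 * K₀ * (t * G₁) := by rw [← eA₁]; ring
    have e2 : A₂ * (c₂ * G) = (A₁ * K₁ + A₁ * B₁ + 2 * K₀) * G := by rw [← eA₂]; ring
    rw [e1] at b1'
    rw [e2] at h2'
    linarith
  obtain ⟨hS, hN⟩ := hb2 lam (kappa q lam t) (kappaRate q lam t) r y p z F hl hκ1 hκ2 hη
  have hΛ : 0 ≤ lam ^ (2 - q) := Real.rpow_nonneg hl0.le _
  have m1 : 0 ≤ A₂ * B₂ := by positivity
  have m2 : 0 ≤ A₁ * B₁ + C₀ := by positivity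
  have s2 : 0 ≤ F ^ 2 / kappaRate q lam t := by positivity
  constructor
  · intro hr hrR
    have hr0 : 0 < r := hM.trans_le hr
    have hS' := key 1 _ hr zero_le_one (by norm_num) (by linarith [lapse_le_one hM hr]) (Or.inr hrR) (hS hr hrR)
    have s1 : 0 ≤ r ^ 3 * r ^ q * F ^ 2 := by
      have := Real.rpow_nonneg hr0.le q
      positivity
    have k1 := mul_nonneg m1 (mul_nonneg (sq_nonneg t) s1)
    have k2 := mul_nonneg m2 (mul_nonneg hΛ s1)
    have k3 := mul_nonneg m2 s2
    generalize r ^ 3 * r ^ q * F ^ 2 = S at *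
    generalize A₁ * B₁ = u at *
    generalize A₂ * B₂ = v at *
    linarith
  · intro hrR
    have hr : M ≤ r := by linarith
    have hr0 : 0 < r := hM.trans_le hr
    have hDh := lapse_mul_two_div (r := r) hM (by linarith)
    have hD4 := lapse_ge_quarter (r := r) hM (by linarith)
    have hh : 0 ≤ 2 / lapse M r := by positivity
    have hh8 : 2 / lapse M r ≤ 8 := by rw [div_le_iff₀ (by linarith)]; linarith
    have hN' := key _ _ hr hh hh8 hDh.le (Or.inl (by linarith)) (hN hrR)
    have s1 : 0 ≤ r ^ 3 * r ^ q * F ^ 2 := by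
      have := Real.rpow_nonneg hr0.le q
      positivity
    have k1 := mul_nonneg m1 (mul_nonneg (sq_nonneg t) s1)
    have k2 := mul_nonneg m2 (mul_nonneg hΛ s1)
    generalize r ^ 3 * r ^ q * F ^ 2 = S at *
    generalize A₁ * B₁ = u at *
    generalize A₂ * B₂ = v at *
    linarith

variable {h r : ℝ}

theorem totalFlux_ge (hM : 0 < M) (hr : M ≤ r) (hq : 0 < q) (hq2 : q < 2) (hh : 0 ≤ h) (hDh : lapse M r * h ≤ 2)
    {w : Weights} (hw : w.Pos) (ht : 0 < t) (htl : t ≤ lam) (y p z : ℝ) :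
    t ^ 2 * fluxT M h r y p z ≤ totalFlux M q w lam t h r y p z := by
  have hl0 : 0 < lam := by linarith
  have h0 := mul_le_mul_of_nonneg_left (fluxT_le_fluxZero hM hr hq hh hDh y p z) (sq_nonneg t)
  have h1 := fluxOne_nonneg hM hr hq hh hDh hw.hC₁.le hw.hε₁.le hl0 y p z
  have h2 := fluxTwo_nonneg hM hr hq hh hDh hw.hC₂.le hw.hε₂.le (Real.rpow_nonneg hl0.le (2 - q)) y p z
  have hκ : 0 ≤ kappa q lam t := by linarith [one_le_kappa (q := q) hq2 hl0 ht.le htl]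
  have := hw.hA₁
  have := hw.hA₂
  have k1 : 0 ≤ w.A₂ * (kappa q lam t * fluxTwo M q w.C₂ w.ε₂ (lam ^ (2 - q)) h r y p z) := by positivity
  have k2 : 0 ≤ w.A₁ * (t * fluxOne M q w.C₁ w.ε₁ lam h r y p z) := by positivity
  rw [totalFlux]
  linarith

theorem fluxZero_le_sq (hM : 0 < M) (hr : M ≤ r) (hq : 0 < q) (hh : 0 ≤ h) (hh8 : h ≤ 8)
    (hDh : lapse M r * h ≤ 2) (y p z : ℝ) :
    fluxZero M q h r y p z ≤ 80000 * (p ^ 2 + (1 - lapse M r / 2 * h) * z ^ 2 + y ^ 2) := by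
  have hr0 : 0 < r := hM.trans_le hr
  have hx := sub_nonneg.2 hr
  have hD := lapse_nonneg M r
  have hD1 := lapse_le_one hM hr
  have hw0 : 0 ≤ 1 - lapse M r / 2 * h := by linarith
  have hw1 : 1 - lapse M r / 2 * h ≤ 1 := by linarith [mul_nonneg hD hh]
  have n1 : M * (r - M) / r ^ 2 ≤ 1 := by
    rw [div_le_one (by positivity)]; nlinarith
  have hp := sq_nonneg p
  have hy := sq_nonneg y
  have hz : 0 ≤ (1 - lapse M r / 2 * h) * z ^ 2 := mul_nonneg hw0 (sq_nonneg z)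
  refine (fluxZero_le hM hr hq hh hDh y p z).trans ?_
  rw [fluxT]
  have a1 : h * p ^ 2 ≤ 8 * p ^ 2 := by gcongr
  have a2 : lapse M r / 2 * ((1 - lapse M r / 2 * h) * z ^ 2) ≤ 1 * ((1 - lapse M r / 2 * h) * z ^ 2) := by
    gcongr; linarith
  have a3 : M * (r - M) / r ^ 2 * y ^ 2 ≤ 1 * y ^ 2 := by gcongr
  linarith

theorem fluxOne_le_sq {R : ℝ} {w : Weights} (hw : w.Pos) (hM : 0 < M) (hr : M ≤ r) (hq : 0 < q) (hh : 0 ≤ h) (hh8 : h ≤ 8)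
    (hDh : lapse M r * h ≤ 2) (hrR : r ≤ R) (hl0 : 0 < lam) (y p z : ℝ) :
    fluxOne M q w.C₁ w.ε₁ lam h r y p z ≤ (80000 * w.C₁ + 8 * R + 1 / M + R + w.ε₁ + 2 / M)
      * (p ^ 2 + (1 - lapse M r / 2 * h) * z ^ 2 + y ^ 2) := by
  have h3 := hw.hC₁
  have h5 := hw.hε₁
  have hr0 : 0 < r := hM.trans_le hr
  have hx := sub_nonneg.2 hr
  have hD := lapse_nonneg M r
  have hD1 := lapse_le_one hM hr
  have hw0 : 0 ≤ 1 - lapse M r / 2 * h := by linarith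
  have hw1 : 1 - lapse M r / 2 * h ≤ 1 := by linarith [mul_nonneg hD hh]
  have n1 : M * (r - M) / r ^ 2 ≤ 1 := by
    rw [div_le_one (by positivity)]; nlinarith
  have n2 : (r - M) ^ 3 / r ^ 3 ≤ 1 := by
    rw [div_le_one (by positivity)]; exact pow_le_pow_left₀ hx (by linarith) 3
  have n3 : (r - M) / r ^ 2 ≤ 1 / M := (div_sq_le_div hM hr).trans (by gcongr)
  have hR : 0 < R := by linarith
  have hp := sq_nonneg p
  have hy := sq_nonneg y
  have hz : 0 ≤ (1 - lapse M r / 2 * h) * z ^ 2 := mul_nonneg hw0 (sq_nonneg z)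
  have z0 := fluxZero_le_sq hM hr hq hh hh8 hDh y p z
  have e : (r - M) / r ^ 2 * (1 - lapse M r / 2 * h) * z ^ 2
      = (r - M) / r ^ 2 * ((1 - lapse M r / 2 * h) * z ^ 2) := by ring
  rw [fluxOne_eq hr0, e]
  have b0 := weightOne_nonneg hM hr hl0
  have b1 := (weightOne_le_self hM hr hl0).trans hrR
  have a0 := mul_le_mul_of_nonneg_left z0 h3.le
  have a1 : h * weightOne M lam r * p ^ 2 ≤ 8 * R * p ^ 2 := by gcongr
  have a2 : (r - M) / r ^ 2 * ((1 - lapse M r / 2 * h) * z ^ 2) ≤ 1 / M * ((1 - lapse M r / 2 * h) * z ^ 2) := by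
    gcongr
  have a3 : weightOne M lam r * (1 - lapse M r / 2 * h) * (M * (r - M) / r ^ 2) * y ^ 2 ≤ R * 1 * 1 * y ^ 2 := by
    gcongr
  have a4 : w.ε₁ * (1 - lapse M r / 2 * h) * ((r - M) ^ 3 / r ^ 3) * y ^ 2 ≤ w.ε₁ * 1 * 1 * y ^ 2 := by gcongr
  have a5 : M * (lapse M r * h) / r ^ 2 * y ^ 2 ≤ 2 / M * y ^ 2 := by
    have : M * (lapse M r * h) / r ^ 2 ≤ M * 2 / M ^ 2 := by gcongr
    rw [show M * 2 / M ^ 2 = 2 / M by field_simp] at this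
    gcongr
  generalize (1 - lapse M r / 2 * h) * z ^ 2 = Z at *
  generalize p ^ 2 = P at *
  have k1 : 0 ≤ (1 / M + R + w.ε₁ + 2 / M) * P := by positivity
  have k2 : 0 ≤ (8 * R + R + w.ε₁ + 2 / M) * Z := by positivity
  have k3 : 0 ≤ (8 * R + 1 / M) * y ^ 2 := by positivity
  linarith

theorem fluxTwo_le_sq {R : ℝ} {w : Weights} (hw : w.Pos) (hM : 0 < M) (hr : M ≤ r) (hq : 0 < q) (hh : 0 ≤ h) (hh8 : h ≤ 8)
    (hDh : lapse M r * h ≤ 2) (hrR : r ≤ R) (hΛ : 1 ≤ lam ^ (2 - q)) (y p z : ℝ) :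
    fluxTwo M q w.C₂ w.ε₂ (lam ^ (2 - q)) h r y p z
      ≤ lam ^ (2 - q) * ((80000 * w.C₂ + 2 * R ^ q + R ^ q + w.ε₂ + 1 / M ^ 2 + 8 / M ^ 2)
      * (p ^ 2 + (1 - lapse M r / 2 * h) * z ^ 2 + y ^ 2)) := by
  have h4 := hw.hC₂
  have h6 := hw.hε₂
  have hr0 : 0 < r := hM.trans_le hr
  have hx := sub_nonneg.2 hr
  have hD := lapse_nonneg M r
  have hD1 := lapse_le_one hM hr
  have hw0 : 0 ≤ 1 - lapse M r / 2 * h := by linarith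
  have hw1 : 1 - lapse M r / 2 * h ≤ 1 := by linarith [mul_nonneg hD hh]
  have n1 : M * (r - M) / r ^ 2 ≤ 1 := by
    rw [div_le_one (by positivity)]; nlinarith
  have n2 : (r - M) ^ 3 / r ^ 3 ≤ 1 := by
    rw [div_le_one (by positivity)]; exact pow_le_pow_left₀ hx (by linarith) 3
  have n4 : 1 / r ^ 2 ≤ 1 / M ^ 2 := by gcongr
  have hrq : 0 ≤ r ^ q := Real.rpow_nonneg hr0.le q
  have hrR' : r ^ q ≤ R ^ q := Real.rpow_le_rpow hr0.le hrR hq.le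
  have hR : 0 < R := by linarith
  have hp := sq_nonneg p
  have hy := sq_nonneg y
  have hz : 0 ≤ (1 - lapse M r / 2 * h) * z ^ 2 := mul_nonneg hw0 (sq_nonneg z)
  have z0 := fluxZero_le_sq hM hr hq hh hh8 hDh y p z
  have e : 1 / r ^ 2 * (1 - lapse M r / 2 * h) * z ^ 2
      = 1 / r ^ 2 * ((1 - lapse M r / 2 * h) * z ^ 2) := by ring
  rw [fluxTwo_eq hr0, e]
  have b0 := weightTwo_nonneg (q := q) hM hr
  have b1 : weightTwo M q r ≤ R ^ q := by
    rw [weightTwo, ← lapse_eq M hr0.ne']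
    calc _ ≤ 1 * R ^ q := by gcongr
      _ = _ := one_mul _
  have a0 := mul_le_mul_of_nonneg_left z0 h4.le
  have a1 : lapse M r * h * r ^ q * p ^ 2 ≤ 2 * R ^ q * p ^ 2 := by gcongr
  have a3 : weightTwo M q r * (1 - lapse M r / 2 * h) * (M * (r - M) / r ^ 2) * y ^ 2 ≤ R ^ q * 1 * 1 * y ^ 2 := by
    gcongr
  have a4 : w.ε₂ * (1 - lapse M r / 2 * h) * ((r - M) ^ 3 / r ^ 3) * y ^ 2 ≤ w.ε₂ * 1 * 1 * y ^ 2 := by gcongr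
  have a2 : 1 / r ^ 2 * ((1 - lapse M r / 2 * h) * z ^ 2)
      ≤ lam ^ (2 - q) * (1 / M ^ 2 * ((1 - lapse M r / 2 * h) * z ^ 2)) := by
    calc _ ≤ 1 * (1 / M ^ 2 * ((1 - lapse M r / 2 * h) * z ^ 2)) := by rw [one_mul]; gcongr
      _ ≤ _ := by gcongr
  have a5 : h * M * (r - M) / r ^ 4 * y ^ 2 ≤ lam ^ (2 - q) * (8 / M ^ 2 * y ^ 2) := by
    have : h * M * (r - M) / r ^ 4 ≤ 8 / M ^ 2 := by
      calc _ = h * (M * (r - M) / r ^ 2) * (1 / r ^ 2) := by field_simp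
        _ ≤ 8 * 1 * (1 / M ^ 2) := by gcongr
        _ = _ := by ring
    calc _ ≤ 1 * (8 / M ^ 2 * y ^ 2) := by rw [one_mul]; gcongr
      _ ≤ _ := by gcongr
  have hRq : 0 ≤ R ^ q := Real.rpow_nonneg hR.le q
  have a6 : w.C₂ * fluxZero M q h r y p z + lapse M r * h * r ^ q * p ^ 2
    + (weightTwo M q r * (1 - lapse M r / 2 * h) * (M * (r - M) / r ^ 2)
      + w.ε₂ * (1 - lapse M r / 2 * h) * ((r - M) ^ 3 / r ^ 3)) * y ^ 2
    ≤ (80000 * w.C₂ + 2 * R ^ q + R ^ q + w.ε₂ + 1 / M ^ 2 + 8 / M ^ 2)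
        * (p ^ 2 + (1 - lapse M r / 2 * h) * z ^ 2 + y ^ 2)
      - 1 / M ^ 2 * ((1 - lapse M r / 2 * h) * z ^ 2) - 8 / M ^ 2 * y ^ 2 := by
    generalize (1 - lapse M r / 2 * h) * z ^ 2 = Z at *
    generalize p ^ 2 = P at *
    have k1 : 0 ≤ (R ^ q + w.ε₂ + 1 / M ^ 2 + 8 / M ^ 2) * P := by positivity
    have k2 : 0 ≤ (2 * R ^ q + R ^ q + w.ε₂ + 8 / M ^ 2) * Z := by positivity
    have k3 : 0 ≤ (2 * R ^ q + 1 / M ^ 2) * y ^ 2 := by positivity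
    linarith
  have a7 := mul_le_mul_of_nonneg_left a6 (by linarith : 0 ≤ lam ^ (2 - q))
  generalize w.C₂ * fluxZero M q h r y p z + lapse M r * h * r ^ q * p ^ 2
    + (weightTwo M q r * (1 - lapse M r / 2 * h) * (M * (r - M) / r ^ 2)
      + w.ε₂ * (1 - lapse M r / 2 * h) * ((r - M) ^ 3 / r ^ 3)) * y ^ 2 = B at *
  generalize (80000 * w.C₂ + 2 * R ^ q + R ^ q + w.ε₂ + 1 / M ^ 2 + 8 / M ^ 2)
        * (p ^ 2 + (1 - lapse M r / 2 * h) * z ^ 2 + y ^ 2) = X at *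
  linarith

/-- At t = 1 and bounded radius all weights are bounded, apart from the factor λ^(2−q) put in by
hand. -/
theorem exists_totalFlux_one_le (hM : 0 < M) (hq : 0 < q) (hq2 : q < 2) {w : Weights} (hw : w.Pos)
    {R : ℝ} (hR : 0 < R) :
    ∃ C, 0 < C ∧ ∀ lam h r y p z : ℝ, 1 ≤ lam → M ≤ r → r ≤ R → 0 ≤ h → h ≤ 8 → lapse M r * h ≤ 2 →
      totalFlux M q w lam 1 h r y p z
        ≤ C * lam ^ (2 - q) * (p ^ 2 + (1 - lapse M r / 2 * h) * z ^ 2 + y ^ 2) := by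
  have h1 := hw.hA₁
  have h2 := hw.hA₂
  have h3 := hw.hC₁
  have h4 := hw.hC₂
  have h5 := hw.hε₁
  have h6 := hw.hε₂
  refine ⟨w.A₂ * (2 * (80000 * w.C₂ + 2 * R ^ q + R ^ q + w.ε₂ + 1 / M ^ 2 + 8 / M ^ 2))
    + w.A₁ * (80000 * w.C₁ + 8 * R + 1 / M + R + w.ε₁ + 2 / M) + 80000, by positivity, ?_⟩
  intro lam h r y p z hl hr hrR hh hh8 hDh
  have hl0 : 0 < lam := by linarith
  have hD := lapse_nonneg M r
  have hw0 : 0 ≤ 1 - lapse M r / 2 * h := by linarith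
  have hΛ : 1 ≤ lam ^ (2 - q) := Real.one_le_rpow hl (by linarith)
  have hκ := kappa_le (q := q) (t := 1) hl0 zero_le_one
  have hκ0 : 0 ≤ kappa q lam 1 := by linarith [one_le_kappa (q := q) (t := 1) hq2 hl0 zero_le_one hl]
  have z0 := fluxZero_le_sq hM hr hq hh hh8 hDh y p z
  have z1 := fluxOne_le_sq hw hM hr hq hh hh8 hDh hrR hl0 y p z
  have z2 := fluxTwo_le_sq hw hM hr hq hh hh8 hDh hrR hΛ y p z
  have nX : 0 ≤ p ^ 2 + (1 - lapse M r / 2 * h) * z ^ 2 + y ^ 2 := by positivity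
  rw [totalFlux, one_pow, one_mul, one_mul]
  have hRq : 0 ≤ R ^ q := Real.rpow_nonneg hR.le q
  generalize p ^ 2 + (1 - lapse M r / 2 * h) * z ^ 2 + y ^ 2 = X at *
  obtain ⟨k₁, hk₁⟩ : ∃ k, k = 80000 * w.C₁ + 8 * R + 1 / M + R + w.ε₁ + 2 / M := ⟨_, rfl⟩
  obtain ⟨k₂, hk₂⟩ : ∃ k, k = 80000 * w.C₂ + 2 * R ^ q + R ^ q + w.ε₂ + 1 / M ^ 2 + 8 / M ^ 2 := ⟨_, rfl⟩
  have pk₁ : 0 ≤ k₁ := by rw [hk₁]; positivity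
  have pk₂ : 0 ≤ k₂ := by rw [hk₂]; positivity
  rw [← hk₁] at z1
  rw [← hk₂] at z2
  rw [← hk₁, ← hk₂]
  have f0 : fluxZero M q h r y p z ≤ lam ^ (2 - q) * (80000 * X) := by
    refine z0.trans ?_
    nlinarith
  have f1 : w.A₁ * fluxOne M q w.C₁ w.ε₁ lam h r y p z ≤ w.A₁ * (lam ^ (2 - q) * (k₁ * X)) := by
    have : 0 ≤ k₁ * X := by positivity
    refine mul_le_mul_of_nonneg_left (z1.trans ?_) h1.le
    nlinarith
  have f2 : w.A₂ * (kappa q lam 1 * fluxTwo M q w.C₂ w.ε₂ (lam ^ (2 - q)) h r y p z)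
      ≤ w.A₂ * (2 * (lam ^ (2 - q) * (k₂ * X))) := by
    have f2' : kappa q lam 1 * fluxTwo M q w.C₂ w.ε₂ (lam ^ (2 - q)) h r y p z
        ≤ kappa q lam 1 * (lam ^ (2 - q) * (k₂ * X)) := mul_le_mul_of_nonneg_left z2 hκ0
    have f2'' : kappa q lam 1 * (lam ^ (2 - q) * (k₂ * X)) ≤ 2 * (lam ^ (2 - q) * (k₂ * X)) := by
      gcongr
    exact mul_le_mul_of_nonneg_left (f2'.trans f2'') h2.le
  linarith

end

end

/-! ### The currents as vector fields; restriction to foliations -/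

noncomputable section

open Set

theorem IsCurrent.congr_on {W R : Set (ℝ × ℝ)} {P Q G P' Q' G' : ℝ × ℝ → ℝ} (hW : IsOpen W)
    (hR : R ⊆ W) (h : IsCurrent W R P Q G) (hP : ∀ p ∈ W, P' p = P p) (hQ : ∀ p ∈ W, Q' p = Q p)
    (hG : ∀ p ∈ R, G' p = G p) : IsCurrent W R P' Q' G' where
  contDiffOn_vComponent := h.1.congr hP
  contDiffOn_rComponent := h.2.congr hQ
  div_eq p hp := by
    have e {f g : ℝ × ℝ → ℝ} (hfg : ∀ p ∈ W, f p = g p) : fderiv ℝ f p = fderiv ℝ g p :=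
      Filter.EventuallyEq.fderiv_eq (Filter.eventually_of_mem (hW.mem_nhds (hR hp)) hfg)
    rw [hG p hp, ← h.3 p hp, dT, dY, e hP, e hQ, dT, dY]

section

variable {M q : ℝ} {U R : Set (ℝ × ℝ)} {ψ F : ℝ × ℝ → ℝ}

/-- The flux through slope h is P − hQ, so the slopes 0 and 1 determine both components. In this
form, linear combinations of currents and of flux densities correspond to each other. -/
theorem isCurrent_phiFlux (hU : IsOpen U) (h : ContDiffOn ℝ 2 ψ U)
    (hR : R ⊆ U ∩ {p : ℝ × ℝ | 0 < p.2}) (hF : ∀ p ∈ R, box M ψ p = F p)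
    {a b s k : ℝ → ℝ} (ha : ContDiffOn ℝ 1 a (Ioi 0)) (hb : ContDiffOn ℝ 1 b (Ioi 0))
    (hs : ContDiffOn ℝ 1 s (Ioi 0)) (hk : ContDiffOn ℝ 1 k (Ioi 0)) :
    IsCurrent (U ∩ {p : ℝ × ℝ | 0 < p.2}) R
      (fun p => phiFlux M a b s k 0 p.2 (p.2 * ψ p) (phiL M ψ p) (phiY ψ p))
      (fun p => phiFlux M a b s k 0 p.2 (p.2 * ψ p) (phiL M ψ p) (phiY ψ p)
        - phiFlux M a b s k 1 p.2 (p.2 * ψ p) (phiL M ψ p) (phiY ψ p))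
      (fun p => -phiBulk M a b s k p.2 (p.2 * ψ p) (phiL M ψ p) (phiY ψ p) (F p)) :=
  (isCurrent_phi hU h hR hF ha hb hs hk).congr
    (fun p => by simp only [phiFlux, phiP]; ring) (fun p => by simp only [phiFlux, phiQ]; ring)
    fun _ _ => rfl

theorem isCurrent_psiFlux (hU : IsOpen U) (h : ContDiffOn ℝ 2 ψ U)
    (hR : R ⊆ U ∩ {p : ℝ × ℝ | 0 < p.2}) (hF : ∀ p ∈ R, box M ψ p = F p) :
    IsCurrent (U ∩ {p : ℝ × ℝ | 0 < p.2}) R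
      (fun p => psiFlux M 0 p.2 ((phiL M ψ p - lapse M p.2 / 2 * ψ p) / p.2) ((phiY ψ p - ψ p) / p.2))
      (fun p => psiFlux M 0 p.2 ((phiL M ψ p - lapse M p.2 / 2 * ψ p) / p.2) ((phiY ψ p - ψ p) / p.2)
        - psiFlux M 1 p.2 ((phiL M ψ p - lapse M p.2 / 2 * ψ p) / p.2) ((phiY ψ p - ψ p) / p.2))
      (fun p => -psiBulk p.2 ((phiL M ψ p - lapse M p.2 / 2 * ψ p) / p.2)
        (lapse M p.2 / 2 * ((phiY ψ p - ψ p) / p.2)) (F p)) := by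
  have e1 : ∀ p : ℝ × ℝ, 0 < p.2 → (phiL M ψ p - lapse M p.2 / 2 * ψ p) / p.2 = psiL M ψ p := by
    intro p hp; rw [phiL, psiL]; field_simp; ring
  have e2 : ∀ p : ℝ × ℝ, 0 < p.2 → (phiY ψ p - ψ p) / p.2 = dY ψ p := by
    intro p hp; rw [phiY]; field_simp; ring
  refine (isCurrent_psi hU h hR hF).congr_on (isOpen_inter_pos hU) hR ?_ ?_ ?_
  · intro p hp
    rw [e1 p hp.2, e2 p hp.2, psiFlux, psiP]; ring
  · intro p hp
    have : p.2 ≠ 0 := ne_of_gt hp.2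
    rw [e1 p hp.2, e2 p hp.2, psiFlux, psiFlux, psiQ]; field_simp; ring
  · intro p hp
    rw [e1 p (hR hp).2, e2 p (hR hp).2]

theorem contDiffOn_potential (M : ℝ) {n : WithTop ℕ∞} : ContDiffOn ℝ n (potential M) (Ioi 0) := by
  have : ContDiffOn ℝ n (fun r => 2 * M * (r - M) / r ^ 4) (Ioi 0) :=
    (contDiffOn_const.mul (contDiffOn_id.sub contDiffOn_const)).div (contDiffOn_id.pow 4)
      fun r hr => pow_ne_zero 4 (ne_of_gt hr)
  exact this.congr fun r hr => potential_eq M (ne_of_gt hr)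

theorem contDiffOn_morawetzF (hM : 0 < M) (q : ℝ) {n : WithTop ℕ∞} :
    ContDiffOn ℝ n (morawetzF M q) (Ioi 0) :=
  contDiffOn_const.sub ((contDiffOn_const.div contDiffOn_id fun _ hr => ne_of_gt hr).rpow_const_of_ne
    fun _ hr => (div_pos hM hr).ne')

theorem contDiffOn_morawetzK (hM : 0 < M) (q : ℝ) {n : WithTop ℕ∞} :
    ContDiffOn ℝ n (morawetzK M q) (Ioi 0) :=
  (((contDiffOn_morawetzF hM q).mul (contDiffOn_lapse M)).mul (contDiffOn_potential M)).mul
    (((contDiffOn_const.div (contDiffOn_id.add contDiffOn_const)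
      fun r (hr : 0 < r) => ne_of_gt (by positivity : 0 < r + 4 * M)).div_const 2).sub contDiffOn_const)

theorem contDiffOn_weightOne {lam : ℝ} (hl : 0 < lam) {n : WithTop ℕ∞} :
    ContDiffOn ℝ n (weightOne M lam) (Ioi 0) :=
  (contDiffOn_const.mul ((contDiffOn_id.sub contDiffOn_const).pow 2)).div
    (contDiffOn_id.mul (contDiffOn_id.add contDiffOn_const))
      fun r (hr : 0 < r) => ne_of_gt (by positivity : 0 < r * (r + lam))

theorem contDiffOn_weightTwo {n : WithTop ℕ∞} : ContDiffOn ℝ n (weightTwo M q) (Ioi 0) :=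
  ContDiffOn.mul (((contDiffOn_id.sub contDiffOn_const).pow 2).div (contDiffOn_id.pow 2)
    fun r (hr : 0 < r) => pow_ne_zero 2 hr.ne') (contDiffOn_id.rpow_const_of_ne fun _ hr => ne_of_gt hr)

theorem isCurrent_fluxZero (hM : 0 < M) (q : ℝ) (hU : IsOpen U) (h : ContDiffOn ℝ 2 ψ U)
    (hR : R ⊆ U ∩ {p : ℝ × ℝ | 0 < p.2}) (hF : ∀ p ∈ R, box M ψ p = F p) :
    IsCurrent (U ∩ {p : ℝ × ℝ | 0 < p.2}) R
      (fun p => fluxZero M q 0 p.2 (ψ p) (phiL M ψ p) (phiY ψ p))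
      (fun p => fluxZero M q 0 p.2 (ψ p) (phiL M ψ p) (phiY ψ p)
        - fluxZero M q 1 p.2 (ψ p) (phiL M ψ p) (phiY ψ p))
      (fun p => -bulkZero M q p.2 (ψ p) (phiL M ψ p) (phiY ψ p) (F p)) := by
  have hW := isOpen_inter_pos hU
  have cD := contDiffOn_lapse M (n := 1)
  have cV := contDiffOn_potential M (n := 1)
  have cf := contDiffOn_morawetzF hM q (n := 1)
  have j1 := isCurrent_phiFlux hU h hR hF (a := fun _ => 1) contDiffOn_const (cD.div_const 2)
    (cV.div_const 2) ((cD.mul cV).div_const 4)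
  have j2 := isCurrent_phiFlux hU h hR hF cf ((cD.mul cf).neg.div_const 2)
    ((cf.mul cV).div_const 2) (contDiffOn_morawetzK hM q)
  have j3 := isCurrent_psiFlux hU h hR hF
  refine (((j1.const_mul hW hR 4000).add hW hR j2).add hW hR (j3.const_mul hW hR (400 * M ^ 3))).congr
    (fun p => rfl) (fun p => ?_) (fun p _ => ?_)
  · simp only [fluxZero]; ring
  · simp only [bulkZero]; ring

theorem isCurrent_fluxOne (hM : 0 < M) (q : ℝ) (hU : IsOpen U) (h : ContDiffOn ℝ 2 ψ U)
    (hR : R ⊆ U ∩ {p : ℝ × ℝ | 0 < p.2}) (hF : ∀ p ∈ R, box M ψ p = F p) (C ε : ℝ) {lam : ℝ}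
    (hl : 0 < lam) :
    IsCurrent (U ∩ {p : ℝ × ℝ | 0 < p.2}) R
      (fun p => fluxOne M q C ε lam 0 p.2 (ψ p) (phiL M ψ p) (phiY ψ p))
      (fun p => fluxOne M q C ε lam 0 p.2 (ψ p) (phiL M ψ p) (phiY ψ p)
        - fluxOne M q C ε lam 1 p.2 (ψ p) (phiL M ψ p) (phiY ψ p))
      (fun p => -bulkOne M q C ε lam p.2 (ψ p) (phiL M ψ p) (phiY ψ p) (F p)) := by
  have hW := isOpen_inter_pos hU
  have cV := contDiffOn_potential M (n := 1)
  have c1 := contDiffOn_weightOne (M := M) hl (n := 1)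
  have cb : ContDiffOn ℝ 1 (fun r => (r - M) / r ^ 2) (Ioi 0) :=
    (contDiffOn_id.sub contDiffOn_const).div (contDiffOn_id.pow 2)
      fun r hr => pow_ne_zero 2 (ne_of_gt hr)
  have cs : ContDiffOn ℝ 1 (fun r => (r - M) ^ 3 / r ^ 5) (Ioi 0) :=
    ((contDiffOn_id.sub contDiffOn_const).pow 3).div (contDiffOn_id.pow 5)
      fun r hr => pow_ne_zero 5 (ne_of_gt hr)
  have j0 := isCurrent_fluxZero hM q hU h hR hF
  have j1 := isCurrent_phiFlux hU h hR hF c1 (b := fun _ => 0) contDiffOn_const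
    ((c1.mul cV).div_const 2) (k := fun _ => 0) contDiffOn_const
  have j2 := isCurrent_phiFlux hU h hR hF (a := fun _ => 0) contDiffOn_const (b := fun _ => 0)
    contDiffOn_const cs (k := fun _ => 0) contDiffOn_const
  have j3 := isCurrent_phiFlux hU h hR hF (a := fun _ => 0) contDiffOn_const cb (s := fun _ => 0)
    contDiffOn_const ((cb.mul cV).div_const 2)
  refine ((((j0.const_mul hW hR C).add hW hR j1).add hW hR (j2.const_mul hW hR ε)).add hW hR j3).congr
    (fun p => rfl) (fun p => ?_) (fun p _ => ?_)
  · simp only [fluxOne]; ring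
  · simp only [bulkOne]; ring

theorem isCurrent_fluxTwo (hM : 0 < M) (q : ℝ) (hU : IsOpen U) (h : ContDiffOn ℝ 2 ψ U)
    (hR : R ⊆ U ∩ {p : ℝ × ℝ | 0 < p.2}) (hF : ∀ p ∈ R, box M ψ p = F p) (C ε Λ : ℝ) :
    IsCurrent (U ∩ {p : ℝ × ℝ | 0 < p.2}) R
      (fun p => fluxTwo M q C ε Λ 0 p.2 (ψ p) (phiL M ψ p) (phiY ψ p))
      (fun p => fluxTwo M q C ε Λ 0 p.2 (ψ p) (phiL M ψ p) (phiY ψ p)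
        - fluxTwo M q C ε Λ 1 p.2 (ψ p) (phiL M ψ p) (phiY ψ p))
      (fun p => -bulkTwo M q C ε Λ p.2 (ψ p) (phiL M ψ p) (phiY ψ p) (F p)) := by
  have hW := isOpen_inter_pos hU
  have cV := contDiffOn_potential M (n := 1)
  have c1 := contDiffOn_weightTwo (M := M) (q := q) (n := 1)
  have cb : ContDiffOn ℝ 1 (fun r : ℝ => 1 / r ^ 2) (Ioi 0) :=
    contDiffOn_const.div (contDiffOn_id.pow 2) fun r hr => pow_ne_zero 2 (ne_of_gt hr)
  have cs : ContDiffOn ℝ 1 (fun r => (r - M) ^ 3 / r ^ 5) (Ioi 0) :=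
    ((contDiffOn_id.sub contDiffOn_const).pow 3).div (contDiffOn_id.pow 5)
      fun r hr => pow_ne_zero 5 (ne_of_gt hr)
  have j0 := isCurrent_fluxZero hM q hU h hR hF
  have j1 := isCurrent_phiFlux hU h hR hF c1 (b := fun _ => 0) contDiffOn_const
    ((c1.mul cV).div_const 2) (k := fun _ => 0) contDiffOn_const
  have j2 := isCurrent_phiFlux hU h hR hF (a := fun _ => 0) contDiffOn_const (b := fun _ => 0)
    contDiffOn_const cs (k := fun _ => 0) contDiffOn_const
  have j3 := isCurrent_phiFlux hU h hR hF (a := fun _ => 0) contDiffOn_const cb (s := fun _ => 0)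
    contDiffOn_const ((cb.mul cV).div_const 2)
  refine (((((j0.const_mul hW hR C).add hW hR j1).add hW hR (j2.const_mul hW hR ε)).const_mul hW hR Λ).add
    hW hR j3).congr (fun p => rfl) (fun p => ?_) (fun p _ => ?_)
  · simp only [fluxTwo]; ring
  · simp only [bulkTwo]; ring

end

/-- `f dr - g dt` is a one-form on a rectangle with divergence `e`. -/
def HasDivergence (a b c d : ℝ) (f g e : ℝ → ℝ → ℝ) : Prop :=
  ∃ ft gr : ℝ → ℝ → ℝ,
    (∀ t ∈ Icc a b, ∀ r ∈ Icc c d, HasDerivAt (fun s => f s r) (ft t r) t) ∧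
    (∀ t ∈ Icc a b, ∀ r ∈ Icc c d, HasDerivAt (fun s => g t s) (gr t r) r) ∧
    ContinuousOn (Function.uncurry f) (Icc a b ×ˢ Icc c d) ∧
    ContinuousOn (Function.uncurry ft) (Icc a b ×ˢ Icc c d) ∧
    ContinuousOn (Function.uncurry gr) (Icc a b ×ˢ Icc c d) ∧
    ∀ t ∈ Icc a b, ∀ r ∈ Icc c d, ft t r + gr t r = e t r

theorem HasDivergence.add {a b c d : ℝ} {f g e f' g' e' : ℝ → ℝ → ℝ} (h : HasDivergence a b c d f g e)
    (h' : HasDivergence a b c d f' g' e') :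
    HasDivergence a b c d (fun t r => f t r + f' t r) (fun t r => g t r + g' t r)
      (fun t r => e t r + e' t r) := by
  obtain ⟨ft, gr, h1, h2, h3, h4, h5, h6⟩ := h
  obtain ⟨ft', gr', h1', h2', h3', h4', h5', h6'⟩ := h'
  refine ⟨fun t r => ft t r + ft' t r, fun t r => gr t r + gr' t r,
    fun t ht r hr => (h1 t ht r hr).fun_add (h1' t ht r hr),
    fun t ht r hr => (h2 t ht r hr).fun_add (h2' t ht r hr), h3.add h3', h4.add h4', h5.add h5',
    fun t ht r hr => ?_⟩
  linear_combination h6 t ht r hr + h6' t ht r hr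

theorem HasDivergence.integral_le {a b c d : ℝ} {f g e err : ℝ → ℝ → ℝ} (h : HasDivergence a b c d f g e)
    (hab : a ≤ b) (hcd : c ≤ d) (ce : ContinuousOn (Function.uncurry err) (Icc a b ×ˢ Icc c d))
    (he : ∀ t ∈ Icc a b, ∀ r ∈ Icc c d, e t r ≤ err t r) :
    (∫ r in c..d, f b r) + (∫ t in a..b, (g t d - g t c))
      ≤ (∫ r in c..d, f a r) + ∫ t in a..b, ∫ r in c..d, err t r := by
  obtain ⟨ft, gr, h1, h2, h3, h4, h5, h6⟩ := h
  exact divergence_rectangle_le hab hcd h1 h2 h3 h4 h5 ce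
    fun t ht r hr => (h6 t ht r hr).trans_le (he t ht r hr)

/-- A current restricted to a foliation by translates of the curve `v = H r`, weighted by a function of
the foliation parameter. -/
theorem IsCurrent.hasDivergence {W R : Set (ℝ × ℝ)} {P Q G : ℝ × ℝ → ℝ} (hW : IsOpen W) (hR : R ⊆ W)
    (h : IsCurrent W R P Q G) {a b c d : ℝ} {H H' ϖ ϖ' : ℝ → ℝ}
    (hH : ∀ r ∈ Icc c d, HasDerivAt H (H' r) r) (cH' : ContinuousOn H' (Icc c d))
    (hϖ : ∀ t ∈ Icc a b, HasDerivAt ϖ (ϖ' t) t) (cϖ' : ContinuousOn ϖ' (Icc a b))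
    (hpt : ∀ t ∈ Icc a b, ∀ r ∈ Icc c d, (t + H r, r) ∈ R) :
    HasDivergence a b c d (fun t r => ϖ t * (P (t + H r, r) - H' r * Q (t + H r, r)))
      (fun t r => ϖ t * Q (t + H r, r))
      (fun t r => ϖ' t * (P (t + H r, r) - H' r * Q (t + H r, r)) + ϖ t * G (t + H r, r)) := by
  have cH : ContinuousOn H (Icc c d) := fun r hr => (hH r hr).continuousAt.continuousWithinAt
  have cϖ : ContinuousOn ϖ (Icc a b) := fun r hr => (hϖ r hr).continuousAt.continuousWithinAt
  have cpt : ContinuousOn (fun z : ℝ × ℝ => (z.1 + H z.2, z.2)) (Icc a b ×ˢ Icc c d) :=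
    (continuousOn_fst.add (cH.comp continuousOn_snd fun z hz => hz.2)).prodMk continuousOn_snd
  have comp {f : ℝ × ℝ → ℝ} (hf : ContinuousOn f W) :
      ContinuousOn (fun z : ℝ × ℝ => f (z.1 + H z.2, z.2)) (Icc a b ×ˢ Icc c d) :=
    hf.comp cpt fun z hz => hR (hpt z.1 hz.1 z.2 hz.2)
  have c1 : ContinuousOn (fun z : ℝ × ℝ => ϖ z.1) (Icc a b ×ˢ Icc c d) :=
    cϖ.comp continuousOn_fst fun z hz => hz.1
  have c2 : ContinuousOn (fun z : ℝ × ℝ => ϖ' z.1) (Icc a b ×ˢ Icc c d) :=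
    cϖ'.comp continuousOn_fst fun z hz => hz.1
  have c3 : ContinuousOn (fun z : ℝ × ℝ => H' z.2) (Icc a b ×ˢ Icc c d) :=
    cH'.comp continuousOn_snd fun z hz => hz.2
  have cP := comp h.1.continuousOn
  have cQ := comp h.2.continuousOn
  have cTP := comp (contDiffOn_dT hW h.1 (m := 0) (by norm_num)).continuousOn
  have cTQ := comp (contDiffOn_dT hW h.2 (m := 0) (by norm_num)).continuousOn
  have cYQ := comp (contDiffOn_dY hW h.2 (m := 0) (by norm_num)).continuousOn
  -- With v = t + H(r), ∂_t is ∂_v and the radial derivative at fixed t is H'∂_v + ∂_r. The mixed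
  -- terms H'∂_vQ cancel, and since only the t-derivative falls on P − H'Q, continuity of H' is
  -- enough.
  refine ⟨fun t r => ϖ' t * (P (t + H r, r) - H' r * Q (t + H r, r))
      + ϖ t * (dT P (t + H r, r) - H' r * dT Q (t + H r, r)),
    fun t r => ϖ t * (H' r * dT Q (t + H r, r) + dY Q (t + H r, r)), ?_, ?_, ?_, ?_, ?_, ?_⟩
  · intro t ht r hr
    have hp := hR (hpt t ht r hr)
    have d {f : ℝ × ℝ → ℝ} (hf : ContDiffOn ℝ 1 f W) :
        HasDerivAt (fun s => f (s + H r, r)) (dT f (t + H r, r)) t := by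
      have := hasDerivAt_dT ((hf.contDiffAt (hW.mem_nhds hp)).differentiableAt (by simp))
      exact HasDerivAt.comp_add_const (f := fun v => f (v, r)) t (H r) this
    exact (hϖ t ht).fun_mul ((d h.1).fun_sub ((d h.2).const_mul (H' r)))
  · intro t ht r hr
    have hp := hR (hpt t ht r hr)
    have hd := ((h.2.contDiffAt (hW.mem_nhds hp)).differentiableAt (by simp)).hasFDerivAt
    have hc : HasDerivAt (fun s => (t + H s, s)) (H' r, 1) r :=
      ((hH r hr).const_add t).prodMk (hasDerivAt_id r)
    have := HasFDerivAt.comp_hasDerivAt (f := fun s => (t + H s, s)) r hd hc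
    rw [fderiv_eq_dT_dY, one_mul] at this
    exact this.const_mul (ϖ t)
  · exact c1.mul (cP.sub (c3.mul cQ))
  · exact (c2.mul (cP.sub (c3.mul cQ))).add (c1.mul (cTP.sub (c3.mul cTQ)))
  · exact c1.mul ((c3.mul cTQ).add cYQ)
  · intro t ht r hr
    linear_combination ϖ t * h.3 _ (hpt t ht r hr)

end

/-! ### The integrated inequality on one foliation -/

noncomputable section

open Set

theorem HasDivergence.congr {a b c d : ℝ} {f g e f' g' e' : ℝ → ℝ → ℝ} (h : HasDivergence a b c d f g e)
    (hf : ∀ t r, f' t r = f t r) (hg : ∀ t r, g' t r = g t r) (he : ∀ t r, e' t r = e t r) :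
    HasDivergence a b c d f' g' e' := by
  obtain rfl : f' = f := funext₂ hf
  obtain rfl : g' = g := funext₂ hg
  obtain rfl : e' = e := funext₂ he
  exact h

section Affine

variable (M q h r y p z : ℝ)

theorem fluxZero_affine : fluxZero M q h r y p z
    = fluxZero M q 0 r y p z - h * (fluxZero M q 0 r y p z - fluxZero M q 1 r y p z) := by
  simp only [fluxZero, phiFlux, psiFlux]; ring

theorem fluxOne_affine (C ε lam : ℝ) : fluxOne M q C ε lam h r y p z
    = fluxOne M q C ε lam 0 r y p z
      - h * (fluxOne M q C ε lam 0 r y p z - fluxOne M q C ε lam 1 r y p z) := by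
  simp only [fluxOne, phiFlux]; rw [fluxZero_affine]; ring

theorem fluxTwo_affine (C ε Λ : ℝ) : fluxTwo M q C ε Λ h r y p z
    = fluxTwo M q C ε Λ 0 r y p z
      - h * (fluxTwo M q C ε Λ 0 r y p z - fluxTwo M q C ε Λ 1 r y p z) := by
  simp only [fluxTwo, phiFlux]; rw [fluxZero_affine]; ring

theorem totalFlux_affine (w : Weights) (lam t : ℝ) : totalFlux M q w lam t h r y p z
    = totalFlux M q w lam t 0 r y p z
      - h * (totalFlux M q w lam t 0 r y p z - totalFlux M q w lam t 1 r y p z) := by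
  simp only [totalFlux]
  rw [fluxZero_affine, fluxOne_affine, fluxTwo_affine]; ring

end Affine

/-- Flux density of the total current of `ψ` at the point `p`. -/
def jetFlux (M q : ℝ) (w : Weights) (lam : ℝ) (ψ : ℝ × ℝ → ℝ) (t h : ℝ) (p : ℝ × ℝ) : ℝ :=
  totalFlux M q w lam t h p.2 (ψ p) (phiL M ψ p) (phiY ψ p)

/-- The `r`-component of the total current of `ψ` at the point `p`. -/
def jetRadial (M q : ℝ) (w : Weights) (lam : ℝ) (ψ : ℝ × ℝ → ℝ) (t : ℝ) (p : ℝ × ℝ) : ℝ :=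
  jetFlux M q w lam ψ t 0 p - jetFlux M q w lam ψ t 1 p

theorem kappaRate_pos {q lam t : ℝ} (hq2 : q < 2) (hl : 0 < lam) (ht : 0 < t) : 0 < kappaRate q lam t :=
  mul_pos (div_pos (by linarith) hl) (Real.rpow_pos_of_pos (div_pos ht hl) _)

theorem continuousOn_kappaRate {q lam T : ℝ} (hl : 0 < lam) :
    ContinuousOn (fun t => kappaRate q lam (1 + t)) (Icc 0 T) := by
  refine continuousOn_const.mul (ContinuousOn.rpow_const (by fun_prop) fun t ht => Or.inl ?_)
  have : 0 < 1 + t := by linarith [ht.1]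
  positivity

/-- At the horizon D = 0, so every slope h ≥ 0 is admissible and P − hQ ≥ 0 for all of them, which
forces Q ≤ 0. -/
theorem jetRadial_horizon_nonpos {M q : ℝ} (hM : 0 < M) (hq : 0 < q) (hq2 : q < 2) {w : Weights} (hw : w.Pos)
    {lam t : ℝ} (ht : 0 < t) (htl : t ≤ lam) (ψ : ℝ × ℝ → ℝ) {p : ℝ × ℝ} (hp : p.2 = M) :
    jetRadial M q w lam ψ t p ≤ 0 := by
  have hD : lapse M p.2 = 0 := by rw [hp, lapse, div_self hM.ne']; norm_num
  have pos : ∀ h, 0 ≤ h → 0 ≤ jetFlux M q w lam ψ t h p := fun h hh => by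
    refine le_trans (mul_nonneg (sq_nonneg t) (fluxT_nonneg hM hp.ge hh (by rw [hD]; norm_num) _ _ _))
      (totalFlux_ge hM hp.ge hq hq2 hh (by rw [hD]; norm_num) hw ht htl _ _ _)
  by_contra! hQ
  have h0 := pos 0 le_rfl
  -- If Q > 0, this slope would give P − hQ = −1.
  have h1 := pos ((jetFlux M q w lam ψ t 0 p + 1) / jetRadial M q w lam ψ t p) (by positivity)
  rw [jetFlux, totalFlux_affine] at h1
  change 0 ≤ jetFlux M q w lam ψ t 0 p - _ * jetRadial M q w lam ψ t p at h1
  rw [div_mul_cancel₀ _ hQ.ne'] at h1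
  linarith

section

variable {M q : ℝ} {U : Set (ℝ × ℝ)} {ψ F : ℝ × ℝ → ℝ}

/-- The integrated divergence identity on a foliation by translates of the curve `v = H r`. -/
theorem foliation_le (hM : 0 < M) (hq : 0 < q) (hq2 : q < 2) {w : Weights} (hw : w.Pos) (hU : IsOpen U)
    (hψ : ContDiffOn ℝ 2 ψ U) {T c d : ℝ} (hT : 0 ≤ T) (hc : M ≤ c) (hcd : c ≤ d) {H H' : ℝ → ℝ}
    (hH : ∀ r ∈ Icc c d, HasDerivAt H (H' r) r) (cH' : ContinuousOn H' (Icc c d))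
    (hpt : ∀ t ∈ Icc 0 T, ∀ r ∈ Icc c d, (t + H r, r) ∈ U ∧ box M ψ (t + H r, r) = F (t + H r, r))
    {χ : ℝ → ℝ} (hχ : ContDiff ℝ 1 χ) (hχ0 : ∀ v, 0 ≤ χ v) (hχ1 : ∀ v, χ v ≤ 1) (hχ' : ∀ v, deriv χ v ≤ 0)
    {err : ℝ → ℝ → ℝ} (cerr : ContinuousOn (Function.uncurry err) (Icc 0 T ×ˢ Icc c d))
    (herr : ∀ t ∈ Icc 0 T, ∀ r ∈ Icc c d, 0 ≤ err t r ∧ totalRate M q w (1 + T) (1 + t) (H' r) r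
      (ψ (t + H r, r)) (phiL M ψ (t + H r, r)) (phiY ψ (t + H r, r)) (F (t + H r, r)) ≤ err t r) :
    (∫ r in c..d, χ (T + H r) * jetFlux M q w (1 + T) ψ (1 + T) (H' r) (T + H r, r))
      + (∫ t in (0 : ℝ)..T, (χ (t + H d) * jetRadial M q w (1 + T) ψ (1 + t) (t + H d, d)
          - χ (t + H c) * jetRadial M q w (1 + T) ψ (1 + t) (t + H c, c)))
      ≤ (∫ r in c..d, χ (0 + H r) * jetFlux M q w (1 + T) ψ (1 + 0) (H' r) (0 + H r, r))
        + ∫ t in (0 : ℝ)..T, ∫ r in c..d, err t r := by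
  have hl : 0 < 1 + T := by linarith
  have hW := isOpen_inter_pos hU
  set R : Set (ℝ × ℝ) := {p | (p ∈ U ∧ box M ψ p = F p) ∧ 0 < p.2} with hRdef
  have hR : R ⊆ U ∩ {p : ℝ × ℝ | 0 < p.2} := fun p hp => ⟨hp.1.1, hp.2⟩
  have hF : ∀ p ∈ R, box M ψ p = F p := fun p hp => hp.1.2
  have hptR : ∀ t ∈ Icc 0 T, ∀ r ∈ Icc c d, (t + H r, r) ∈ R := fun t ht r hr =>
    ⟨hpt t ht r hr, by have := hr.1; change 0 < r; linarith⟩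
  have d0 := ((isCurrent_fluxZero hM q hU hψ hR hF).mul_fst hW hR hχ).hasDivergence hW hR
    (a := 0) (b := T) (ϖ := fun t => (1 + t) ^ 2) (ϖ' := fun t => 2 * (1 + t)) hH cH'
    (fun t _ => by simpa using ((hasDerivAt_id t).const_add 1).fun_pow 2) (by fun_prop) hptR
  have d1 := ((isCurrent_fluxOne hM q hU hψ hR hF w.C₁ w.ε₁ hl).mul_fst hW hR hχ).hasDivergence hW hR
    (a := 0) (b := T) (ϖ := fun t => w.A₁ * (1 + t)) (ϖ' := fun t => w.A₁) hH cH'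
    (fun t _ => by simpa using ((hasDerivAt_id t).const_add 1).const_mul w.A₁) (by fun_prop) hptR
  have d2 := ((isCurrent_fluxTwo hM q hU hψ hR hF w.C₂ w.ε₂ ((1 + T) ^ (2 - q))).mul_fst hW hR hχ).hasDivergence hW hR
    (a := 0) (b := T) (ϖ := fun t => w.A₂ * kappa q (1 + T) (1 + t))
    (ϖ' := fun t => w.A₂ * -kappaRate q (1 + T) (1 + t)) hH cH'
    (fun t ht => (HasDerivAt.comp_const_add (f := kappa q (1 + T)) 1 t
      (hasDerivAt_kappa hl (by linarith [ht.1]))).const_mul w.A₂)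
    (continuousOn_const.mul (continuousOn_kappaRate hl).neg) hptR
  have key : HasDivergence 0 T c d
      (fun t r => χ (t + H r) * jetFlux M q w (1 + T) ψ (1 + t) (H' r) (t + H r, r))
      (fun t r => χ (t + H r) * jetRadial M q w (1 + T) ψ (1 + t) (t + H r, r))
      (fun t r => χ (t + H r) * totalRate M q w (1 + T) (1 + t) (H' r) r
        (ψ (t + H r, r)) (phiL M ψ (t + H r, r)) (phiY ψ (t + H r, r)) (F (t + H r, r))
        + deriv χ (t + H r) * jetFlux M q w (1 + T) ψ (1 + t) 0 (t + H r, r)) := by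
    refine ((d2.add d1).add d0).congr (fun t r => ?_) (fun t r => ?_) (fun t r => ?_)
    · rw [jetFlux, totalFlux_affine]
      simp only [totalFlux]; ring
    · simp only [jetRadial, jetFlux, totalFlux]; ring
    · simp only [jetFlux, totalRate]
      rw [fluxZero_affine M q (H' r), fluxOne_affine M q (H' r), fluxTwo_affine M q (H' r)]
      simp only [totalFlux]; ring
  refine key.integral_le hT hcd cerr fun t ht r hr => ?_
  obtain ⟨e0, e1⟩ := herr t ht r hr
  have hr' : M ≤ r := hc.trans hr.1
  -- The derivative of the cutoff multiplies the v-component, which is the flux through v = const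
  -- and is nonnegative. As χ' ≤ 0, the cutoff error can be discarded.
  have hP : 0 ≤ jetFlux M q w (1 + T) ψ (1 + t) 0 (t + H r, r) :=
    le_trans (mul_nonneg (sq_nonneg _) (fluxT_nonneg hM hr' le_rfl (by norm_num) _ _ _))
      (totalFlux_ge hM hr' hq hq2 le_rfl (by norm_num) hw (by linarith [ht.1]) (by linarith [ht.2]) _ _ _)
  have h1 := mul_le_mul_of_nonneg_left e1 (hχ0 (t + H r))
  have h2 := mul_le_mul_of_nonneg_right (hχ1 (t + H r)) e0
  have h3 := mul_nonpos_of_nonpos_of_nonneg (hχ' (t + H r)) hP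
  linarith

end

end

/-! ### Gluing S and N -/

noncomputable section

open Set

theorem hasDerivAt_tortoise {M r : ℝ} (hM : 0 < M) (hr : M < r) :
    HasDerivAt (tortoise M) (1 / lapse M r) r := by
  have hx : r - M ≠ 0 := (sub_pos.2 hr).ne'
  have hr0 : r ≠ 0 := (hM.trans hr).ne'
  have h1 := (hasDerivAt_id r).sub_const M
  have h : HasDerivAt (tortoise M) _ r :=
    ((hasDerivAt_id r).fun_add ((h1.log hx).const_mul (2 * M))).fun_sub
      ((hasDerivAt_const r (M ^ 2)).fun_div h1 hx)
  refine h.congr_deriv ?_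
  rw [lapse_eq M hr0]
  simp only [id]
  field_simp
  ring

/-- The height `v` along `N_0`, as a function of the radius. -/
def heightN (M R₀ r : ℝ) : ℝ := R₀ + 2 * (tortoise M r - tortoise M R₀)

theorem pointN_eq (M R₀ τ r : ℝ) : pointN M R₀ τ r = (τ + heightN M R₀ r, r) := by
  rw [pointN, heightN, add_assoc]

theorem heightN_self (M R₀ : ℝ) : heightN M R₀ R₀ = R₀ := by rw [heightN]; ring

theorem hasDerivAt_heightN {M R₀ r : ℝ} (hM : 0 < M) (hr : M < r) :
    HasDerivAt (heightN M R₀) (2 / lapse M r) r :=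
  ((((hasDerivAt_tortoise hM hr).sub_const (tortoise M R₀)).const_mul 2).const_add R₀).congr_deriv (by ring)

theorem continuousOn_lapse (M : ℝ) : ContinuousOn (lapse M) (Ioi 0) :=
  (contDiffOn_lapse M (n := 1)).continuousOn

theorem continuousOn_two_div_lapse {M c d : ℝ} (hM : 0 < M) (hc : 2 * M < c) :
    ContinuousOn (fun r => 2 / lapse M r) (Icc c d) := by
  refine continuousOn_const.div ((continuousOn_lapse M).mono fun r hr => ?_) fun r hr => ?_
  · have := hr.1; change 0 < r; linarith
  · have := lapse_ge_quarter hM (r := r) (by linarith [hr.1]); linarith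

/-- The part of the weighted flux through `S_τ ∪ N_τ` inside `r ≤ Rb`. -/
def leafFlux (M q R₀ Rb : ℝ) (w : Weights) (lam : ℝ) (ψ : ℝ × ℝ → ℝ) (χ : ℝ → ℝ) (τ : ℝ) : ℝ :=
  (∫ r in M..R₀, χ (τ + r) * jetFlux M q w lam ψ (1 + τ) 1 (pointS τ r))
    + ∫ r in R₀..Rb, χ (τ + heightN M R₀ r) * jetFlux M q w lam ψ (1 + τ) (2 / lapse M r) (pointN M R₀ τ r)

/-- The square integral of the source on `S_τ`. -/
def sourceS (M R₀ : ℝ) (F : ℝ × ℝ → ℝ) (τ : ℝ) : ℝ := ∫ r in M..R₀, r ^ 2 * F (pointS τ r) ^ 2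

/-- The weighted square integral of the source on the part of `N_τ` inside `r ≤ Rb`. -/
def sourceN (M q R₀ Rb : ℝ) (F : ℝ × ℝ → ℝ) (τ : ℝ) : ℝ :=
  ∫ r in R₀..Rb, r ^ 3 * r ^ q * F (pointN M R₀ τ r) ^ 2

theorem continuousOn_comp_foliation {W : Set (ℝ × ℝ)} {F : ℝ × ℝ → ℝ} (cF : ContinuousOn F W)
    {a b c d : ℝ} {H : ℝ → ℝ} (cH : ContinuousOn H (Icc c d))
    (hpt : ∀ t ∈ Icc a b, ∀ r ∈ Icc c d, (t + H r, r) ∈ W) :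
    ContinuousOn (fun z : ℝ × ℝ => F (z.1 + H z.2, z.2)) (Icc a b ×ˢ Icc c d) :=
  cF.comp ((continuousOn_fst.add (cH.comp continuousOn_snd fun _ hz => hz.2)).prodMk continuousOn_snd)
    fun z hz => hpt z.1 hz.1 z.2 hz.2

theorem continuousOn_jetRadial {M q : ℝ} (hM : 0 < M) {U : Set (ℝ × ℝ)} (hU : IsOpen U) {ψ : ℝ × ℝ → ℝ}
    (hψ : ContDiffOn ℝ 2 ψ U) (w : Weights) {T r x : ℝ} (hT : 0 ≤ T) (hr : 0 < r)
    (hpt : ∀ t ∈ Icc 0 T, (t + x, r) ∈ U) :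
    ContinuousOn (fun t => jetRadial M q w (1 + T) ψ (1 + t) (t + x, r)) (Icc 0 T) := by
  have hl : 0 < 1 + T := by linarith
  -- Only the regularity of the components is used, so the divergence identity is requested on the
  -- empty set with a dummy source.
  have hR : (∅ : Set (ℝ × ℝ)) ⊆ U ∩ {p : ℝ × ℝ | 0 < p.2} := empty_subset _
  have hF : ∀ p ∈ (∅ : Set (ℝ × ℝ)), box M ψ p = (fun _ => (0 : ℝ)) p := fun p hp => hp.elim
  have comp {f : ℝ × ℝ → ℝ} (hf : ContDiffOn ℝ 1 f (U ∩ {p : ℝ × ℝ | 0 < p.2})) :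
      ContinuousOn (fun t => f (t + x, r)) (Icc 0 T) :=
    hf.continuousOn.comp (by fun_prop) fun t ht => ⟨hpt t ht, hr⟩
  have c0 := comp (isCurrent_fluxZero hM q hU hψ hR hF).2
  have c1 := comp (isCurrent_fluxOne hM q hU hψ hR hF w.C₁ w.ε₁ hl).2
  have c2 := comp (isCurrent_fluxTwo hM q hU hψ hR hF w.C₂ w.ε₂ ((1 + T) ^ (2 - q))).2
  have cκ : ContinuousOn (fun t => kappa q (1 + T) (1 + t)) (Icc 0 T) := fun t ht =>
    (HasDerivAt.comp_const_add (f := kappa q (1 + T)) 1 t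
      (hasDerivAt_kappa hl (by linarith [ht.1]))).continuousAt.continuousWithinAt
  have ct : ContinuousOn (fun t : ℝ => 1 + t) (Icc 0 T) := by fun_prop
  refine (((continuousOn_const (c := w.A₂)).mul (cκ.mul c2)).add
    (((continuousOn_const (c := w.A₁)).mul (ct.mul c1)).add ((ct.pow 2).mul c0))).congr fun t _ => ?_
  simp only [jetRadial, jetFlux, totalFlux, Pi.add_apply, Pi.mul_apply, Pi.pow_apply]
  ring

/-- The foliation inequality is added for S and N. The leaves meet at (t + R₀, R₀), so the radial
fluxes there cancel; the horizon flux has a favourable sign and the outer one vanishes with the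
cutoff. -/
theorem exists_leafFlux_le {M q R₀ : ℝ} (hM : 0 < M) (hR₀ : 2 * M < R₀) (hq : 0 < q) (hq2 : q < 2) :
    ∃ (w : Weights) (C : ℝ), w.Pos ∧ 0 < C ∧ ∀ (U : Set (ℝ × ℝ)) (ψ F : ℝ × ℝ → ℝ) (T Rb : ℝ) (χ : ℝ → ℝ),
      IsOpen U → ContDiffOn ℝ 2 ψ U → ContinuousOn F (U ∩ {p : ℝ × ℝ | 0 < p.2}) → 0 ≤ T → R₀ ≤ Rb →
      (∀ t ∈ Icc 0 T, ∀ r ∈ Icc M R₀, pointS t r ∈ U ∧ box M ψ (pointS t r) = F (pointS t r)) →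
      (∀ t ∈ Icc 0 T, ∀ r ∈ Ici R₀, pointN M R₀ t r ∈ U ∧ box M ψ (pointN M R₀ t r) = F (pointN M R₀ t r)) →
      ContDiff ℝ 1 χ → (∀ v, 0 ≤ χ v) → (∀ v, χ v ≤ 1) → (∀ v, deriv χ v ≤ 0) →
      (∀ t ∈ Icc 0 T, χ (t + heightN M R₀ Rb) = 0) →
      leafFlux M q R₀ Rb w (1 + T) ψ χ T ≤ leafFlux M q R₀ Rb w (1 + T) ψ χ 0
        + C * ((∫ t in (0 : ℝ)..T, ((1 + t) ^ 2 + (1 + T) ^ (2 - q) + 1 / kappaRate q (1 + T) (1 + t))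
              * sourceS M R₀ F t)
          + ∫ t in (0 : ℝ)..T, ((1 + t) ^ 2 + (1 + T) ^ (2 - q)) * sourceN M q R₀ Rb F t) := by
  obtain ⟨w, C, hw, hC, hrate⟩ := exists_totalRate_le hM hR₀ hq hq2
  have hR0 : 0 < R₀ := by linarith
  refine ⟨w, C * (R₀ * R₀ ^ q + 1 / M ^ 2 + 1), hw, by positivity, ?_⟩
  intro U ψ F T Rb χ hU hψ cF hT hRb hS hN hχ hχ0 hχ1 hχ' hχb
  have hl : 0 < 1 + T := by linarith
  have hΛ : 0 ≤ (1 + T) ^ (2 - q) := Real.rpow_nonneg hl.le _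
  obtain ⟨B, hB⟩ : ∃ B, B = C * (R₀ * R₀ ^ q + 1 / M ^ 2 + 1) := ⟨_, rfl⟩
  rw [← hB]
  have hB0 : 0 ≤ B := by rw [hB]; positivity
  have hηc : ContinuousOn (fun t => 1 / kappaRate q (1 + T) (1 + t)) (Icc 0 T) :=
    continuousOn_const.div (continuousOn_kappaRate hl) fun t ht =>
      (kappaRate_pos hq2 hl (by linarith [ht.1])).ne'
  have hptS : ∀ t ∈ Icc 0 T, ∀ r ∈ Icc M R₀, (t + r, r) ∈ U ∩ {p : ℝ × ℝ | 0 < p.2} := fun t ht r hr =>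
    ⟨(hS t ht r hr).1, hM.trans_le hr.1⟩
  have hptN : ∀ t ∈ Icc 0 T, ∀ r ∈ Icc R₀ Rb, (t + heightN M R₀ r, r) ∈ U ∩ {p : ℝ × ℝ | 0 < p.2} :=
    fun t ht r hr => ⟨by rw [← pointN_eq]; exact (hN t ht r hr.1).1, hR0.trans_le hr.1⟩
  have dH : ∀ r ∈ Icc R₀ Rb, HasDerivAt (heightN M R₀) (2 / lapse M r) r := fun r hr =>
    hasDerivAt_heightN hM (by linarith [hr.1])
  have cH : ContinuousOn (heightN M R₀) (Icc R₀ Rb) := fun r hr =>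
    (dH r hr).continuousAt.continuousWithinAt
  have cFS := continuousOn_comp_foliation cF continuousOn_id hptS
  have cFN := continuousOn_comp_foliation cF cH hptN
  have IS := foliation_le (F := F) hM hq hq2 hw hU hψ hT le_rfl (by linarith : M ≤ R₀) (H := fun r => r)
    (H' := fun _ => 1) (fun r _ => hasDerivAt_id r) continuousOn_const (fun t ht r hr => hS t ht r hr)
    hχ hχ0 hχ1 hχ'
    (err := fun t r => B * (((1 + t) ^ 2 + (1 + T) ^ (2 - q) + 1 / kappaRate q (1 + T) (1 + t))
      * (r ^ 2 * F (t + r, r) ^ 2))) (by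
      refine continuousOn_const.mul (ContinuousOn.mul ?_ (ContinuousOn.mul (by fun_prop) (cFS.pow 2)))
      exact ContinuousOn.comp (g := fun t => (1 + t) ^ 2 + (1 + T) ^ (2 - q) + 1 / kappaRate q (1 + T) (1 + t))
        (ContinuousOn.add (by fun_prop) hηc) continuousOn_fst fun z hz => hz.1)
    (by
      intro t ht r hr
      have hr0 : 0 < r := hM.trans_le hr.1
      have hη := kappaRate_pos hq2 hl (show 0 < 1 + t by linarith [ht.1])
      refine ⟨by positivity, ((hrate (1 + T) (1 + t) r _ _ _ _ (by linarith) (by linarith [ht.1])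
        (by linarith [ht.2])).1 hr.1 hr.2).trans ?_⟩
      -- On S the radius lies in [M, R₀], so both source weights reduce to r².
      have k1 : r ^ 3 * r ^ q ≤ R₀ * R₀ ^ q * r ^ 2 := by
        have : r * r ^ q ≤ R₀ * R₀ ^ q :=
          mul_le_mul hr.2 (Real.rpow_le_rpow hr0.le hr.2 hq.le) (by positivity) hR0.le
        calc _ = r * r ^ q * r ^ 2 := by ring
          _ ≤ _ := by gcongr
      have k2 : 1 ≤ 1 / M ^ 2 * r ^ 2 := by
        rw [one_div, ← div_eq_inv_mul, one_le_div (by positivity)]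
        exact pow_le_pow_left₀ hM.le hr.1 2
      have k3 : ((1 + t) ^ 2 + (1 + T) ^ (2 - q)) * (r ^ 3 * r ^ q * F (t + r, r) ^ 2)
          ≤ ((1 + t) ^ 2 + (1 + T) ^ (2 - q)) * (R₀ * R₀ ^ q * r ^ 2 * F (t + r, r) ^ 2) := by gcongr
      have k4 : 1 * (1 / kappaRate q (1 + T) (1 + t) * F (t + r, r) ^ 2)
          ≤ 1 / M ^ 2 * r ^ 2 * (1 / kappaRate q (1 + T) (1 + t) * F (t + r, r) ^ 2) := by gcongr
      have k5 : 0 ≤ (1 / M ^ 2 + 1) * (((1 + t) ^ 2 + (1 + T) ^ (2 - q)) * (r ^ 2 * F (t + r, r) ^ 2)) := by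
        positivity
      have k6 : 0 ≤ (R₀ * R₀ ^ q + 1) * (1 / kappaRate q (1 + T) (1 + t) * (r ^ 2 * F (t + r, r) ^ 2)) := by
        positivity
      rw [hB, mul_assoc C, div_eq_mul_one_div (F (t + r, r) ^ 2)]
      refine mul_le_mul_of_nonneg_left ?_ hC.le
      linarith)
  have IN := foliation_le (F := F) hM hq hq2 hw hU hψ hT (by linarith : M ≤ R₀) hRb (H := heightN M R₀)
    (H' := fun r => 2 / lapse M r) dH (continuousOn_two_div_lapse hM hR₀)
    (fun t ht r hr => by rw [← pointN_eq]; exact hN t ht r hr.1) hχ hχ0 hχ1 hχ'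
    (err := fun t r => B * (((1 + t) ^ 2 + (1 + T) ^ (2 - q)) * (r ^ 3 * r ^ q * F (t + heightN M R₀ r, r) ^ 2))) (by
      refine continuousOn_const.mul (ContinuousOn.mul (by fun_prop)
        (ContinuousOn.mul (ContinuousOn.mul (by fun_prop) ?_) (cFN.pow 2)))
      exact ContinuousOn.rpow_const (by fun_prop) fun z hz => Or.inl (by have := hz.2.1; linarith))
    (by
      intro t ht r hr
      have hr0 : 0 < r := hR0.trans_le hr.1
      refine ⟨by positivity, ((hrate (1 + T) (1 + t) r _ _ _ _ (by linarith) (by linarith [ht.1])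
        (by linarith [ht.2])).2 hr.1).trans ?_⟩
      refine mul_le_mul_of_nonneg_right ?_ (by positivity)
      rw [hB]
      refine le_mul_of_one_le_right hC.le ?_
      have : 0 ≤ R₀ * R₀ ^ q + 1 / M ^ 2 := by positivity
      linarith)
  have hQ : ∀ r x, 0 < r → (∀ t ∈ Icc 0 T, (t + x, r) ∈ U) → IntervalIntegrable
      (fun t => χ (t + x) * jetRadial M q w (1 + T) ψ (1 + t) (t + x, r)) MeasureTheory.volume 0 T :=
    fun r x hr hp => ContinuousOn.intervalIntegrable (by
      rw [uIcc_of_le hT]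
      exact (hχ.continuous.comp_continuousOn (by fun_prop)).mul (continuousOn_jetRadial hM hU hψ w hT hr hp))
  have q1 := hQ R₀ R₀ hR0 fun t ht => (hS t ht R₀ ⟨by linarith, le_rfl⟩).1
  have q2 := hQ M M hM fun t ht => (hS t ht M ⟨le_rfl, by linarith⟩).1
  have b1 : ∫ t in (0 : ℝ)..T, χ (t + M) * jetRadial M q w (1 + T) ψ (1 + t) (t + M, M) ≤ 0 := by
    rw [← neg_nonneg, ← intervalIntegral.integral_neg]
    exact intervalIntegral.integral_nonneg hT fun t ht => neg_nonneg.2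
      (mul_nonpos_of_nonneg_of_nonpos (hχ0 _)
        (jetRadial_horizon_nonpos hM hq hq2 hw (by linarith [ht.1]) (by linarith [ht.2]) ψ rfl))
  have b2 : ∫ t in (0 : ℝ)..T, (χ (t + heightN M R₀ Rb)
        * jetRadial M q w (1 + T) ψ (1 + t) (t + heightN M R₀ Rb, Rb)
        - χ (t + heightN M R₀ R₀) * jetRadial M q w (1 + T) ψ (1 + t) (t + heightN M R₀ R₀, R₀))
      = -∫ t in (0 : ℝ)..T, χ (t + R₀) * jetRadial M q w (1 + T) ψ (1 + t) (t + R₀, R₀) := by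
    rw [← intervalIntegral.integral_neg]
    refine intervalIntegral.integral_congr fun t ht => ?_
    rw [uIcc_of_le hT] at ht
    simp only [hχb t ht, heightN_self, zero_mul, zero_sub]
  rw [intervalIntegral.integral_sub q1 q2] at IS
  rw [b2] at IN
  have e1 : ∫ t in (0 : ℝ)..T, ∫ r in M..R₀, B * (((1 + t) ^ 2 + (1 + T) ^ (2 - q)
      + 1 / kappaRate q (1 + T) (1 + t)) * (r ^ 2 * F (t + r, r) ^ 2))
      = B * ∫ t in (0 : ℝ)..T, ((1 + t) ^ 2 + (1 + T) ^ (2 - q) + 1 / kappaRate q (1 + T) (1 + t))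
        * sourceS M R₀ F t := by
    simp only [intervalIntegral.integral_const_mul, sourceS, pointS]
  have e2 : ∫ t in (0 : ℝ)..T, ∫ r in R₀..Rb, B * (((1 + t) ^ 2 + (1 + T) ^ (2 - q))
      * (r ^ 3 * r ^ q * F (t + heightN M R₀ r, r) ^ 2))
      = B * ∫ t in (0 : ℝ)..T, ((1 + t) ^ 2 + (1 + T) ^ (2 - q)) * sourceN M q R₀ Rb F t := by
    simp only [intervalIntegral.integral_const_mul, sourceN, pointN_eq]
  rw [e1] at IS
  rw [e2] at IN
  simp only [leafFlux, pointN_eq, pointS, mul_add B]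
  linarith

end

/-! ### Time integrals of the sources -/

noncomputable section

open Set

section

open MeasureTheory

theorem setLIntegral_Icc_ofReal {f : ℝ → ℝ} {c d : ℝ} (hcd : c ≤ d) (hf : ContinuousOn f (Icc c d))
    (h0 : ∀ r ∈ Icc c d, 0 ≤ f r) :
    ∫⁻ r in Icc c d, ENNReal.ofReal (f r) = ENNReal.ofReal (∫ r in c..d, f r) := by
  rw [intervalIntegral.integral_of_le hcd, ← integral_Icc_eq_integral_Ioc,
    ofReal_integral_eq_lintegral_ofReal (hf.integrableOn_compact isCompact_Icc)
      ((ae_restrict_iff' measurableSet_Icc).2 (ae_of_all _ h0))]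

theorem setLIntegral_Icc_Icc_ofReal {f : ℝ → ℝ → ℝ} {a b c d : ℝ} (hab : a ≤ b) (hcd : c ≤ d)
    (hf : ContinuousOn (Function.uncurry f) (Icc a b ×ˢ Icc c d))
    (h0 : ∀ t ∈ Icc a b, ∀ r ∈ Icc c d, 0 ≤ f t r) :
    ∫⁻ t in Icc a b, ∫⁻ r in Icc c d, ENNReal.ofReal (f t r)
      = ENNReal.ofReal (∫ t in a..b, ∫ r in c..d, f t r) := by
  rw [setLIntegral_congr_fun measurableSet_Icc
    fun t ht => setLIntegral_Icc_ofReal hcd (hf.slice_right ht) (h0 t ht)]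
  exact setLIntegral_Icc_ofReal hab (continuousOn_intervalIntegral_of_rectangle hcd hf)
    fun t ht => intervalIntegral.integral_nonneg hcd fun r hr => h0 t ht r hr

end

/-- The moment of order two of a density with decaying tails. -/
theorem integral_add_mul_le_of_tail {g : ℝ → ℝ} {T K q : ℝ} (hT : 0 ≤ T) (hK : 0 ≤ K)
    (hq2 : q < 2) (hg : ContinuousOn g (Icc 0 T))
    (h : ∀ s ∈ Ico 0 T, ∫ t in s..T, g t ≤ K * (1 + s) ^ (-q)) :
    ∫ t in (0 : ℝ)..T, ((1 + t) ^ 2 + (1 + T) ^ (2 - q)) * g t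
      ≤ (2 + 2 / (2 - q)) * K * (1 + T) ^ (2 - q) := by
  have hΛ : 0 ≤ (1 + T) ^ (2 - q) := Real.rpow_nonneg (by linarith) _
  have h1 := integral_sq_mul_le_of_tail hT hK hq2 hg h
  have i1 : IntervalIntegrable (fun t => (1 + t) ^ 2 * g t) MeasureTheory.volume 0 T :=
    ContinuousOn.intervalIntegrable (by rw [uIcc_of_le hT]; exact ContinuousOn.mul (by fun_prop) hg)
  have i2 : IntervalIntegrable (fun t => (1 + T) ^ (2 - q) * g t) MeasureTheory.volume 0 T :=
    ContinuousOn.intervalIntegrable (by rw [uIcc_of_le hT]; exact continuousOn_const.mul hg)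
  have h2 : ∫ t in (0 : ℝ)..T, g t ≤ K := by
    rcases hT.eq_or_lt with rfl | hT'
    · simpa using hK
    · simpa using h 0 ⟨le_rfl, hT'⟩
  simp only [add_mul]
  rw [intervalIntegral.integral_add i1 i2, intervalIntegral.integral_const_mul]
  have := mul_le_mul_of_nonneg_left h2 hΛ
  linarith

/-- 1/κ-rate is λ^(1−q/2)(1 + t)^(q/2)/(1 − q/2). Against (1 + t)^(−q) there remains (1 + t)^(−q/2),
whose integral has size λ^(1−q/2) because q < 2; the two powers multiply to λ^(2−q). -/
theorem integral_div_kappaRate_le {g : ℝ → ℝ} {T K q : ℝ} (hT : 0 ≤ T) (hK : 0 ≤ K)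
    (hq2 : q < 2) (hg : ContinuousOn g (Icc 0 T))
    (h : ∀ s ∈ Icc 0 T, g s ≤ K * (1 + s) ^ (-q)) :
    ∫ t in (0 : ℝ)..T, 1 / kappaRate q (1 + T) (1 + t) * g t
      ≤ 1 / (1 - q / 2) ^ 2 * K * (1 + T) ^ (2 - q) := by
  have hl : 0 < 1 + T := by linarith
  have hm : 0 < 1 - q / 2 := by linarith
  have hηc : ContinuousOn (fun t => 1 / kappaRate q (1 + T) (1 + t)) (Icc 0 T) :=
    continuousOn_const.div (continuousOn_kappaRate hl) fun t ht =>
      (kappaRate_pos hq2 hl (by linarith [ht.1])).ne'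
  have hc : ContinuousOn (fun t : ℝ => (1 + t) ^ (-(q / 2))) (Icc 0 T) :=
    ContinuousOn.rpow_const (by fun_prop) fun t ht => Or.inl (by linarith [ht.1])
  have hpt : ∀ t ∈ Icc 0 T, 1 / kappaRate q (1 + T) (1 + t) * g t
      ≤ K * (1 + T) ^ (1 - q / 2) / (1 - q / 2) * (1 + t) ^ (-(q / 2)) := by
    intro t ht
    have ht0 : 0 < 1 + t := by linarith [ht.1]
    have hη := kappaRate_pos hq2 hl ht0
    calc _ ≤ 1 / kappaRate q (1 + T) (1 + t) * (K * (1 + t) ^ (-q)) :=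
          mul_le_mul_of_nonneg_left (h t ht) (by positivity)
      _ = _ := by
        rw [kappaRate, Real.div_rpow ht0.le hl.le, Real.rpow_sub hl, Real.rpow_one, Real.rpow_neg hl.le,
          show -q = -(q / 2) + -(q / 2) by ring, Real.rpow_add ht0]
        have : 0 < (1 + t) ^ (-(q / 2)) := Real.rpow_pos_of_pos ht0 _
        have : 0 < (1 + T) ^ (q / 2) := Real.rpow_pos_of_pos hl _
        field_simp
  have hint : ∫ t in (0 : ℝ)..T, (1 + t) ^ (-(q / 2)) ≤ (1 + T) ^ (1 - q / 2) / (1 - q / 2) := by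
    have hd : ∀ t ∈ uIcc 0 T, HasDerivAt (fun t : ℝ => (1 + t) ^ (1 - q / 2) / (1 - q / 2))
        ((1 + t) ^ (-(q / 2))) t := by
      intro t ht
      rw [uIcc_of_le hT] at ht
      have := ((((hasDerivAt_id t).const_add 1).rpow_const (p := 1 - q / 2)
        (Or.inl (ne_of_gt (by simp only [id]; linarith [ht.1])))).div_const (1 - q / 2))
      refine this.congr_deriv ?_
      rw [show 1 - q / 2 - 1 = -(q / 2) by ring, id, one_mul, mul_div_cancel_left₀ _ hm.ne']
    rw [intervalIntegral.integral_eq_sub_of_hasDerivAt hd (by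
      rw [← uIcc_of_le hT] at hc; exact hc.intervalIntegrable), add_zero, Real.one_rpow]
    have : 0 ≤ 1 / (1 - q / 2) := by positivity
    linarith
  calc _ ≤ ∫ t in (0 : ℝ)..T, K * (1 + T) ^ (1 - q / 2) / (1 - q / 2) * (1 + t) ^ (-(q / 2)) := by
        refine intervalIntegral.integral_mono_on hT ?_ ?_ hpt
        · exact ContinuousOn.intervalIntegrable (by rw [uIcc_of_le hT]; exact hηc.mul hg)
        · exact ContinuousOn.intervalIntegrable (by rw [uIcc_of_le hT]; exact continuousOn_const.mul hc)
    _ = K * (1 + T) ^ (1 - q / 2) / (1 - q / 2) * ∫ t in (0 : ℝ)..T, (1 + t) ^ (-(q / 2)) :=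
        intervalIntegral.integral_const_mul _ _
    _ ≤ K * (1 + T) ^ (1 - q / 2) / (1 - q / 2) * ((1 + T) ^ (1 - q / 2) / (1 - q / 2)) := by
        refine mul_le_mul_of_nonneg_left hint ?_
        have := Real.rpow_nonneg hl.le (1 - q / 2)
        positivity
    _ = _ := by
        rw [show 2 - q = (1 - q / 2) + (1 - q / 2) by ring, Real.rpow_add hl]
        field_simp

/-- Total weight of the sources. -/
theorem source_integral_le {gS gN : ℝ → ℝ} {T K q : ℝ} (hT : 0 ≤ T) (hK : 0 ≤ K)
    (hq2 : q < 2) (cS : ContinuousOn gS (Icc 0 T)) (cN : ContinuousOn gN (Icc 0 T))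
    (h1 : ∀ s ∈ Icc 0 T, gS s ≤ K * (1 + s) ^ (-q))
    (h2 : ∀ s ∈ Ico 0 T, ∫ t in s..T, gS t ≤ K * (1 + s) ^ (-q))
    (h3 : ∀ s ∈ Ico 0 T, ∫ t in s..T, gN t ≤ K * (1 + s) ^ (-q)) :
    (∫ t in (0 : ℝ)..T, ((1 + t) ^ 2 + (1 + T) ^ (2 - q) + 1 / kappaRate q (1 + T) (1 + t)) * gS t)
      + (∫ t in (0 : ℝ)..T, ((1 + t) ^ 2 + (1 + T) ^ (2 - q)) * gN t)
      ≤ (4 + 4 / (2 - q) + 1 / (1 - q / 2) ^ 2) * (K * (1 + T) ^ (2 - q)) := by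
  have hl : 0 < 1 + T := by linarith
  have hηc : ContinuousOn (fun t => 1 / kappaRate q (1 + T) (1 + t)) (Icc 0 T) :=
    continuousOn_const.div (continuousOn_kappaRate hl) fun t ht =>
      (kappaRate_pos hq2 hl (by linarith [ht.1])).ne'
  have a1 := integral_add_mul_le_of_tail hT hK hq2 cS h2
  have a2 := integral_div_kappaRate_le hT hK hq2 cS h1
  have a3 := integral_add_mul_le_of_tail hT hK hq2 cN h3
  have e : ∫ t in (0 : ℝ)..T, ((1 + t) ^ 2 + (1 + T) ^ (2 - q) + 1 / kappaRate q (1 + T) (1 + t)) * gS t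
      = (∫ t in (0 : ℝ)..T, ((1 + t) ^ 2 + (1 + T) ^ (2 - q)) * gS t)
        + ∫ t in (0 : ℝ)..T, 1 / kappaRate q (1 + T) (1 + t) * gS t := by
    rw [← intervalIntegral.integral_add]
    · simp only [add_mul]
    · exact ContinuousOn.intervalIntegrable (by
        rw [uIcc_of_le hT]; exact ContinuousOn.mul (by fun_prop) cS)
    · exact ContinuousOn.intervalIntegrable (by rw [uIcc_of_le hT]; exact hηc.mul cS)
  rw [e]
  have : 4 / (2 - q) = 2 * (2 / (2 - q)) := by ring
  rw [this]
  linarith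

end

/-! ### Hardy inequalities on the initial leaf -/

noncomputable section

open Set

section

open MeasureTheory intervalIntegral

/-- Integrate the derivative of (r − a)f², which vanishes at a, and absorb half of f² by completing
the square. -/
theorem integral_sq_le_of_hasDerivAt {f f' : ℝ → ℝ} {a b : ℝ} (hab : a ≤ b)
    (hf : ∀ r ∈ Icc a b, HasDerivAt f (f' r) r) (cf' : ContinuousOn f' (Icc a b)) :
    ∫ r in a..b, f r ^ 2 ≤ 2 * (b - a) * f b ^ 2 + 4 * (b - a) ^ 2 * ∫ r in a..b, f' r ^ 2 := by
  have cf : ContinuousOn f (Icc a b) := fun r hr => (hf r hr).continuousAt.continuousWithinAt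
  have u := uIcc_of_le hab
  have hd : ∀ r ∈ uIcc a b, HasDerivAt (fun r => (r - a) * f r ^ 2)
      (f r ^ 2 + (r - a) * (2 * f r * f' r)) r := fun r hr => by
    have := ((hasDerivAt_id r).sub_const a).fun_mul ((hf r (u ▸ hr)).fun_pow 2)
    refine this.congr_deriv ?_
    simp only [id]; push_cast; ring
  have I {g : ℝ → ℝ} (hg : ContinuousOn g (Icc a b)) : IntervalIntegrable g volume a b :=
    (u ▸ hg : ContinuousOn g (uIcc a b)).intervalIntegrable
  have i1 := I (cf.pow 2)
  have i2 := I (cf'.pow 2)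
  have i0 : IntervalIntegrable (fun r => f r ^ 2 + (r - a) * (2 * f r * f' r)) volume a b :=
    I ((cf.pow 2).add (ContinuousOn.mul (by fun_prop) ((continuousOn_const.mul cf).mul cf')))
  have e := integral_eq_sub_of_hasDerivAt hd i0
  have h := integral_mono_on hab ((i1.const_mul (1 / 2)).sub (i2.const_mul (2 * (b - a) ^ 2))) i0
    fun r hr => by
      have h1 : (r - a) ^ 2 * f' r ^ 2 ≤ (b - a) ^ 2 * f' r ^ 2 := by
        gcongr
        · linarith [hr.1]
        · exact hr.2
      change 1 / 2 * f r ^ 2 - 2 * (b - a) ^ 2 * f' r ^ 2 ≤ _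
      nlinarith [sq_nonneg (f r + 2 * ((r - a) * f' r))]
  rw [e, intervalIntegral.integral_sub (i1.const_mul _) (i2.const_mul _),
    intervalIntegral.integral_const_mul, intervalIntegral.integral_const_mul] at h
  simp only [Pi.pow_apply] at h
  linarith

/-- The same with (r − b)f², which isolates the left endpoint: it carries the bound from N across
the sphere r = R₀ to S. -/
theorem mul_sq_left_le_of_hasDerivAt {f f' : ℝ → ℝ} {a b : ℝ} (hab : a ≤ b)
    (hf : ∀ r ∈ Icc a b, HasDerivAt f (f' r) r) (cf' : ContinuousOn f' (Icc a b)) :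
    (b - a) * f a ^ 2 ≤ 2 * (∫ r in a..b, f r ^ 2) + (b - a) ^ 2 * ∫ r in a..b, f' r ^ 2 := by
  have cf : ContinuousOn f (Icc a b) := fun r hr => (hf r hr).continuousAt.continuousWithinAt
  have u := uIcc_of_le hab
  have hd : ∀ r ∈ uIcc a b, HasDerivAt (fun r => (r - b) * f r ^ 2)
      (f r ^ 2 + (r - b) * (2 * f r * f' r)) r := fun r hr => by
    have := ((hasDerivAt_id r).sub_const b).fun_mul ((hf r (u ▸ hr)).fun_pow 2)
    refine this.congr_deriv ?_
    simp only [id]; push_cast; ring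
  have I {g : ℝ → ℝ} (hg : ContinuousOn g (Icc a b)) : IntervalIntegrable g volume a b :=
    (u ▸ hg : ContinuousOn g (uIcc a b)).intervalIntegrable
  have i1 := I (cf.pow 2)
  have i2 := I (cf'.pow 2)
  have i0 : IntervalIntegrable (fun r => f r ^ 2 + (r - b) * (2 * f r * f' r)) volume a b :=
    I ((cf.pow 2).add (ContinuousOn.mul (by fun_prop) ((continuousOn_const.mul cf).mul cf')))
  have e := integral_eq_sub_of_hasDerivAt hd i0
  have h := integral_mono_on hab i0 ((i1.const_mul 2).add (i2.const_mul ((b - a) ^ 2)))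
    fun r hr => by
      have h1 : (b - r) ^ 2 * f' r ^ 2 ≤ (b - a) ^ 2 * f' r ^ 2 := by
        gcongr
        · linarith [hr.2]
        · exact hr.1
      change _ ≤ 2 * f r ^ 2 + (b - a) ^ 2 * f' r ^ 2
      nlinarith [sq_nonneg (f r - ((r - b) * f' r))]
  rw [e, intervalIntegral.integral_add (i1.const_mul _) (i2.const_mul _),
    intervalIntegral.integral_const_mul, intervalIntegral.integral_const_mul] at h
  simp only [Pi.pow_apply] at h
  linarith

end

/-- Through a null curve the transversal derivative z has coefficient zero, so vanishing of ψ along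
the curve suffices, whatever z is. -/
theorem totalFlux_eq_zero {M q h r : ℝ} (w : Weights) (lam t z : ℝ) (hw : 1 - lapse M r / 2 * h = 0) :
    totalFlux M q w lam t h r 0 0 z = 0 := by
  simp only [totalFlux, fluxTwo, fluxOne, fluxZero, phiFlux, psiFlux, hw]
  ring

section

variable {M q R₀ : ℝ} {U : Set (ℝ × ℝ)} {ψ : ℝ × ℝ → ℝ}

theorem hasDerivAt_comp_foliation (hU : IsOpen U) (hψ : ContDiffOn ℝ 2 ψ U) {t r h : ℝ} {H : ℝ → ℝ}
    (hH : HasDerivAt H h r) (hp : (t + H r, r) ∈ U) :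
    HasDerivAt (fun s => ψ (t + H s, s)) (h * dT ψ (t + H r, r) + dY ψ (t + H r, r)) r := by
  have hd := ((hψ.contDiffAt (hU.mem_nhds hp)).differentiableAt (by simp)).hasFDerivAt
  have := HasFDerivAt.comp_hasDerivAt (f := fun s => (t + H s, s)) r hd
    ((hH.const_add t).prodMk (hasDerivAt_id r))
  rwa [fderiv_eq_dT_dY, one_mul] at this

theorem continuousOn_jetFlux (hM : 0 < M) (hU : IsOpen U) (hψ : ContDiffOn ℝ 2 ψ U) (w : Weights) {lam : ℝ}
    (hl : 0 < lam) (t : ℝ) {a b c d : ℝ} {H H' : ℝ → ℝ} (cH : ContinuousOn H (Icc c d))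
    (cH' : ContinuousOn H' (Icc c d)) (hc : 0 < c) (hpt : ∀ τ ∈ Icc a b, ∀ r ∈ Icc c d, (τ + H r, r) ∈ U)
    {τ : ℝ} (hτ : τ ∈ Icc a b) :
    ContinuousOn (fun r => jetFlux M q w lam ψ t (H' r) (τ + H r, r)) (Icc c d) := by
  have hR : (∅ : Set (ℝ × ℝ)) ⊆ U ∩ {p : ℝ × ℝ | 0 < p.2} := empty_subset _
  have hF : ∀ p ∈ (∅ : Set (ℝ × ℝ)), box M ψ p = (fun _ => (0 : ℝ)) p := fun p hp => hp.elim
  have comp {f : ℝ × ℝ → ℝ} (hf : ContDiffOn ℝ 1 f (U ∩ {p : ℝ × ℝ | 0 < p.2})) :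
      ContinuousOn (fun r => f (τ + H r, r)) (Icc c d) :=
    hf.continuousOn.comp ((continuousOn_const.add cH).prodMk continuousOn_id)
      fun r hr => ⟨hpt τ hτ r hr, hc.trans_le hr.1⟩
  have J0 := isCurrent_fluxZero hM q hU hψ hR hF
  have J1 := isCurrent_fluxOne hM q hU hψ hR hF w.C₁ w.ε₁ hl
  have J2 := isCurrent_fluxTwo hM q hU hψ hR hF w.C₂ w.ε₂ (lam ^ (2 - q))
  have c0 := (comp J0.1).sub (cH'.mul (comp J0.2))
  have c1 := (comp J1.1).sub (cH'.mul (comp J1.2))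
  have c2 := (comp J2.1).sub (cH'.mul (comp J2.2))
  refine (((continuousOn_const (c := w.A₂ * kappa q lam t)).mul c2).add
    (((continuousOn_const (c := w.A₁ * t)).mul c1).add ((continuousOn_const (c := t ^ 2)).mul c0))).congr
      fun r _ => ?_
  simp only [jetFlux, Pi.add_apply, Pi.mul_apply, Pi.sub_apply]
  rw [totalFlux_affine]
  simp only [totalFlux]
  ring

/-- Square integral of the first derivatives on `S_0`. -/
def dataS (M R₀ : ℝ) (ψ : ℝ × ℝ → ℝ) : ℝ :=
  ∫ r in M..R₀, r ^ 2 * (dY ψ (pointS 0 r) ^ 2 + dT ψ (pointS 0 r) ^ 2)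

/-- Square integral of the tangential derivative on the part of `N_0` inside `r ≤ R₁`. -/
def dataN (M R₀ R₁ : ℝ) (ψ : ℝ × ℝ → ℝ) : ℝ :=
  ∫ r in R₀..R₁, r ^ 2 * (2 / lapse M r) * psiL M ψ (pointN M R₀ 0 r) ^ 2

theorem two_div_lapse_le (hM : 0 < M) {r : ℝ} (hr : 2 * M ≤ r) : 2 / lapse M r ≤ 8 := by
  have := lapse_ge_quarter hM hr
  rw [div_le_iff₀ (by linarith)]; linarith

/-- The zeroth order terms on `Σ_0` are controlled by the first derivatives. -/
theorem exists_hardy (hM : 0 < M) (hR₀ : 2 * M < R₀) {R₁ : ℝ} (hR₁ : R₀ + 1 ≤ R₁) :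
    ∃ C, 0 < C ∧ ∀ (U : Set (ℝ × ℝ)) (ψ : ℝ × ℝ → ℝ), IsOpen U → ContDiffOn ℝ 2 ψ U →
      (∀ r ∈ Icc M R₀, pointS 0 r ∈ U) → (∀ r ∈ Icc R₀ R₁, pointN M R₀ 0 r ∈ U) →
      ψ (pointN M R₀ 0 R₁) = 0 →
      (∫ r in M..R₀, ψ (pointS 0 r) ^ 2) + (∫ r in R₀..R₁, ψ (pointN M R₀ 0 r) ^ 2)
        ≤ C * (dataS M R₀ ψ + dataN M R₀ R₁ ψ) := by
  have hR0 : 0 < R₀ := by linarith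
  refine ⟨8 * R₀ ^ 2 / M ^ 2 + 32 * R₁ ^ 2 / R₀ ^ 2 + 2 * R₀ * (72 * R₁ ^ 2 / R₀ ^ 2), by positivity, ?_⟩
  intro U ψ hU hψ hS hN h0
  have dN : ∀ r ∈ Icc R₀ R₁, HasDerivAt (fun s => ψ (pointN M R₀ 0 s))
      (2 / lapse M r * psiL M ψ (pointN M R₀ 0 r)) r := fun r hr => by
    have hp := hN r hr
    have hD := lapse_ge_quarter hM (r := r) (by linarith [hr.1])
    have hD' : lapse M r ≠ 0 := by linarith
    simp only [pointN_eq] at hp ⊢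
    refine (hasDerivAt_comp_foliation hU hψ (hasDerivAt_heightN hM (by linarith [hr.1])) hp).congr_deriv ?_
    rw [psiL]; field_simp
  have dS : ∀ r ∈ Icc M R₀, HasDerivAt (fun s => ψ (pointS 0 s))
      (dT ψ (pointS 0 r) + dY ψ (pointS 0 r)) r := fun r hr => by
    have := hasDerivAt_comp_foliation hU hψ (H := fun r => r) (hasDerivAt_id r) (hS r hr)
    rwa [one_mul] at this
  have cH : ContinuousOn (heightN M R₀) (Icc R₀ R₁) := fun r hr =>
    (hasDerivAt_heightN hM (by linarith [hr.1])).continuousAt.continuousWithinAt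
  have cl : ContinuousOn (fun r => psiL M ψ (pointN M R₀ 0 r)) (Icc R₀ R₁) := by
    simp only [pointN_eq]
    exact (contDiffOn_psiL hU hψ).continuousOn.comp ((continuousOn_const.add cH).prodMk continuousOn_id)
      fun r hr => ⟨by simpa only [pointN_eq] using hN r hr, hR0.trans_le hr.1⟩
  have cT : ContinuousOn (fun r => dT ψ (pointS 0 r)) (Icc M R₀) :=
    (contDiffOn_dT hU hψ (m := 1) (by norm_num)).continuousOn.comp
      (by unfold pointS; fun_prop) hS
  have cY : ContinuousOn (fun r => dY ψ (pointS 0 r)) (Icc M R₀) :=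
    (contDiffOn_dY hU hψ (m := 1) (by norm_num)).continuousOn.comp
      (by unfold pointS; fun_prop) hS
  have cD := continuousOn_two_div_lapse (d := R₁) hM hR₀
  have hRR : R₀ ≤ R₁ := by linarith
  have hMR : M ≤ R₀ := by linarith
  -- Chain of estimates: ψ = 0 at R₁ bounds ψ on N, this bounds the value at R₀, and that value
  -- serves as endpoint term on S.
  have n1 := integral_sq_le_of_hasDerivAt hRR dN (cD.mul cl)
  have n2 := mul_sq_left_le_of_hasDerivAt hRR dN (cD.mul cl)
  have s1 := integral_sq_le_of_hasDerivAt hMR dS (cT.add cY)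
  have e0 : pointN M R₀ 0 R₀ = pointS 0 R₀ := by rw [pointN_eq, heightN_self, pointS]
  have I {a b : ℝ} (hab : a ≤ b) {g : ℝ → ℝ} (hg : ContinuousOn g (Icc a b)) :
      IntervalIntegrable g MeasureTheory.volume a b :=
    ContinuousOn.intervalIntegrable (by rwa [uIcc_of_le hab])
  have m1 : ∫ r in R₀..R₁, (2 / lapse M r * psiL M ψ (pointN M R₀ 0 r)) ^ 2
      ≤ 8 / R₀ ^ 2 * dataN M R₀ R₁ ψ := by
    rw [dataN, ← intervalIntegral.integral_const_mul]
    refine intervalIntegral.integral_mono_on hRR (I hRR ((cD.mul cl).pow 2))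
      (I hRR (continuousOn_const.mul ((ContinuousOn.mul (by fun_prop) cD).mul (cl.pow 2)))) fun r hr => ?_
    have hD := lapse_ge_quarter hM (r := r) (by linarith [hr.1])
    have h8 := two_div_lapse_le hM (r := r) (by linarith [hr.1])
    have hr1 := hr.1
    have h1 : 1 ≤ r ^ 2 / R₀ ^ 2 := by
      rw [one_le_div (by positivity)]; exact pow_le_pow_left₀ hR0.le hr.1 2
    calc _ = 2 / lapse M r * (2 / lapse M r) * 1 * psiL M ψ (pointN M R₀ 0 r) ^ 2 := by ring
      _ ≤ 8 * (2 / lapse M r) * (r ^ 2 / R₀ ^ 2) * psiL M ψ (pointN M R₀ 0 r) ^ 2 := by gcongr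
      _ = _ := by ring
  have m2 : ∫ r in M..R₀, (dT ψ (pointS 0 r) + dY ψ (pointS 0 r)) ^ 2 ≤ 2 / M ^ 2 * dataS M R₀ ψ := by
    rw [dataS, ← intervalIntegral.integral_const_mul]
    refine intervalIntegral.integral_mono_on hMR (I hMR ((cT.add cY).pow 2))
      (I hMR (continuousOn_const.mul (ContinuousOn.mul (by fun_prop) ((cY.pow 2).add (cT.pow 2))))) fun r hr => ?_
    have h1 : 1 ≤ r ^ 2 / M ^ 2 := by
      rw [one_le_div (by positivity)]; exact pow_le_pow_left₀ hM.le hr.1 2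
    calc _ ≤ 2 * 1 * (dY ψ (pointS 0 r) ^ 2 + dT ψ (pointS 0 r) ^ 2) := by
          linarith [sq_nonneg (dT ψ (pointS 0 r) - dY ψ (pointS 0 r))]
      _ ≤ 2 * (r ^ 2 / M ^ 2) * (dY ψ (pointS 0 r) ^ 2 + dT ψ (pointS 0 r) ^ 2) := by gcongr
      _ = _ := by ring
  rw [e0] at n2
  rw [h0] at n1
  have pN : 0 ≤ dataN M R₀ R₁ ψ := intervalIntegral.integral_nonneg hRR fun r hr => by
    have := lapse_nonneg M r
    positivity
  have pS : 0 ≤ dataS M R₀ ψ := intervalIntegral.integral_nonneg hMR fun r hr => by positivity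
  have q1 : (R₁ - R₀) ^ 2 ≤ R₁ ^ 2 := pow_le_pow_left₀ (by linarith) (by linarith) 2
  have q2 : (R₀ - M) ^ 2 ≤ R₀ ^ 2 := pow_le_pow_left₀ (by linarith) (by linarith) 2
  generalize hIN : ∫ r in R₀..R₁, (2 / lapse M r * psiL M ψ (pointN M R₀ 0 r)) ^ 2 = IN at *
  generalize hIS : ∫ r in M..R₀, (dT ψ (pointS 0 r) + dY ψ (pointS 0 r)) ^ 2 = IS at *
  have pIN : 0 ≤ IN := hIN ▸ intervalIntegral.integral_nonneg hRR fun r _ => sq_nonneg _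
  have pIS : 0 ≤ IS := hIS ▸ intervalIntegral.integral_nonneg hMR fun r _ => sq_nonneg _
  generalize (∫ r in R₀..R₁, ψ (pointN M R₀ 0 r) ^ 2) = JN at *
  generalize (∫ r in M..R₀, ψ (pointS 0 r) ^ 2) = JS at *
  generalize ψ (pointS 0 R₀) = v at *
  generalize dataN M R₀ R₁ ψ = EN at *
  generalize dataS M R₀ ψ = ES at *
  have k1 : JN ≤ 4 * R₁ ^ 2 * IN := by
    have := mul_le_mul_of_nonneg_right q1 pIN
    linarith
  have k2 : v ^ 2 ≤ 9 * R₁ ^ 2 * IN := by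
    have a1 := mul_le_mul_of_nonneg_right q1 pIN
    have a2 : 1 * v ^ 2 ≤ (R₁ - R₀) * v ^ 2 := by gcongr; linarith
    linarith
  have k3 : JS ≤ 2 * R₀ * v ^ 2 + 4 * R₀ ^ 2 * IS := by
    have a1 := mul_le_mul_of_nonneg_right q2 pIS
    have a2 : (R₀ - M) * v ^ 2 ≤ R₀ * v ^ 2 := by gcongr; linarith
    linarith
  have k4 := mul_le_mul_of_nonneg_left k2 (by positivity : 0 ≤ 2 * R₀)
  have k5 := mul_le_mul_of_nonneg_left m1 (by positivity : 0 ≤ 4 * R₁ ^ 2 + 2 * R₀ * (9 * R₁ ^ 2))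
  have k6 := mul_le_mul_of_nonneg_left m2 (by positivity : 0 ≤ 4 * R₀ ^ 2)
  have k7 : JS + JN ≤ 8 * R₀ ^ 2 / M ^ 2 * ES + (32 * R₁ ^ 2 / R₀ ^ 2 + 2 * R₀ * (72 * R₁ ^ 2 / R₀ ^ 2)) * EN := by
    have e1 : 4 * R₀ ^ 2 * (2 / M ^ 2 * ES) = 8 * R₀ ^ 2 / M ^ 2 * ES := by ring
    have e2 : (4 * R₁ ^ 2 + 2 * R₀ * (9 * R₁ ^ 2)) * (8 / R₀ ^ 2 * EN)
      = (32 * R₁ ^ 2 / R₀ ^ 2 + 2 * R₀ * (72 * R₁ ^ 2 / R₀ ^ 2)) * EN := by ring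
    linarith
  have p1 : 0 ≤ 8 * R₀ ^ 2 / M ^ 2 * EN := by positivity
  have p2 : 0 ≤ (32 * R₁ ^ 2 / R₀ ^ 2 + 2 * R₀ * (72 * R₁ ^ 2 / R₀ ^ 2)) * ES := by positivity
  linarith

end

end

/-! ### The weighted flux through the initial leaf -/

noncomputable section

open Set

section

variable {M q R₀ : ℝ} {U : Set (ℝ × ℝ)} {ψ : ℝ × ℝ → ℝ}

theorem phiL_eq (M : ℝ) (ψ : ℝ × ℝ → ℝ) (p : ℝ × ℝ) :
    phiL M ψ p = p.2 * psiL M ψ p + lapse M p.2 / 2 * ψ p := rfl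

theorem phiL_sq_le (hM : 0 < M) {p : ℝ × ℝ} (hp : M ≤ p.2) :
    phiL M ψ p ^ 2 ≤ 2 * (p.2 ^ 2 * psiL M ψ p ^ 2) + ψ p ^ 2 := by
  have h0 := lapse_nonneg M p.2
  have h1 := lapse_le_one hM hp
  rw [phiL_eq]
  have : (lapse M p.2 / 2 * ψ p) ^ 2 ≤ 1 / 4 * ψ p ^ 2 := by
    calc _ = (lapse M p.2 / 2) ^ 2 * ψ p ^ 2 := by ring
      _ ≤ _ := by gcongr; nlinarith
  nlinarith [sq_nonneg (p.2 * psiL M ψ p - lapse M p.2 / 2 * ψ p), sq_nonneg (ψ p)]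

theorem psiL_sq_le (hM : 0 < M) {p : ℝ × ℝ} (hp : M ≤ p.2) :
    psiL M ψ p ^ 2 ≤ 2 * (dY ψ p ^ 2 + dT ψ p ^ 2) := by
  have h0 := lapse_nonneg M p.2
  have h1 := lapse_le_one hM hp
  rw [psiL]
  have : (lapse M p.2 / 2 * dY ψ p) ^ 2 ≤ 1 / 4 * dY ψ p ^ 2 := by
    calc _ = (lapse M p.2 / 2) ^ 2 * dY ψ p ^ 2 := by ring
      _ ≤ _ := by gcongr; nlinarith
  nlinarith [sq_nonneg (dT ψ p - lapse M p.2 / 2 * dY ψ p), sq_nonneg (dY ψ p)]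

/-- The flux beyond the support vanishes, and for r ≤ R₁ the only large weight is λ^(2−q). The
zeroth order terms are removed with `exists_hardy`. -/
theorem exists_leafFlux_zero_le (hM : 0 < M) (hR₀ : 2 * M < R₀) (hq : 0 < q) (hq2 : q < 2) {w : Weights}
    (hw : w.Pos) {Rs R₁ : ℝ} (hRs : Rs < R₁) (hR₁ : R₀ + 1 ≤ R₁) :
    ∃ C, 0 < C ∧ ∀ (U : Set (ℝ × ℝ)) (ψ : ℝ × ℝ → ℝ) (lam Rb : ℝ) (χ : ℝ → ℝ), IsOpen U →
      ContDiffOn ℝ 2 ψ U → (∀ r ∈ Icc M R₀, pointS 0 r ∈ U) → (∀ r ∈ Ici R₀, pointN M R₀ 0 r ∈ U) →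
      (∀ r ∈ Ici R₀, Rs < r → ψ (pointN M R₀ 0 r) = 0) → 1 ≤ lam → R₁ ≤ Rb → Continuous χ →
      (∀ v, 0 ≤ χ v) → (∀ v, χ v ≤ 1) →
      leafFlux M q R₀ Rb w lam ψ χ 0 ≤ C * (lam ^ (2 - q) * (dataS M R₀ ψ + dataN M R₀ R₁ ψ)) := by
  have hR0 : 0 < R₀ := by linarith
  obtain ⟨K, hK, hflux⟩ := exists_totalFlux_one_le hM hq hq2 hw (R := R₁) (by linarith)
  obtain ⟨B, hB, hardy⟩ := exists_hardy hM hR₀ hR₁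
  refine ⟨K * (6 + 4 * B), by positivity, ?_⟩
  intro U ψ lam Rb χ hU hψ hS hN hsupp hl hRb cχ hχ0 hχ1
  have hl0 : 0 < lam := by linarith
  have hΛ : 0 < lam ^ (2 - q) := Real.rpow_pos_of_pos hl0 _
  have hRR : R₀ ≤ R₁ := by linarith
  have hMR : M ≤ R₀ := by linarith
  have hH := hardy U ψ hU hψ hS (fun r hr => hN r hr.1) (hsupp R₁ hRR hRs)
  have dH : ∀ {r}, R₀ ≤ r → HasDerivAt (heightN M R₀) (2 / lapse M r) r := fun hr =>
    hasDerivAt_heightN hM (by linarith)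
  have cH : ∀ d, ContinuousOn (heightN M R₀) (Icc R₀ d) := fun d r hr =>
    (dH hr.1).continuousAt.continuousWithinAt
  have cl : ContinuousOn (fun r => psiL M ψ (pointN M R₀ 0 r)) (Icc R₀ R₁) := by
    simp only [pointN_eq]
    exact (contDiffOn_psiL hU hψ).continuousOn.comp ((continuousOn_const.add (cH R₁)).prodMk continuousOn_id)
      fun r hr => ⟨by simpa only [pointN_eq] using hN r hr.1, hR0.trans_le hr.1⟩
  have cψN : ContinuousOn (fun r => ψ (pointN M R₀ 0 r)) (Icc R₀ R₁) := by
    simp only [pointN_eq]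
    exact hψ.continuousOn.comp ((continuousOn_const.add (cH R₁)).prodMk continuousOn_id)
      fun r hr => by simpa only [pointN_eq] using hN r hr.1
  have cT : ContinuousOn (fun r => dT ψ (pointS 0 r)) (Icc M R₀) :=
    (contDiffOn_dT hU hψ (m := 1) (by norm_num)).continuousOn.comp (by unfold pointS; fun_prop) hS
  have cY : ContinuousOn (fun r => dY ψ (pointS 0 r)) (Icc M R₀) :=
    (contDiffOn_dY hU hψ (m := 1) (by norm_num)).continuousOn.comp (by unfold pointS; fun_prop) hS
  have cψS : ContinuousOn (fun r => ψ (pointS 0 r)) (Icc M R₀) :=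
    hψ.continuousOn.comp (by unfold pointS; fun_prop) hS
  have cD : ∀ d, ContinuousOn (fun r => 2 / lapse M r) (Icc R₀ d) := fun d =>
    continuousOn_two_div_lapse hM hR₀
  have I {a b : ℝ} (hab : a ≤ b) {g : ℝ → ℝ} (hg : ContinuousOn g (Icc a b)) :
      IntervalIntegrable g MeasureTheory.volume a b :=
    ContinuousOn.intervalIntegrable (by rwa [uIcc_of_le hab])
  have h00 : (0 : ℝ) ∈ Icc (0 : ℝ) 0 := ⟨le_rfl, le_rfl⟩
  have cjS := continuousOn_jetFlux (q := q) hM hU hψ w hl0 (1 + 0) (H := fun r => r) (H' := fun _ => 1)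
    (continuousOn_id (s := Icc M R₀)) continuousOn_const hM
    (fun τ (hτ : τ ∈ Icc (0 : ℝ) 0) r hr => by rw [le_antisymm hτ.2 hτ.1]; exact hS r hr) h00
  have cjN : ∀ d, ContinuousOn (fun r => jetFlux M q w lam ψ (1 + 0) (2 / lapse M r) (0 + heightN M R₀ r, r))
      (Icc R₀ d) := fun d => continuousOn_jetFlux hM hU hψ w hl0 (1 + 0) (cH d) (cD d) hR0
    (fun τ (hτ : τ ∈ Icc (0 : ℝ) 0) r hr => by
      rw [le_antisymm hτ.2 hτ.1, ← pointN_eq]; exact hN r hr.1) h00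
  have iN : ∀ {c d}, R₀ ≤ c → c ≤ d → IntervalIntegrable (fun r => χ (0 + heightN M R₀ r)
      * jetFlux M q w lam ψ (1 + 0) (2 / lapse M r) (pointN M R₀ 0 r)) MeasureTheory.volume c d := by
    intro c d hc hcd
    simp only [pointN_eq]
    exact I hcd (((cχ.comp_continuousOn (continuousOn_const.add (cH d))).mul (cjN d)).mono
      (Icc_subset_Icc_left hc))
  have aS : ∫ r in M..R₀, χ (0 + r) * jetFlux M q w lam ψ (1 + 0) 1 (pointS 0 r)
      ≤ K * lam ^ (2 - q) * (6 * dataS M R₀ ψ + 4 * ∫ r in M..R₀, ψ (pointS 0 r) ^ 2) := by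
    rw [dataS, ← intervalIntegral.integral_const_mul, ← intervalIntegral.integral_const_mul,
      ← intervalIntegral.integral_add, ← intervalIntegral.integral_const_mul]
    · refine intervalIntegral.integral_mono_on hMR ?_ ?_ fun r hr => ?_
      · exact I hMR ((cχ.comp_continuousOn (by fun_prop)).mul cjS)
      · exact I hMR (continuousOn_const.mul ((continuousOn_const.mul (ContinuousOn.mul (by fun_prop)
          ((cY.pow 2).add (cT.pow 2)))).add (continuousOn_const.mul (cψS.pow 2))))
      · have hp : M ≤ (pointS 0 r).2 := hr.1
        have b := hflux lam 1 r (ψ (pointS 0 r)) (phiL M ψ (pointS 0 r)) (phiY ψ (pointS 0 r)) hl hr.1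
          (hr.2.trans hRR) zero_le_one (by norm_num) (by linarith [lapse_le_one hM hr.1])
        have hw0 : 0 ≤ 1 - lapse M r / 2 * 1 := by linarith [lapse_le_one hM hr.1]
        have hw1 : 1 - lapse M r / 2 * 1 ≤ 1 := by linarith [lapse_nonneg M r]
        have l1 := phiL_sq_le (ψ := ψ) hM hp
        have l2 := psiL_sq_le (ψ := ψ) hM hp
        have l3 : phiY ψ (pointS 0 r) ^ 2 ≤ 2 * (r ^ 2 * dY ψ (pointS 0 r) ^ 2) + 2 * ψ (pointS 0 r) ^ 2 := by
          change (r * dY ψ (pointS 0 r) + ψ (pointS 0 r)) ^ 2 ≤ _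
          linarith [sq_nonneg (r * dY ψ (pointS 0 r) - ψ (pointS 0 r))]
        have l4 : (1 - lapse M r / 2 * 1) * phiY ψ (pointS 0 r) ^ 2 ≤ 1 * phiY ψ (pointS 0 r) ^ 2 := by gcongr
        have l5 : r ^ 2 * psiL M ψ (pointS 0 r) ^ 2 ≤ r ^ 2 * (2 * (dY ψ (pointS 0 r) ^ 2 + dT ψ (pointS 0 r) ^ 2)) := by
          gcongr
        change phiL M ψ (pointS 0 r) ^ 2 ≤ 2 * (r ^ 2 * psiL M ψ (pointS 0 r) ^ 2) + ψ (pointS 0 r) ^ 2 at l1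
        have l6 : phiL M ψ (pointS 0 r) ^ 2 + (1 - lapse M r / 2 * 1) * phiY ψ (pointS 0 r) ^ 2
            + ψ (pointS 0 r) ^ 2 ≤ 6 * (r ^ 2 * (dY ψ (pointS 0 r) ^ 2 + dT ψ (pointS 0 r) ^ 2))
            + 4 * ψ (pointS 0 r) ^ 2 := by
          have : 0 ≤ r ^ 2 * dT ψ (pointS 0 r) ^ 2 := by positivity
          linarith
        have l7 : jetFlux M q w lam ψ (1 + 0) 1 (pointS 0 r) ≤ K * lam ^ (2 - q)
            * (6 * (r ^ 2 * (dY ψ (pointS 0 r) ^ 2 + dT ψ (pointS 0 r) ^ 2)) + 4 * ψ (pointS 0 r) ^ 2) := by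
          rw [add_zero]
          exact b.trans (mul_le_mul_of_nonneg_left l6 (by positivity))
        calc _ ≤ χ (0 + r) * (K * lam ^ (2 - q)
              * (6 * (r ^ 2 * (dY ψ (pointS 0 r) ^ 2 + dT ψ (pointS 0 r) ^ 2)) + 4 * ψ (pointS 0 r) ^ 2)) :=
              mul_le_mul_of_nonneg_left l7 (hχ0 _)
          _ ≤ 1 * _ := mul_le_mul_of_nonneg_right (hχ1 _) (by positivity)
          _ = _ := one_mul _
    · exact I hMR (continuousOn_const.mul (ContinuousOn.mul (by fun_prop) ((cY.pow 2).add (cT.pow 2))))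
    · exact I hMR (continuousOn_const.mul (cψS.pow 2))
  have aN : ∫ r in R₀..R₁, χ (0 + heightN M R₀ r) * jetFlux M q w lam ψ (1 + 0) (2 / lapse M r) (pointN M R₀ 0 r)
      ≤ K * lam ^ (2 - q) * (2 * dataN M R₀ R₁ ψ + 2 * ∫ r in R₀..R₁, ψ (pointN M R₀ 0 r) ^ 2) := by
    rw [dataN, ← intervalIntegral.integral_const_mul, ← intervalIntegral.integral_const_mul,
      ← intervalIntegral.integral_add, ← intervalIntegral.integral_const_mul]
    · refine intervalIntegral.integral_mono_on hRR (iN le_rfl hRR) ?_ fun r hr => ?_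
      · exact I hRR (continuousOn_const.mul ((continuousOn_const.mul ((ContinuousOn.mul (by fun_prop)
          (cD R₁)).mul (cl.pow 2))).add (continuousOn_const.mul (cψN.pow 2))))
      · have hr2 : 2 * M ≤ r := by linarith [hr.1]
        have hp : M ≤ (pointN M R₀ 0 r).2 := hMR.trans hr.1
        have hD := lapse_ge_quarter hM hr2
        have hDh := lapse_mul_two_div hM hr2
        have hD1 := lapse_le_one hM (r := r) (hMR.trans hr.1)
        have h8 := two_div_lapse_le hM hr2
        have b := hflux lam (2 / lapse M r) r (ψ (pointN M R₀ 0 r)) (phiL M ψ (pointN M R₀ 0 r))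
          (phiY ψ (pointN M R₀ 0 r)) hl (hMR.trans hr.1) hr.2 (by positivity) h8 hDh.le
        rw [show 1 - lapse M r / 2 * (2 / lapse M r) = 0 by linarith, zero_mul, add_zero] at b
        have l1 := phiL_sq_le (ψ := ψ) hM hp
        change phiL M ψ (pointN M R₀ 0 r) ^ 2 ≤ 2 * (r ^ 2 * psiL M ψ (pointN M R₀ 0 r) ^ 2)
          + ψ (pointN M R₀ 0 r) ^ 2 at l1
        have l2 : 1 ≤ 2 / lapse M r := by rw [one_le_div (by linarith)]; linarith
        have l3 : r ^ 2 * 1 * psiL M ψ (pointN M R₀ 0 r) ^ 2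
            ≤ r ^ 2 * (2 / lapse M r) * psiL M ψ (pointN M R₀ 0 r) ^ 2 := by gcongr
        have l6 : phiL M ψ (pointN M R₀ 0 r) ^ 2 + ψ (pointN M R₀ 0 r) ^ 2
            ≤ 2 * (r ^ 2 * (2 / lapse M r) * psiL M ψ (pointN M R₀ 0 r) ^ 2) + 2 * ψ (pointN M R₀ 0 r) ^ 2 := by
          linarith
        have l7 : jetFlux M q w lam ψ (1 + 0) (2 / lapse M r) (pointN M R₀ 0 r) ≤ K * lam ^ (2 - q)
            * (2 * (r ^ 2 * (2 / lapse M r) * psiL M ψ (pointN M R₀ 0 r) ^ 2) + 2 * ψ (pointN M R₀ 0 r) ^ 2) := by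
          rw [add_zero]
          exact b.trans (mul_le_mul_of_nonneg_left l6 (by positivity))
        calc _ ≤ χ (0 + heightN M R₀ r) * (K * lam ^ (2 - q)
              * (2 * (r ^ 2 * (2 / lapse M r) * psiL M ψ (pointN M R₀ 0 r) ^ 2) + 2 * ψ (pointN M R₀ 0 r) ^ 2)) :=
              mul_le_mul_of_nonneg_left l7 (hχ0 _)
          _ ≤ 1 * _ := mul_le_mul_of_nonneg_right (hχ1 _) (by positivity)
          _ = _ := one_mul _
    · exact I hRR (continuousOn_const.mul ((ContinuousOn.mul (by fun_prop) (cD R₁)).mul (cl.pow 2)))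
    · exact I hRR (continuousOn_const.mul (cψN.pow 2))
  -- Beyond the support ψ vanishes along an open piece of the cone, hence so does its tangential
  -- derivative Lψ; nothing is claimed about Yψ.
  have zN : ∫ r in R₁..Rb, χ (0 + heightN M R₀ r) * jetFlux M q w lam ψ (1 + 0) (2 / lapse M r) (pointN M R₀ 0 r)
      = 0 := by
    refine (intervalIntegral.integral_congr (g := fun _ => 0) fun r hr => ?_).trans
      intervalIntegral.integral_zero
    rw [uIcc_of_le hRb] at hr
    have hrR : R₀ < r := by linarith [hr.1]
    have hr2 : 2 * M ≤ r := by linarith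
    have hD := lapse_ge_quarter hM hr2
    have hDh := lapse_mul_two_div hM hr2
    have v0 := hsupp r hrR.le (hRs.trans_le hr.1)
    have d1 := hasDerivAt_comp_foliation (t := 0) hU hψ (dH hrR.le) (by rw [← pointN_eq]; exact hN r hrR.le)
    have d2 : HasDerivAt (fun s => ψ (0 + heightN M R₀ s, s)) 0 r := by
      refine (hasDerivAt_const r (0 : ℝ)).congr_of_eventuallyEq ?_
      filter_upwards [Ioi_mem_nhds hrR, Ioi_mem_nhds (hRs.trans_le hr.1)] with s h1 h2
      rw [← pointN_eq]; exact hsupp s (mem_Ici.2 (le_of_lt h1)) h2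
    have e := d1.unique d2
    rw [← pointN_eq] at e
    have l0 : psiL M ψ (pointN M R₀ 0 r) = 0 := by
      have : psiL M ψ (pointN M R₀ 0 r) = lapse M r / 2 * (2 / lapse M r * dT ψ (pointN M R₀ 0 r)
          + dY ψ (pointN M R₀ 0 r)) := by
        change dT ψ (pointN M R₀ 0 r) + lapse M r / 2 * dY ψ (pointN M R₀ 0 r) = _
        linear_combination (-(1 / 2) * dT ψ (pointN M R₀ 0 r)) * hDh
      rw [this, e, mul_zero]
    have p0 : phiL M ψ (pointN M R₀ 0 r) = 0 := by rw [phiL_eq, l0, v0]; ring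
    simp only [jetFlux, p0, v0]
    rw [totalFlux_eq_zero w lam (1 + 0) _ (by change 1 - lapse M r / 2 * (2 / lapse M r) = 0; linarith), mul_zero]
  have pN : 0 ≤ dataN M R₀ R₁ ψ := intervalIntegral.integral_nonneg hRR fun r hr => by
    have := lapse_nonneg M r
    positivity
  have pS : 0 ≤ dataS M R₀ ψ := intervalIntegral.integral_nonneg hMR fun r hr => by positivity
  have pJN : 0 ≤ ∫ r in R₀..R₁, ψ (pointN M R₀ 0 r) ^ 2 :=
    intervalIntegral.integral_nonneg hRR fun r _ => sq_nonneg _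
  rw [leafFlux, ← intervalIntegral.integral_add_adjacent_intervals (iN le_rfl hRR) (iN hRR hRb), zN]
  have h : K * lam ^ (2 - q) * (6 * dataS M R₀ ψ + 4 * (∫ r in M..R₀, ψ (pointS 0 r) ^ 2))
        + K * lam ^ (2 - q) * (2 * dataN M R₀ R₁ ψ + 2 * ∫ r in R₀..R₁, ψ (pointN M R₀ 0 r) ^ 2)
      ≤ K * (6 + 4 * B) * (lam ^ (2 - q) * (dataS M R₀ ψ + dataN M R₀ R₁ ψ)) := by
    rw [← mul_add]
    calc _ ≤ K * lam ^ (2 - q) * ((6 + 4 * B) * (dataS M R₀ ψ + dataN M R₀ R₁ ψ)) :=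
          mul_le_mul_of_nonneg_left (by linarith) (by positivity)
      _ = _ := by ring
  refine le_trans (le_of_eq ?_) ((add_le_add aS aN).trans h)
  ring

end

end

/-! ### From the flux of rψ to the energy of ψ -/

noncomputable section

open Set

/-- The energy density of `ψ` along a curve of slope `h`. -/
def energyDensity (M : ℝ) (ψ : ℝ × ℝ → ℝ) (h : ℝ) (p : ℝ × ℝ) : ℝ :=
  p.2 ^ 2 * (h * psiL M ψ p ^ 2 + lapse M p.2 / 2 * (1 - lapse M p.2 / 2 * h) * dY ψ p ^ 2)

section

variable {M q R₀ : ℝ} {U : Set (ℝ × ℝ)} {ψ : ℝ × ℝ → ℝ}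

/-- The energy of `ψ` and the flux of `rψ` differ by a boundary term. -/
theorem integral_energyDensity (hM : 0 < M) (hU : IsOpen U) (hψ : ContDiffOn ℝ 2 ψ U) {t c d : ℝ}
    {H H' : ℝ → ℝ} (hc : M ≤ c) (hcd : c ≤ d) (hH : ∀ r ∈ Icc c d, HasDerivAt H (H' r) r)
    (cH' : ContinuousOn H' (Icc c d)) (hpt : ∀ r ∈ Icc c d, (t + H r, r) ∈ U) :
    ContinuousOn (fun r => energyDensity M ψ (H' r) (t + H r, r)) (Icc c d) ∧
    ContinuousOn (fun r => fluxT M (H' r) r (ψ (t + H r, r)) (phiL M ψ (t + H r, r)) (phiY ψ (t + H r, r)))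
      (Icc c d) ∧
    ∫ r in c..d, energyDensity M ψ (H' r) (t + H r, r)
      = (∫ r in c..d, fluxT M (H' r) r (ψ (t + H r, r)) (phiL M ψ (t + H r, r)) (phiY ψ (t + H r, r)))
        - (lapse M d / 2 * d * ψ (t + H d, d) ^ 2 - lapse M c / 2 * c * ψ (t + H c, c) ^ 2) := by
  have hc0 : 0 < c := hM.trans_le hc
  have cH : ContinuousOn H (Icc c d) := fun r hr => (hH r hr).continuousAt.continuousWithinAt
  have comp {f : ℝ × ℝ → ℝ} (hf : ContDiffOn ℝ 1 f (U ∩ {p : ℝ × ℝ | 0 < p.2})) :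
      ContinuousOn (fun r => f (t + H r, r)) (Icc c d) :=
    hf.continuousOn.comp ((continuousOn_const.add cH).prodMk continuousOn_id)
      fun r hr => ⟨hpt r hr, hc0.trans_le hr.1⟩
  have cψ := comp ((hψ.of_le (by norm_num)).mono inter_subset_left)
  have cl := comp (contDiffOn_psiL (M := M) hU hψ)
  have cu := comp ((contDiffOn_dY hU hψ (m := 1) (by norm_num)).mono inter_subset_left)
  have cp := comp (contDiffOn_phiL (M := M) hU hψ)
  have cz := comp (contDiffOn_phiY hU hψ)
  have cD : ContinuousOn (lapse M) (Icc c d) :=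
    (continuousOn_lapse M).mono fun r hr => hc0.trans_le hr.1
  have cw : ContinuousOn (fun r => lapse M r / 2 * (1 - lapse M r / 2 * H' r)) (Icc c d) :=
    (cD.div_const 2).mul (continuousOn_const.sub ((cD.div_const 2).mul cH'))
  have c1 : ContinuousOn (fun r => energyDensity M ψ (H' r) (t + H r, r)) (Icc c d) :=
    ContinuousOn.mul (by fun_prop) ((cH'.mul (cl.pow 2)).add (cw.mul (cu.pow 2)))
  have cV : ContinuousOn (fun r => M * (r - M) / r ^ 2) (Icc c d) :=
    ContinuousOn.div (by fun_prop) (by fun_prop) fun r hr => pow_ne_zero 2 (hc0.trans_le hr.1).ne'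
  have c2 : ContinuousOn (fun r => fluxT M (H' r) r (ψ (t + H r, r)) (phiL M ψ (t + H r, r))
      (phiY ψ (t + H r, r))) (Icc c d) :=
    ((cH'.mul (cp.pow 2)).add (cw.mul (cz.pow 2))).add (cV.mul (cψ.pow 2))
  refine ⟨c1, c2, ?_⟩
  have u := uIcc_of_le hcd
  -- The two densities differ by the exact derivative of (D/2)rψ² along the curve, independently of
  -- the slope.
  have hd : ∀ r ∈ uIcc c d, HasDerivAt (fun r => lapse M r / 2 * r * ψ (t + H r, r) ^ 2)
      (fluxT M (H' r) r (ψ (t + H r, r)) (phiL M ψ (t + H r, r)) (phiY ψ (t + H r, r))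
        - energyDensity M ψ (H' r) (t + H r, r)) r := fun r hr => by
    rw [u] at hr
    have hr0 : 0 < r := hc0.trans_le hr.1
    have h1 := ((((hasDerivAt_lapse M hr0.ne').div_const 2).fun_mul (hasDerivAt_id r)).fun_mul
      ((hasDerivAt_comp_foliation hU hψ (hH r hr) (hpt r hr)).fun_pow 2))
    refine h1.congr_deriv ?_
    simp only [fluxT, energyDensity, phiL, phiY, psiL, id, dLapse]
    generalize lapse M r = D
    field_simp
    ring
  have e := intervalIntegral.integral_eq_sub_of_hasDerivAt hd
    (u ▸ (c2.sub c1) : ContinuousOn _ (uIcc c d)).intervalIntegrable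
  rw [intervalIntegral.integral_sub (u ▸ c2 : ContinuousOn _ (uIcc c d)).intervalIntegrable
    (u ▸ c1 : ContinuousOn _ (uIcc c d)).intervalIntegrable] at e
  linarith

/-- The boundary terms (D/2)rψ² are harmless: zero at the horizon since D = 0, cancelling at R₀
between S and N, and of good sign at R. Beyond R the flux density is nonnegative and is dropped. -/
theorem energy_le_leafFlux (hM : 0 < M) (hR₀ : 2 * M < R₀) (hq : 0 < q) (hq2 : q < 2) {w : Weights}
    (hw : w.Pos) (hU : IsOpen U) (hψ : ContDiffOn ℝ 2 ψ U) {T R Rb : ℝ} (hT : 0 ≤ T)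
    (hS : ∀ r ∈ Icc M R₀, pointS T r ∈ U) (hN : ∀ r ∈ Ici R₀, pointN M R₀ T r ∈ U)
    (hR : R₀ ≤ R) (hRb : R ≤ Rb) {χ : ℝ → ℝ} (cχ : Continuous χ) (hχ0 : ∀ v, 0 ≤ χ v)
    (hχS : ∀ r ∈ Icc M R₀, χ (T + r) = 1) (hχN : ∀ r ∈ Icc R₀ R, χ (T + heightN M R₀ r) = 1) :
    (1 + T) ^ 2 * ((∫ r in M..R₀, energyDensity M ψ 1 (pointS T r))
        + ∫ r in R₀..R, energyDensity M ψ (2 / lapse M r) (pointN M R₀ T r))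
      ≤ leafFlux M q R₀ Rb w (1 + T) ψ χ T := by
  have hR0 : 0 < R₀ := by linarith
  have hl : 0 < 1 + T := by linarith
  have hMR : M ≤ R₀ := by linarith
  have hN' : ∀ r, R₀ ≤ r → (T + heightN M R₀ r, r) ∈ U := fun r hr => by rw [← pointN_eq]; exact hN r hr
  have dH : ∀ {r}, R₀ ≤ r → HasDerivAt (heightN M R₀) (2 / lapse M r) r := fun hr =>
    hasDerivAt_heightN hM (by linarith)
  have cH : ∀ d, ContinuousOn (heightN M R₀) (Icc R₀ d) := fun d r hr =>
    (dH hr.1).continuousAt.continuousWithinAt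
  have cD : ∀ d, ContinuousOn (fun r => 2 / lapse M r) (Icc R₀ d) := fun d =>
    continuousOn_two_div_lapse hM hR₀
  obtain ⟨-, cS2, eS⟩ := integral_energyDensity hM hU hψ (t := T) le_rfl hMR (H := fun r => r)
    (H' := fun _ => 1) (fun r _ => hasDerivAt_id r) continuousOn_const hS
  obtain ⟨-, cN2, eN⟩ := integral_energyDensity hM hU hψ (t := T) hMR hR (fun r hr => dH hr.1) (cD R)
    (fun r hr => hN' r hr.1)
  have hTT : T ∈ Icc T T := ⟨le_rfl, le_rfl⟩
  have cjS := continuousOn_jetFlux (q := q) hM hU hψ w hl (1 + T) (H := fun r => r) (H' := fun _ => 1)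
    (continuousOn_id (s := Icc M R₀)) continuousOn_const hM
    (fun τ (hτ : τ ∈ Icc T T) r hr => by rw [le_antisymm hτ.2 hτ.1]; exact hS r hr) hTT
  have cjN : ∀ d, ContinuousOn (fun r => jetFlux M q w (1 + T) ψ (1 + T) (2 / lapse M r) (T + heightN M R₀ r, r))
      (Icc R₀ d) := fun d => continuousOn_jetFlux hM hU hψ w hl (1 + T) (cH d) (cD d) hR0
    (fun τ (hτ : τ ∈ Icc T T) r hr => by rw [le_antisymm hτ.2 hτ.1]; exact hN' r hr.1) hTT
  have I {a b : ℝ} (hab : a ≤ b) {g : ℝ → ℝ} (hg : ContinuousOn g (Icc a b)) :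
      IntervalIntegrable g MeasureTheory.volume a b :=
    ContinuousOn.intervalIntegrable (by rwa [uIcc_of_le hab])
  have iN : ∀ {c d}, R₀ ≤ c → c ≤ d → IntervalIntegrable (fun r => χ (T + heightN M R₀ r)
      * jetFlux M q w (1 + T) ψ (1 + T) (2 / lapse M r) (T + heightN M R₀ r, r)) MeasureTheory.volume c d :=
    fun {c d} hc hcd => I hcd (((cχ.comp_continuousOn (continuousOn_const.add (cH d))).mul (cjN d)).mono
      (Icc_subset_Icc_left hc))
  have jS : (1 + T) ^ 2 * (∫ r in M..R₀, fluxT M 1 r (ψ (T + r, r)) (phiL M ψ (T + r, r)) (phiY ψ (T + r, r)))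
      ≤ ∫ r in M..R₀, χ (T + r) * jetFlux M q w (1 + T) ψ (1 + T) 1 (T + r, r) := by
    rw [← intervalIntegral.integral_const_mul]
    refine intervalIntegral.integral_mono_on hMR (I hMR (continuousOn_const.mul cS2))
      (I hMR ((cχ.comp_continuousOn (by fun_prop)).mul cjS)) fun r hr => ?_
    rw [hχS r hr, one_mul]
    exact totalFlux_ge hM hr.1 hq hq2 zero_le_one (by linarith [lapse_le_one hM hr.1]) hw hl le_rfl _ _ _
  have geN : ∀ r, R₀ ≤ r → (1 + T) ^ 2 * fluxT M (2 / lapse M r) r (ψ (T + heightN M R₀ r, r))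
      (phiL M ψ (T + heightN M R₀ r, r)) (phiY ψ (T + heightN M R₀ r, r))
      ≤ jetFlux M q w (1 + T) ψ (1 + T) (2 / lapse M r) (T + heightN M R₀ r, r) ∧
      0 ≤ fluxT M (2 / lapse M r) r (ψ (T + heightN M R₀ r, r))
      (phiL M ψ (T + heightN M R₀ r, r)) (phiY ψ (T + heightN M R₀ r, r)) := fun r hr => by
    have hr2 : 2 * M ≤ r := by linarith
    have hD := lapse_ge_quarter hM hr2
    have hDh := lapse_mul_two_div hM hr2
    exact ⟨totalFlux_ge hM (hMR.trans hr) hq hq2 (by positivity) hDh.le hw hl le_rfl _ _ _,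
      fluxT_nonneg hM (hMR.trans hr) (by positivity) hDh.le _ _ _⟩
  have jN : (1 + T) ^ 2 * (∫ r in R₀..R, fluxT M (2 / lapse M r) r (ψ (T + heightN M R₀ r, r))
        (phiL M ψ (T + heightN M R₀ r, r)) (phiY ψ (T + heightN M R₀ r, r)))
      ≤ ∫ r in R₀..R, χ (T + heightN M R₀ r)
        * jetFlux M q w (1 + T) ψ (1 + T) (2 / lapse M r) (T + heightN M R₀ r, r) := by
    rw [← intervalIntegral.integral_const_mul]
    refine intervalIntegral.integral_mono_on hR (I hR (continuousOn_const.mul cN2)) (iN le_rfl hR) fun r hr => ?_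
    rw [hχN r hr, one_mul]
    exact (geN r hr.1).1
  have j0 : 0 ≤ ∫ r in R..Rb, χ (T + heightN M R₀ r)
        * jetFlux M q w (1 + T) ψ (1 + T) (2 / lapse M r) (T + heightN M R₀ r, r) :=
    intervalIntegral.integral_nonneg hRb fun r hr => mul_nonneg (hχ0 _) (by
      obtain ⟨h1, h2⟩ := geN r (hR.trans hr.1)
      exact (mul_nonneg (sq_nonneg _) h2).trans h1)
  have hDM : lapse M M = 0 := by rw [lapse, div_self hM.ne']; norm_num
  have bR : 0 ≤ lapse M R / 2 * R * ψ (T + heightN M R₀ R, R) ^ 2 := by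
    have := lapse_nonneg M R
    have : 0 ≤ R := by linarith
    positivity
  simp only [leafFlux, pointN_eq]
  rw [← intervalIntegral.integral_add_adjacent_intervals (iN le_rfl hR) (iN hR hRb)]
  rw [hDM] at eS
  rw [heightN_self] at eN
  simp only [pointS]
  rw [eS, eN]
  have := mul_nonneg (sq_nonneg (1 + T)) bR
  linarith

end

end

/-! ### Cutoff, geometry of the leaves, energy densities -/

noncomputable section

open Set

/-- A smooth function that is one on `v ≤ V` and zero on `v ≥ V + 1`. -/
def cutoff (V v : ℝ) : ℝ := Real.smoothTransition (V + 1 - v)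

section Cutoff

variable (V v : ℝ)

theorem contDiff_cutoff {n : ℕ∞} : ContDiff ℝ n (cutoff V) :=
  Real.smoothTransition.contDiff.comp (contDiff_const.sub contDiff_id)

theorem cutoff_nonneg : 0 ≤ cutoff V v := Real.smoothTransition.nonneg _

theorem cutoff_le_one : cutoff V v ≤ 1 := Real.smoothTransition.le_one _

theorem deriv_cutoff_nonpos : deriv (cutoff V) v ≤ 0 :=
  Antitone.deriv_nonpos fun _ _ h => Real.smoothTransition.monotone (by linarith)

variable {V v}

theorem cutoff_eq_one (h : v ≤ V) : cutoff V v = 1 := Real.smoothTransition.one_of_one_le (by linarith)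

theorem cutoff_eq_zero (h : V + 1 ≤ v) : cutoff V v = 0 := Real.smoothTransition.zero_of_nonpos (by linarith)

end Cutoff

section

variable {M R₀ : ℝ}

theorem heightN_monotoneOn (hM : 0 < M) (hR₀ : 2 * M < R₀) : MonotoneOn (heightN M R₀) (Ici R₀) := by
  have hd : ∀ r ∈ Ici R₀, HasDerivAt (heightN M R₀) (2 / lapse M r) r := fun r hr =>
    hasDerivAt_heightN hM (by have := mem_Ici.1 hr; linarith)
  refine monotoneOn_of_deriv_nonneg (convex_Ici R₀)
    (fun r hr => (hd r hr).continuousAt.continuousWithinAt)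
    (fun r hr => (hd r (interior_subset hr)).differentiableAt.differentiableWithinAt) fun r hr => ?_
  rw [(hd r (interior_subset hr)).deriv]
  exact div_nonneg zero_le_two (lapse_nonneg M r)

theorem exists_heightN_ge (hM : 0 < M) (R₀ R B : ℝ) : ∃ Rb, R ≤ Rb ∧ B ≤ heightN M R₀ Rb := by
  obtain ⟨x, hx⟩ : ∃ x, x = max (max R (M + 1)) ((B - R₀) / 2 + tortoise M R₀ + M ^ 2) := ⟨_, rfl⟩
  have h1 : R ≤ x := hx ▸ (le_max_left _ _).trans (le_max_left _ _)
  have h2 : M + 1 ≤ x := hx ▸ (le_max_right _ _).trans (le_max_left _ _)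
  have h3 : (B - R₀) / 2 + tortoise M R₀ + M ^ 2 ≤ x := hx ▸ le_max_right _ _
  refine ⟨x, h1, ?_⟩
  have h4 : 0 ≤ 2 * M * Real.log (x - M) := mul_nonneg (by linarith) (Real.log_nonneg (by linarith))
  have h5 : M ^ 2 / (x - M) ≤ M ^ 2 := div_le_self (sq_nonneg M) (by linarith)
  rw [heightN, tortoise]
  linarith

theorem pointS_mem_region {τmax : EReal} {τ r : ℝ} (h0 : 0 ≤ τ) (hτ : (τ : EReal) < τmax)
    (hr : r ∈ Icc M R₀) : pointS τ r ∈ region M R₀ τmax :=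
  ⟨τ, h0, hτ, Or.inl ⟨by simp [pointS], hr.1, hr.2⟩⟩

theorem pointN_mem_leafN (hM : 0 < M) (hR₀ : 2 * M < R₀) {τ r : ℝ} (hr : r ∈ Ici R₀) :
    pointN M R₀ τ r ∈ leafN M R₀ τ := by
  have hr' := mem_Ici.1 hr
  refine ⟨by change M < r; linarith, ?_, ?_⟩
  · simp only [uCoord, pointN]; ring
  · have h := heightN_monotoneOn hM hR₀ self_mem_Ici hr hr'
    rw [heightN_self] at h
    rw [pointN_eq]
    exact add_le_add_right h τ

theorem pointN_mem_region (hM : 0 < M) (hR₀ : 2 * M < R₀) {τmax : EReal} {τ r : ℝ} (h0 : 0 ≤ τ)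
    (hτ : (τ : EReal) < τmax) (hr : r ∈ Ici R₀) : pointN M R₀ τ r ∈ region M R₀ τmax :=
  ⟨τ, h0, hτ, Or.inr (pointN_mem_leafN hM hR₀ hr)⟩

/-- The normalisation √(2 − D) of the unit normal cancels the one in the induced volume, leaving the
density of slope one. -/
theorem current_normalS (hM : 0 < M) (ψ : ℝ × ℝ → ℝ) {p : ℝ × ℝ} (hp : M ≤ p.2) :
    √(2 - lapse M p.2) * p.2 ^ 2 * current M ψ p killingT (normalS M p) = energyDensity M ψ 1 p := by
  have hD := lapse_le_one hM hp
  have hs : √(2 - lapse M p.2) ≠ 0 := (Real.sqrt_pos.2 (by linarith)).ne'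
  simp only [current, fderiv_eq_dT_dY, killingT, normalS, metric, gradSq, energyDensity, psiL]
  generalize √(2 - lapse M p.2) = s at *
  field_simp
  ring

theorem current_normalN (M : ℝ) (ψ : ℝ × ℝ → ℝ) (p : ℝ × ℝ) :
    current M ψ p killingT (normalN M p) = psiL M ψ p ^ 2 := by
  simp only [current, fderiv_eq_dT_dY, killingT, normalN, metric, gradSq, psiL]
  ring

theorem energyDensity_null (hM : 0 < M) (ψ : ℝ × ℝ → ℝ) {p : ℝ × ℝ} (hp : 2 * M ≤ p.2) :
    energyDensity M ψ (2 / lapse M p.2) p = p.2 ^ 2 * (2 / lapse M p.2) * psiL M ψ p ^ 2 := by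
  have h := lapse_mul_two_div hM hp
  rw [energyDensity, show 1 - lapse M p.2 / 2 * (2 / lapse M p.2) = 0 by linarith]
  ring

theorem energyDensity_nonneg {ψ : ℝ × ℝ → ℝ} {h : ℝ} {p : ℝ × ℝ} (hh : 0 ≤ h)
    (hDh : lapse M p.2 * h ≤ 2) : 0 ≤ energyDensity M ψ h p := by
  have := lapse_nonneg M p.2
  have : 0 ≤ 1 - lapse M p.2 / 2 * h := by linarith
  rw [energyDensity]; positivity

theorem le_mul_toReal_of_ofReal_le {x c : ℝ} {E : ENNReal} (hE : E ≠ ⊤) (hc : 0 ≤ c)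
    (h : ENNReal.ofReal x ≤ ENNReal.ofReal c * E) : x ≤ c * E.toReal := by
  rw [← ENNReal.ofReal_toReal hE, ← ENNReal.ofReal_mul hc] at h
  exact (ENNReal.ofReal_le_ofReal_iff (mul_nonneg hc ENNReal.toReal_nonneg)).1 h

open MeasureTheory in
theorem setLIntegral_Ici_eq_iSup (f : ℝ → ENNReal) (a : ℝ) :
    ∫⁻ r in Ici a, f r = ⨆ n : ℕ, ∫⁻ r in Icc a (a + n), f r := by
  have h : Ici a = ⋃ n : ℕ, Icc a (a + n) := by
    ext r
    simp only [mem_Ici, mem_iUnion, mem_Icc]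
    refine ⟨fun hr => ?_, fun ⟨_, hr⟩ => hr.1⟩
    obtain ⟨n, hn⟩ := exists_nat_ge (r - a)
    exact ⟨n, hr, by linarith⟩
  rw [h]
  refine setLIntegral_iUnion_of_directed f ?_
  refine Monotone.directed_le fun m n hmn => Icc_subset_Icc_right ?_
  have : (m : ℝ) ≤ n := by exact_mod_cast hmn
  linarith

end

end

/-! ### Translation between Lebesgue integrals and interval integrals -/

noncomputable section

open Set

section

variable {M R₀ : ℝ} {U : Set (ℝ × ℝ)} {ψ F : ℝ × ℝ → ℝ}

theorem continuousOn_nonlinearity (M : ℝ) {A : ℝ → ℝ} (hA : Continuous A) (hU : IsOpen U)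
    (hψ : ContDiffOn ℝ 2 ψ U) :
    ContinuousOn (nonlinearity M A ψ) (U ∩ {p : ℝ × ℝ | 0 < p.2}) := by
  have cT := (contDiffOn_dT hU hψ (m := 1) (by norm_num)).continuousOn.mono
    (inter_subset_left (t := {p : ℝ × ℝ | 0 < p.2}))
  have cY := (contDiffOn_dY hU hψ (m := 1) (by norm_num)).continuousOn.mono
    (inter_subset_left (t := {p : ℝ × ℝ | 0 < p.2}))
  have cD := (contDiffOn_radial (U := U) (contDiffOn_lapse M (n := 1))).continuousOn
  exact (hA.comp_continuousOn (hψ.continuousOn.mono inter_subset_left)).mul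
    ((cD.mul (cY.pow 2)).add ((continuousOn_const.mul cT).mul cY))

theorem one_le_sqrt_two_sub_lapse (hM : 0 < M) {r : ℝ} (hr : M ≤ r) : 1 ≤ √(2 - lapse M r) :=
  Real.one_le_sqrt.2 (by linarith [lapse_le_one hM hr])

theorem one_le_four_pi : 1 ≤ 4 * Real.pi := by linarith [Real.pi_gt_three]

theorem lintegral_S_le_intS (hM : 0 < M) {f : ℝ × ℝ → ℝ} (hf : ∀ p, 0 ≤ f p) (τ : ℝ) :
    ∫⁻ r in Icc M R₀, ENNReal.ofReal (r ^ 2 * f (pointS τ r)) ≤ intS M R₀ τ f := by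
  refine MeasureTheory.setLIntegral_mono' measurableSet_Icc fun r hr => ENNReal.ofReal_le_ofReal ?_
  have h1 := one_le_mul_of_one_le_of_one_le one_le_four_pi (one_le_sqrt_two_sub_lapse hM hr.1)
  have h2 : 0 ≤ r ^ 2 * f (pointS τ r) := mul_nonneg (sq_nonneg r) (hf _)
  calc _ ≤ 4 * Real.pi * √(2 - lapse M r) * (r ^ 2 * f (pointS τ r)) := le_mul_of_one_le_left h2 h1
    _ = _ := by ring

theorem lintegral_S_le_bulkS {f : ℝ × ℝ → ℝ} (hf : ∀ p, 0 ≤ f p) (s T : ℝ) :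
    ∫⁻ τ in Icc s T, ∫⁻ r in Icc M R₀, ENNReal.ofReal (r ^ 2 * f (pointS τ r)) ≤ bulkS M R₀ s T f := by
  refine MeasureTheory.lintegral_mono fun τ => MeasureTheory.lintegral_mono fun r =>
    ENNReal.ofReal_le_ofReal ?_
  have h2 : 0 ≤ r ^ 2 * f (pointS τ r) := mul_nonneg (sq_nonneg r) (hf _)
  calc _ ≤ 4 * Real.pi * (r ^ 2 * f (pointS τ r)) := le_mul_of_one_le_left h2 one_le_four_pi
    _ = _ := by ring

theorem lintegral_N_le_bulkN {f : ℝ × ℝ → ℝ} (hf : ∀ p, 0 ≤ p.2 → 0 ≤ f p) (hR₀ : 0 ≤ R₀) (s T Rb : ℝ) :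
    ∫⁻ τ in Icc s T, ∫⁻ r in Icc R₀ Rb, ENNReal.ofReal (r ^ 2 * f (pointN M R₀ τ r)) ≤ bulkN M R₀ s T f := by
  refine MeasureTheory.lintegral_mono fun τ =>
    (MeasureTheory.lintegral_mono_set Icc_subset_Ici_self).trans
      (MeasureTheory.setLIntegral_mono' measurableSet_Ici fun r hr => ENNReal.ofReal_le_ofReal ?_)
  have h2 : 0 ≤ r ^ 2 * f (pointN M R₀ τ r) := mul_nonneg (sq_nonneg r) (hf _ (hR₀.trans hr))
  calc _ ≤ 4 * Real.pi * (r ^ 2 * f (pointN M R₀ τ r)) := le_mul_of_one_le_left h2 one_le_four_pi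
    _ = _ := by ring

theorem lintegral_N_le_intN {f : ℝ × ℝ → ℝ} (hf : ∀ p, 0 ≤ f p) (τ Rb : ℝ) :
    ∫⁻ r in Icc R₀ Rb, ENNReal.ofReal (r ^ 2 * (2 / lapse M r) * f (pointN M R₀ τ r)) ≤ intN M R₀ τ f := by
  refine (MeasureTheory.lintegral_mono_set Icc_subset_Ici_self).trans
      (MeasureTheory.lintegral_mono fun r => ENNReal.ofReal_le_ofReal ?_)
  have h2 : 0 ≤ r ^ 2 * (2 / lapse M r) * f (pointN M R₀ τ r) :=
    mul_nonneg (mul_nonneg (sq_nonneg r) (div_nonneg zero_le_two (lapse_nonneg M r))) (hf _)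
  calc _ ≤ 4 * Real.pi * (r ^ 2 * (2 / lapse M r) * f (pointN M R₀ τ r)) :=
        le_mul_of_one_le_left h2 one_le_four_pi
    _ = _ := by ring

/-- The initial energy controls the first derivatives on `Σ_0`. -/
theorem data_le (hM : 0 < M) (hR₀ : 2 * M < R₀) {R₁ ε : ℝ} (hR₁ : R₀ ≤ R₁) (hε : 0 < ε) (hU : IsOpen U)
    (hψ : ContDiffOn ℝ 2 ψ U) (hS : ∀ r ∈ Icc M R₀, pointS 0 r ∈ U)
    (hN : ∀ r ∈ Ici R₀, pointN M R₀ 0 r ∈ U) (hE : E₀ M R₀ ε ψ ≠ ⊤) :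
    dataS M R₀ ψ ≤ ε ^ 2 * (E₀ M R₀ ε ψ).toReal ∧ dataN M R₀ R₁ ψ ≤ ε ^ 2 * (E₀ M R₀ ε ψ).toReal := by
  have hR0 : 0 < R₀ := by linarith
  have hf : ∀ p ∈ U, fderiv ℝ (fun p => ε⁻¹ * ψ p) p = ε⁻¹ • fderiv ℝ ψ p := fun p hp =>
    fderiv_const_mul ((hψ.contDiffAt (hU.mem_nhds hp)).differentiableAt (by simp)) _
  have hMR : M ≤ R₀ := by linarith
  have e1 : ENNReal.ofReal (dataS M R₀ ψ) ≤ ENNReal.ofReal (ε ^ 2) * E₀ M R₀ ε ψ := by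
    have cT : ContinuousOn (fun r => dT ψ (pointS 0 r)) (Icc M R₀) :=
      (contDiffOn_dT hU hψ (m := 1) (by norm_num)).continuousOn.comp (by unfold pointS; fun_prop) hS
    have cY : ContinuousOn (fun r => dY ψ (pointS 0 r)) (Icc M R₀) :=
      (contDiffOn_dY hU hψ (m := 1) (by norm_num)).continuousOn.comp (by unfold pointS; fun_prop) hS
    have c : ContinuousOn (fun r => r ^ 2 * (dY ψ (pointS 0 r) ^ 2 + dT ψ (pointS 0 r) ^ 2)) (Icc M R₀) :=
      ContinuousOn.mul (by fun_prop) ((cY.pow 2).add (cT.pow 2))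
    rw [dataS, ← setLIntegral_Icc_ofReal hMR c fun r _ => by positivity]
    have h1 : ∫⁻ r in Icc M R₀, ENNReal.ofReal (r ^ 2 * (dY ψ (pointS 0 r) ^ 2 + dT ψ (pointS 0 r) ^ 2))
        = ENNReal.ofReal (ε ^ 2) * ∫⁻ r in Icc M R₀, ENNReal.ofReal (r ^ 2 *
          (fun p => dY (fun p => ε⁻¹ * ψ p) p ^ 2 + dT (fun p => ε⁻¹ * ψ p) p ^ 2) (pointS 0 r)) := by
      rw [← MeasureTheory.lintegral_const_mul' _ _ ENNReal.ofReal_ne_top]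
      refine MeasureTheory.setLIntegral_congr_fun measurableSet_Icc fun r hr => ?_
      simp only
      rw [← ENNReal.ofReal_mul (by positivity), dY, dT, dY, dT, hf _ (hS r hr)]
      congr 1
      simp only [_root_.smul_apply, smul_eq_mul]
      field_simp
    rw [h1]
    refine mul_le_mul_right ((lintegral_S_le_intS hM
      (f := fun p => dY (fun p => ε⁻¹ * ψ p) p ^ 2 + dT (fun p => ε⁻¹ * ψ p) p ^ 2) (fun p => by positivity) 0).trans ?_) _
    exact le_self_add.trans le_self_add
  have e2 : ENNReal.ofReal (dataN M R₀ R₁ ψ) ≤ ENNReal.ofReal (ε ^ 2) * E₀ M R₀ ε ψ := by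
    have cH : ContinuousOn (heightN M R₀) (Icc R₀ R₁) := fun r hr =>
      (hasDerivAt_heightN hM (by linarith [hr.1])).continuousAt.continuousWithinAt
    have cl : ContinuousOn (fun r => psiL M ψ (pointN M R₀ 0 r)) (Icc R₀ R₁) := by
      simp only [pointN_eq]
      exact (contDiffOn_psiL hU hψ).continuousOn.comp ((continuousOn_const.add cH).prodMk continuousOn_id)
        fun r hr => ⟨by simpa only [pointN_eq] using hN r hr.1, hR0.trans_le hr.1⟩
    have c : ContinuousOn (fun r => r ^ 2 * (2 / lapse M r) * psiL M ψ (pointN M R₀ 0 r) ^ 2)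
        (Icc R₀ R₁) :=
      (ContinuousOn.mul (by fun_prop) (continuousOn_two_div_lapse hM hR₀)).mul (cl.pow 2)
    rw [dataN, ← setLIntegral_Icc_ofReal hR₁ c fun r _ => by
        have := lapse_nonneg M r
        positivity]
    have h1 : ∫⁻ r in Icc R₀ R₁, ENNReal.ofReal (r ^ 2 * (2 / lapse M r) * psiL M ψ (pointN M R₀ 0 r) ^ 2)
        = ENNReal.ofReal (ε ^ 2) * ∫⁻ r in Icc R₀ R₁, ENNReal.ofReal (r ^ 2 * (2 / lapse M r) *
          (fun p => fderiv ℝ (fun p => ε⁻¹ * ψ p) p (normalN M p) ^ 2) (pointN M R₀ 0 r)) := by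
      rw [← MeasureTheory.lintegral_const_mul' _ _ ENNReal.ofReal_ne_top]
      refine MeasureTheory.setLIntegral_congr_fun measurableSet_Icc fun r hr => ?_
      simp only
      rw [← ENNReal.ofReal_mul (by positivity), hf _ (hN r hr.1)]
      congr 1
      simp only [_root_.smul_apply, smul_eq_mul, fderiv_eq_dT_dY, psiL, normalN]
      field_simp
    rw [h1]
    refine mul_le_mul_right ((lintegral_N_le_intN
      (f := fun p => fderiv ℝ (fun p => ε⁻¹ * ψ p) p (normalN M p) ^ 2) (fun p => sq_nonneg _) 0 R₁).trans ?_) _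
    exact le_add_self.trans le_self_add
  exact ⟨le_mul_toReal_of_ofReal_le hE (sq_nonneg ε) e1, le_mul_toReal_of_ofReal_le hE (sq_nonneg ε) e2⟩

/-- The energy on N may be infinite a priori. As a supremum over truncated cones it is controlled by
estimates at finite radius, uniform in the radius. -/
theorem degenerateEnergy_eq_iSup (hM : 0 < M) (hR₀ : 2 * M < R₀) (hU : IsOpen U)
    (hψ : ContDiffOn ℝ 2 ψ U) {τ : ℝ} (hS : ∀ r ∈ Icc M R₀, pointS τ r ∈ U)
    (hN : ∀ r ∈ Ici R₀, pointN M R₀ τ r ∈ U) :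
    degenerateEnergy M R₀ ψ τ = ⨆ n : ℕ, ENNReal.ofReal (4 * Real.pi *
      ((∫ r in M..R₀, energyDensity M ψ 1 (pointS τ r))
        + ∫ r in R₀..(R₀ + n), energyDensity M ψ (2 / lapse M r) (pointN M R₀ τ r))) := by
  have hMR : M ≤ R₀ := by linarith
  have hpi : 0 ≤ 4 * Real.pi := by linarith [one_le_four_pi]
  have eS : intS M R₀ τ (fun p => current M ψ p killingT (normalS M p))
      = ENNReal.ofReal (4 * Real.pi * ∫ r in M..R₀, energyDensity M ψ 1 (pointS τ r)) := by
    have c := (integral_energyDensity hM hU hψ (t := τ) le_rfl hMR (H := fun r => r)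
      (H' := fun _ => 1) (fun r _ => hasDerivAt_id r) continuousOn_const hS).1
    have c' : ContinuousOn (fun r => 4 * Real.pi * energyDensity M ψ 1 (pointS τ r)) (Icc M R₀) :=
      continuousOn_const.mul c
    rw [← intervalIntegral.integral_const_mul, ← setLIntegral_Icc_ofReal hMR c']
    · refine MeasureTheory.setLIntegral_congr_fun measurableSet_Icc fun r hr => ?_
      have := current_normalS hM ψ (p := pointS τ r) hr.1
      simp only
      rw [← this]
      congr 1
      simp only [pointS]
      ring
    · exact fun r hr => mul_nonneg hpi (energyDensity_nonneg (p := (τ + r, r)) zero_le_one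
        (by linarith [lapse_le_one hM hr.1]))
  have eN : ∀ n : ℕ, ∫⁻ r in Icc R₀ (R₀ + n), ENNReal.ofReal (4 * Real.pi * r ^ 2 * (2 / lapse M r)
        * current M ψ (pointN M R₀ τ r) killingT (normalN M (pointN M R₀ τ r)))
      = ENNReal.ofReal (4 * Real.pi * ∫ r in R₀..(R₀ + n),
        energyDensity M ψ (2 / lapse M r) (pointN M R₀ τ r)) := fun n => by
    have hn : R₀ ≤ R₀ + n := by have : (0 : ℝ) ≤ n := Nat.cast_nonneg n; linarith
    have c := (integral_energyDensity hM hU hψ (t := τ) hMR hn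
      (fun r hr => hasDerivAt_heightN (R₀ := R₀) hM (by linarith [hr.1])) (continuousOn_two_div_lapse hM hR₀)
      (fun r hr => by rw [← pointN_eq]; exact hN r hr.1)).1
    simp only [← pointN_eq] at c
    have c' : ContinuousOn (fun r => 4 * Real.pi * energyDensity M ψ (2 / lapse M r) (pointN M R₀ τ r))
        (Icc R₀ (R₀ + n)) := continuousOn_const.mul c
    rw [← intervalIntegral.integral_const_mul, ← setLIntegral_Icc_ofReal hn c']
    · refine MeasureTheory.setLIntegral_congr_fun measurableSet_Icc fun r hr => ?_
      have := energyDensity_null hM ψ (p := pointN M R₀ τ r) (by change 2 * M ≤ r; linarith [hr.1])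
      rw [current_normalN]
      change energyDensity M ψ (2 / lapse M r) (pointN M R₀ τ r)
        = r ^ 2 * (2 / lapse M r) * psiL M ψ (pointN M R₀ τ r) ^ 2 at this
      rw [this]
      congr 1
      ring
    · intro r hr
      exact mul_nonneg hpi (energyDensity_nonneg (div_nonneg zero_le_two (lapse_nonneg M r))
        (lapse_mul_two_div (r := r) hM (by linarith [hr.1])).le)
  have nS : 0 ≤ ∫ r in M..R₀, energyDensity M ψ 1 (pointS τ r) :=
    intervalIntegral.integral_nonneg hMR fun r hr => energyDensity_nonneg (p := (τ + r, r)) zero_le_one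
        (by linarith [lapse_le_one hM hr.1])
  rw [degenerateEnergy, eS, intN, setLIntegral_Ici_eq_iSup, ENNReal.add_iSup]
  refine iSup_congr fun n => ?_
  rw [eN n, ← ENNReal.ofReal_add, mul_add]
  · exact mul_nonneg hpi nS
  · refine mul_nonneg hpi (intervalIntegral.integral_nonneg (by simp) fun r hr => ?_)
    exact energyDensity_nonneg (div_nonneg zero_le_two (lapse_nonneg M r))
        (lapse_mul_two_div (r := r) hM (by linarith [hr.1])).le

end

end

/-! ### Decay from bounds on the sources and the data -/

noncomputable section

open Set

section

variable {M R₀ : ℝ} {U : Set (ℝ × ℝ)} {F : ℝ × ℝ → ℝ}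

theorem continuousOn_comp_pointS (hM : 0 < M) (cF : ContinuousOn F (U ∩ {p : ℝ × ℝ | 0 < p.2})) {a b : ℝ}
    (hS : ∀ t ∈ Icc a b, ∀ r ∈ Icc M R₀, pointS t r ∈ U) :
    ContinuousOn (fun z : ℝ × ℝ => F (pointS z.1 z.2)) (Icc a b ×ˢ Icc M R₀) :=
  continuousOn_comp_foliation cF continuousOn_id fun t ht r hr => ⟨hS t ht r hr, hM.trans_le hr.1⟩

theorem continuousOn_comp_pointN (hM : 0 < M) (hR₀ : 2 * M < R₀)
    (cF : ContinuousOn F (U ∩ {p : ℝ × ℝ | 0 < p.2})) {a b : ℝ}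
    (hN : ∀ t ∈ Icc a b, ∀ r ∈ Ici R₀, pointN M R₀ t r ∈ U) (Rb : ℝ) :
    ContinuousOn (fun z : ℝ × ℝ => F (pointN M R₀ z.1 z.2)) (Icc a b ×ˢ Icc R₀ Rb) := by
  simp only [pointN_eq] at hN ⊢
  exact continuousOn_comp_foliation cF
    (fun r hr => (hasDerivAt_heightN hM (by linarith [hr.1])).continuousAt.continuousWithinAt)
    fun t ht r hr => ⟨hN t ht r hr.1, show 0 < r by linarith [hr.1]⟩

theorem continuousOn_uncurry_sourceS (hM : 0 < M) (cF : ContinuousOn F (U ∩ {p : ℝ × ℝ | 0 < p.2}))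
    {a b : ℝ} (hS : ∀ t ∈ Icc a b, ∀ r ∈ Icc M R₀, pointS t r ∈ U) :
    ContinuousOn (Function.uncurry fun t r => r ^ 2 * F (pointS t r) ^ 2) (Icc a b ×ˢ Icc M R₀) :=
  ContinuousOn.mul (by fun_prop) ((continuousOn_comp_pointS hM cF hS).pow 2)

theorem continuousOn_uncurry_sourceN (hM : 0 < M) (hR₀ : 2 * M < R₀)
    (cF : ContinuousOn F (U ∩ {p : ℝ × ℝ | 0 < p.2})) {a b : ℝ}
    (hN : ∀ t ∈ Icc a b, ∀ r ∈ Ici R₀, pointN M R₀ t r ∈ U) (q Rb : ℝ) :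
    ContinuousOn (Function.uncurry fun t r => r ^ 3 * r ^ q * F (pointN M R₀ t r) ^ 2)
      (Icc a b ×ˢ Icc R₀ Rb) :=
  (((continuousOn_snd (s := Icc a b ×ˢ Icc R₀ Rb)).pow 3).mul (continuousOn_snd.rpow_const fun z hz =>
    Or.inl (show z.2 ≠ 0 from (show 0 < z.2 by linarith [hz.2.1]).ne'))).mul ((continuousOn_comp_pointN hM hR₀ cF hN Rb).pow 2)

/-- Decay of the degenerate energy, in terms of bounds for the source and the data. -/
theorem exists_energyDensity_le {q : ℝ} (hM : 0 < M) (hR₀ : 2 * M < R₀) (hq : 0 < q) (hq2 : q < 2)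
    {Rs R₁ : ℝ} (hRs : Rs < R₁) (hR₁ : R₀ + 1 ≤ R₁) :
    ∃ C, 0 < C ∧ ∀ (U : Set (ℝ × ℝ)) (ψ F : ℝ × ℝ → ℝ) (T K R : ℝ), IsOpen U → ContDiffOn ℝ 2 ψ U →
      ContinuousOn F (U ∩ {p : ℝ × ℝ | 0 < p.2}) → 0 ≤ T → 0 ≤ K → R₀ ≤ R →
      (∀ t ∈ Icc 0 T, ∀ r ∈ Icc M R₀, pointS t r ∈ U ∧ box M ψ (pointS t r) = F (pointS t r)) →
      (∀ t ∈ Icc 0 T, ∀ r ∈ Ici R₀, pointN M R₀ t r ∈ U ∧ box M ψ (pointN M R₀ t r) = F (pointN M R₀ t r)) →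
      (∀ r ∈ Ici R₀, Rs < r → ψ (pointN M R₀ 0 r) = 0) →
      (∀ s ∈ Icc 0 T, sourceS M R₀ F s ≤ K * (1 + s) ^ (-q)) →
      (∀ s ∈ Ico 0 T, ∫ t in s..T, sourceS M R₀ F t ≤ K * (1 + s) ^ (-q)) →
      (∀ Rb, R₀ ≤ Rb → ∀ s ∈ Ico 0 T, ∫ t in s..T, sourceN M q R₀ Rb F t ≤ K * (1 + s) ^ (-q)) →
      (∫ r in M..R₀, energyDensity M ψ 1 (pointS T r))
        + (∫ r in R₀..R, energyDensity M ψ (2 / lapse M r) (pointN M R₀ T r))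
        ≤ C * ((dataS M R₀ ψ + dataN M R₀ R₁ ψ + K) * (1 + T) ^ (-q)) := by
  obtain ⟨w, B₁, hw, hB₁, hflux⟩ := exists_leafFlux_le hM hR₀ hq hq2
  obtain ⟨B₀, hB₀, hzero⟩ := exists_leafFlux_zero_le hM hR₀ hq hq2 hw hRs hR₁
  have hm : 0 < 2 - q := by linarith
  obtain ⟨S, hSdef⟩ : ∃ S, S = 4 + 4 / (2 - q) + 1 / (1 - q / 2) ^ 2 := ⟨_, rfl⟩
  have hS0 : 0 < S := by rw [hSdef]; positivity
  refine ⟨B₀ + B₁ * S, by positivity, ?_⟩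
  intro U ψ F T K R hU hψ cF hT hK hR hS hN hsupp h1 h2 h3
  have hMR : M ≤ R₀ := by linarith
  have h0T : (0 : ℝ) ∈ Icc 0 T := ⟨le_rfl, hT⟩
  have hTT : T ∈ Icc 0 T := ⟨hT, le_rfl⟩
  have hl : 0 < 1 + T := by linarith
  -- The cutoff has to be one on the part r ≤ R of the final leaf and zero at r = Rb on every leaf
  -- with 0 ≤ t ≤ T; v is unbounded along the cones, so such Rb exists.
  obtain ⟨Rb, hRb, hV⟩ := exists_heightN_ge hM R₀ (max R R₁) (T + heightN M R₀ R + 1)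
  have hRRb : R ≤ Rb := (le_max_left _ _).trans hRb
  have hmono := heightN_monotoneOn hM hR₀
  have hHR : R₀ ≤ heightN M R₀ R := by
    have := hmono self_mem_Ici hR hR
    rwa [heightN_self] at this
  have hcut : ContDiff ℝ 1 (cutoff (T + heightN M R₀ R)) := by exact_mod_cast contDiff_cutoff _ (n := 1)
  have i1 := hflux U ψ F T Rb (cutoff (T + heightN M R₀ R)) hU hψ cF hT (hR.trans hRRb) hS hN hcut
    (cutoff_nonneg _) (cutoff_le_one _) (deriv_cutoff_nonpos _)
    fun t ht => cutoff_eq_zero (by linarith [ht.1])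
  have i2 := hzero U ψ (1 + T) Rb (cutoff (T + heightN M R₀ R)) hU hψ (fun r hr => (hS 0 h0T r hr).1)
    (fun r hr => (hN 0 h0T r hr).1) hsupp (by linarith) ((le_max_right _ _).trans hRb) hcut.continuous
    (cutoff_nonneg _) (cutoff_le_one _)
  have i3 := energy_le_leafFlux hM hR₀ hq hq2 hw hU hψ hT (fun r hr => (hS T hTT r hr).1)
    (fun r hr => (hN T hTT r hr).1) hR hRRb hcut.continuous (cutoff_nonneg _)
    (fun r hr => cutoff_eq_one (by linarith [hr.2]))
    fun r hr => cutoff_eq_one (by linarith [hmono (mem_Ici.2 hr.1) (mem_Ici.2 hR) hr.2])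
  have i4 := source_integral_le hT hK hq2
    (continuousOn_intervalIntegral_of_rectangle hMR
      (continuousOn_uncurry_sourceS hM cF fun t ht r hr => (hS t ht r hr).1))
    (continuousOn_intervalIntegral_of_rectangle (hR.trans hRRb)
      (continuousOn_uncurry_sourceN hM hR₀ cF (fun t ht r hr => (hN t ht r hr).1) q Rb))
    h1 h2 (h3 Rb (hR.trans hRRb))
  change (∫ t in (0 : ℝ)..T, _ * sourceS M R₀ F t) + (∫ t in (0 : ℝ)..T, _ * sourceN M q R₀ Rb F t) ≤ _ at i4
  rw [← hSdef] at i4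
  have i5 := mul_le_mul_of_nonneg_left i4 hB₁.le
  have hd1 : 0 ≤ dataS M R₀ ψ :=
    intervalIntegral.integral_nonneg hMR fun r _ => by positivity
  have hd2 : 0 ≤ dataN M R₀ R₁ ψ :=
    intervalIntegral.integral_nonneg (by linarith) fun r _ => by
      have := lapse_nonneg M r
      positivity
  have hΛ : 0 < (1 + T) ^ (2 - q) := Real.rpow_pos_of_pos hl _
  have hpow : (1 + T) ^ (2 - q) = (1 + T) ^ 2 * (1 + T) ^ (-q) := by
    rw [← Real.rpow_natCast, ← Real.rpow_add hl]
    norm_num [sub_eq_add_neg]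
  -- The energy appears with the factor (1 + T)², data and sources with (1 + T)^(2−q).
  refine le_of_mul_le_mul_left ?_ (sq_pos_of_pos hl)
  refine i3.trans (i1.trans ((add_le_add i2 i5).trans ?_))
  have e : (1 + T) ^ 2 * ((B₀ + B₁ * S) * ((dataS M R₀ ψ + dataN M R₀ R₁ ψ + K) * (1 + T) ^ (-q)))
      = (B₀ + B₁ * S) * ((dataS M R₀ ψ + dataN M R₀ R₁ ψ + K) * (1 + T) ^ (2 - q)) := by
    rw [hpow]; ring
  rw [e]
  have t1 : 0 ≤ B₀ * (K * (1 + T) ^ (2 - q)) := by positivity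
  have t2 : 0 ≤ B₁ * S * ((dataS M R₀ ψ + dataN M R₀ R₁ ψ) * (1 + T) ^ (2 - q)) := by positivity
  linear_combination t1 + t2

theorem sourceS_le {c : ℝ} {𝓔 : ℝ≥0∞} (hM : 0 < M) (hR₀ : 2 * M < R₀)
    (cF : ContinuousOn F (U ∩ {p : ℝ × ℝ | 0 < p.2})) (hE : 𝓔 ≠ ⊤) (hc : 0 ≤ c)
    {s : ℝ} (hS : ∀ r ∈ Icc M R₀, pointS s r ∈ U)
    (h : intS M R₀ s (fun p => F p ^ 2) ≤ ENNReal.ofReal c * 𝓔) :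
    sourceS M R₀ F s ≤ c * 𝓔.toReal := by
  have hMR : M ≤ R₀ := by linarith
  refine le_mul_toReal_of_ofReal_le hE hc (le_trans ?_ h)
  have c' := (continuousOn_uncurry_sourceS hM cF (a := s) (b := s) fun t ht r hr => by
    rw [le_antisymm ht.2 ht.1]; exact hS r hr).slice_right ⟨le_rfl, le_rfl⟩
  rw [sourceS, ← setLIntegral_Icc_ofReal (f := fun r => r ^ 2 * F (pointS s r) ^ 2) hMR c'
    fun r _ => by positivity]
  exact lintegral_S_le_intS hM (f := fun p => F p ^ 2) (fun p => sq_nonneg _) s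

theorem integral_sourceS_le {c : ℝ} {𝓔 : ℝ≥0∞} (hM : 0 < M) (hR₀ : 2 * M < R₀)
    (cF : ContinuousOn F (U ∩ {p : ℝ × ℝ | 0 < p.2})) (hE : 𝓔 ≠ ⊤) (hc : 0 ≤ c)
    {s T : ℝ} (hsT : s ≤ T) (hS : ∀ t ∈ Icc s T, ∀ r ∈ Icc M R₀, pointS t r ∈ U)
    (h : bulkS M R₀ s T (fun p => F p ^ 2) ≤ ENNReal.ofReal c * 𝓔) :
    ∫ t in s..T, sourceS M R₀ F t ≤ c * 𝓔.toReal := by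
  have hMR : M ≤ R₀ := by linarith
  refine le_mul_toReal_of_ofReal_le hE hc (le_trans ?_ h)
  simp only [sourceS]
  rw [← setLIntegral_Icc_Icc_ofReal (f := fun t r => r ^ 2 * F (pointS t r) ^ 2) hsT hMR
    (continuousOn_uncurry_sourceS hM cF hS) fun t _ r _ => by positivity]
  exact lintegral_S_le_bulkS (f := fun p => F p ^ 2) (fun p => sq_nonneg _) s T

theorem integral_sourceN_le {q c : ℝ} {𝓔 : ℝ≥0∞} (hM : 0 < M) (hR₀ : 2 * M < R₀)
    (cF : ContinuousOn F (U ∩ {p : ℝ × ℝ | 0 < p.2})) (hE : 𝓔 ≠ ⊤) (hc : 0 ≤ c)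
    {s T Rb : ℝ} (hsT : s ≤ T) (hRb : R₀ ≤ Rb) (hN : ∀ t ∈ Icc s T, ∀ r ∈ Ici R₀, pointN M R₀ t r ∈ U)
    (h : bulkN M R₀ s T (fun p => p.2 ^ (1 + q) * F p ^ 2) ≤ ENNReal.ofReal c * 𝓔) :
    ∫ t in s..T, sourceN M q R₀ Rb F t ≤ c * 𝓔.toReal := by
  have hR0 : 0 < R₀ := by linarith
  refine le_mul_toReal_of_ofReal_le hE hc (le_trans ?_ h)
  simp only [sourceN]
  rw [← setLIntegral_Icc_Icc_ofReal (f := fun t r => r ^ 3 * r ^ q * F (pointN M R₀ t r) ^ 2) hsT hRb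
    (continuousOn_uncurry_sourceN hM hR₀ cF hN q Rb) fun t _ r hr => by
      have : 0 < r := hR0.trans_le hr.1
      positivity]
  refine le_trans (le_of_eq ?_) (lintegral_N_le_bulkN (f := fun p => p.2 ^ (1 + q) * F p ^ 2)
    (fun p hp => by positivity) hR0.le s T Rb)
  refine MeasureTheory.setLIntegral_congr_fun measurableSet_Icc fun t _ =>
    MeasureTheory.setLIntegral_congr_fun measurableSet_Icc fun r hr => ?_
  have hr0 : 0 < r := hR0.trans_le hr.1
  simp only [pointN]
  rw [Real.rpow_add hr0, Real.rpow_one]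
  congr 1
  ring

end

end

end ExtremalRN

/-! ### The decay theorem -/

theorem mainTheorem3 (M R₀ Rs α Cα : ℝ) (hM : 0 < M) (hR₀ : 2 * M < R₀)
    (hα : 0 < α) (hα' : α < 2) (hCα : 0 < Cα) :
    ∃ C : ℝ, 0 < C ∧
      ∀ (A : ℝ → ℝ), ContDiff ℝ ∞ A → (∀ k : ℕ, ∃ a : ℝ, ∀ x, |iteratedDeriv k A x| ≤ a) →
      ∀ (τmax : EReal) (U : Set (ℝ × ℝ)) (ψ : ℝ × ℝ → ℝ) (ε : ℝ), 0 < ε →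
        -- `ψ` is `C²` up to the boundary of the region and solves the equation there
        IsOpen U → region M R₀ τmax ⊆ U → ContDiffOn ℝ 2 ψ U →
        (∀ p ∈ region M R₀ τmax, box M ψ p = nonlinearity M A ψ p) →
        -- the initial value is supported in `r ≤ Rs`
        (∀ p ∈ leaf M R₀ 0, Rs < p.2 → ψ p = 0) →
        -- the three bootstrap assumptions
        (∀ τ₀ : ℝ, 0 ≤ τ₀ → (τ₀ : EReal) < τmax →
          intS M R₀ τ₀ (fun p => nonlinearity M A ψ p ^ 2)
            ≤ ENNReal.ofReal (Cα * ε ^ 2 * (1 + τ₀) ^ (-2 + α)) * E₀ M R₀ ε ψ) →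
        (∀ τ₁ τ₂ : ℝ, 0 ≤ τ₁ → τ₁ < τ₂ → (τ₂ : EReal) < τmax →
          bulkS M R₀ τ₁ τ₂ (fun p => nonlinearity M A ψ p ^ 2)
            ≤ ENNReal.ofReal (Cα * ε ^ 2 * (1 + τ₁) ^ (-2 + α)) * E₀ M R₀ ε ψ) →
        (∀ τ₁ τ₂ : ℝ, 0 ≤ τ₁ → τ₁ < τ₂ → (τ₂ : EReal) < τmax →
          bulkN M R₀ τ₁ τ₂ (fun p => p.2 ^ (3 - α) * nonlinearity M A ψ p ^ 2)
            ≤ ENNReal.ofReal (Cα * ε ^ 2 * (1 + τ₁) ^ (-2 + α)) * E₀ M R₀ ε ψ) →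
        ∀ τ : ℝ, 0 ≤ τ → (τ : EReal) < τmax →
          degenerateEnergy M R₀ ψ τ
            ≤ ENNReal.ofReal (C * ε ^ 2 * (1 + τ) ^ (-2 + α)) * E₀ M R₀ ε ψ := by
  have hpi : 0 < 4 * Real.pi := by linarith [one_le_four_pi]
  -- R₁ = max R₀ Rs + 1 lies beyond the support and leaves a piece of N_0 of radial length at least
  -- one, as `exists_hardy` requires.
  have hRs : Rs < max R₀ Rs + 1 := by linarith [le_max_right R₀ Rs]
  have hR₁ : R₀ + 1 ≤ max R₀ Rs + 1 := by linarith [le_max_left R₀ Rs]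
  obtain ⟨B, hB, henergy⟩ := exists_energyDensity_le (q := 2 - α) hM hR₀ (by linarith) (by linarith) hRs hR₁
  refine ⟨4 * Real.pi * (B * (2 + Cα)), by positivity, ?_⟩
  intro A hA _ τmax U ψ ε hε hU hreg hψ hbox hsupp hA1 hA2 hA3 τ hτ hτmax
  have hl : 0 < 1 + τ := by linarith
  have hΛ : 0 < (1 + τ) ^ (-2 + α) := Real.rpow_pos_of_pos hl _
  -- For infinite initial energy the right-hand side is infinite, its coefficient being positive.
  -- Otherwise all bounds can be read in the reals.
  by_cases hE : E₀ M R₀ ε ψ = ⊤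
  · rw [hE, ENNReal.mul_top (ENNReal.ofReal_pos.2 (by positivity)).ne']
    exact le_top
  have cF := continuousOn_nonlinearity M hA.continuous hU hψ
  have hlt : ∀ {t : ℝ}, t ≤ τ → (t : EReal) < τmax := fun ht =>
    lt_of_le_of_lt (EReal.coe_le_coe_iff.2 ht) hτmax
  have hS : ∀ t ∈ Set.Icc 0 τ, ∀ r ∈ Set.Icc M R₀, pointS t r ∈ region M R₀ τmax := fun t ht r hr =>
    pointS_mem_region ht.1 (hlt ht.2) hr
  have hN : ∀ t ∈ Set.Icc 0 τ, ∀ r ∈ Set.Ici R₀, pointN M R₀ t r ∈ region M R₀ τmax := fun t ht r hr =>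
    pointN_mem_region hM hR₀ ht.1 (hlt ht.2) hr
  have hpos : ∀ {s : ℝ}, 0 ≤ s → 0 ≤ Cα * ε ^ 2 * (1 + s) ^ (-2 + α) := fun hs => by positivity
  have hq : -(2 - α) = -2 + α := by ring
  have hq' : 1 + (2 - α) = 3 - α := by ring
  obtain ⟨E, hEE⟩ : ∃ E, E = (E₀ M R₀ ε ψ).toReal := ⟨_, rfl⟩
  have hE0 : 0 ≤ E := hEE ▸ ENNReal.toReal_nonneg
  have hK : ∀ s : ℝ, Cα * ε ^ 2 * (1 + s) ^ (-2 + α) * E = Cα * ε ^ 2 * E * (1 + s) ^ (-(2 - α)) :=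
    fun s => by rw [hq]; ring
  obtain ⟨d1, d2⟩ := data_le hM hR₀ (R₁ := max R₀ Rs + 1) (by linarith) hε hU hψ
    (fun r hr => hreg (hS 0 ⟨le_rfl, hτ⟩ r hr)) (fun r hr => hreg (hN 0 ⟨le_rfl, hτ⟩ r hr)) hE
  rw [← hEE] at d1 d2
  rw [degenerateEnergy_eq_iSup hM hR₀ hU hψ (fun r hr => hreg (hS τ ⟨hτ, le_rfl⟩ r hr))
    fun r hr => hreg (hN τ ⟨hτ, le_rfl⟩ r hr)]
  refine iSup_le fun n => ?_
  have hn : R₀ ≤ R₀ + n := by have : (0 : ℝ) ≤ n := Nat.cast_nonneg n; linarith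
  have key := henergy U ψ (nonlinearity M A ψ) τ (Cα * ε ^ 2 * E) (R₀ + n) hU hψ cF hτ (by positivity) hn
    (fun t ht r hr => ⟨hreg (hS t ht r hr), hbox _ (hS t ht r hr)⟩)
    (fun t ht r hr => ⟨hreg (hN t ht r hr), hbox _ (hN t ht r hr)⟩)
    (fun r hr hrs => hsupp _ (Or.inr (pointN_mem_leafN hM hR₀ hr)) hrs)
    (fun s hs => by
      rw [← hK, hEE]
      exact sourceS_le hM hR₀ cF hE (hpos hs.1) (fun r hr => hreg (hS s hs r hr))
        (hA1 s hs.1 (hlt hs.2)))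
    (fun s hs => by
      rw [← hK, hEE]
      exact integral_sourceS_le hM hR₀ cF hE (hpos hs.1) hs.2.le
        (fun t ht r hr => hreg (hS t ⟨hs.1.trans ht.1, ht.2⟩ r hr)) (hA2 s τ hs.1 hs.2 hτmax))
    (fun Rb hRb s hs => by
      rw [← hK, hEE]
      exact integral_sourceN_le hM hR₀ cF hE (hpos hs.1) hs.2.le hRb
        (fun t ht r hr => hreg (hN t ⟨hs.1.trans ht.1, ht.2⟩ r hr))
        (by rw [hq']; exact hA3 s τ hs.1 hs.2 hτmax))
  rw [hq] at key
  rw [← ENNReal.ofReal_toReal hE, ← hEE, ← ENNReal.ofReal_mul (by positivity)]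
  refine ENNReal.ofReal_le_ofReal ((mul_le_mul_of_nonneg_left key hpi.le).trans ?_)
  have h1 : dataS M R₀ ψ + dataN M R₀ (max R₀ Rs + 1) ψ + Cα * ε ^ 2 * E ≤ (2 + Cα) * (ε ^ 2 * E) := by
    linear_combination d1 + d2
  calc _ ≤ 4 * Real.pi * (B * ((2 + Cα) * (ε ^ 2 * E) * (1 + τ) ^ (-2 + α))) :=
        mul_le_mul_of_nonneg_left (mul_le_mul_of_nonneg_left
          (mul_le_mul_of_nonneg_right h1 hΛ.le) hB.le) hpi.le
    _ = _ := by ring
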